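/- Let $N\ge 1$, let $\omega\in\mathbb{C}$ be a primitive $N$-th root of unity, and let $\mathbb{Z}_N=\mathbb{Z}/N\mathbb{Z}$. Let $z\in \mathrm{C}(\mathbb{Z}_N)$ be the function $z(t)=\omega^t$. **The algebra.** $\mathrm{C}(\mathrm{S}_N^+(\mathrm{R}))$ is the universal unital C*-algebra with generators $q_{ij}$, $i,j\in\mathbb{Z}_N$, and the relations, for all $i,j,k\in\mathbb{Z}_N$, (a) $q_{0i}=q_{i0}=\delta_{i0}1$; (b) $q_{ij}^*=\omega^{-i(i-j)}q_{-i,-j}$; (c) $q_{k,i+j}=\sum_{l\in\mathbb{Z}_N}\omega^{-l(i-k+l)}q_{k-l,i}q_{lj}$; (d) $q_{i+j,k}=\sum_{l\in\mathbb{Z}_N}\omega^{-i(l-j)}q_{jl}q_{i,k-l}$. It carries the $\mathbb{Z}_N$-action $\rho_t(q_{ij})=\omega^{t(j-i)}q_{ij}$, that is, the coaction of $\mathrm{C}(\mathbb{Z}_N)$ that sends $a$ to the function $t\mapsto\rho_t(a)$ in $\mathrm{C}(\mathbb{Z}_N,\mathrm{C}(\mathrm{S}_N^+(\mathrm{R})))$.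 **Braided tensor products.** Let $X,Y$ be unital C*-algebras with $\mathbb{Z}_N$-actions, represented faithfully and covariantly on Hilbert spaces $\mathcal{L}^X,\mathcal{L}^Y$ with unitary representations $\pi^X,\pi^Y$ of $\mathbb{Z}_N$. A vector $\xi$ has degree $m$ if $\pi(t)\xi=\omega^{tm}\xi$ for all $t$. Let $c:\mathcal{L}^X\otimes\mathcal{L}^Y\to\mathcal{L}^Y\otimes\mathcal{L}^X$ be the unitary with $c(\xi\otimes\eta)=\omega^{mn}\eta\otimes\xi$ for $\xi$ of degree $m$ and $\eta$ of degree $n$. Then $X\boxtimes_{\mathrm{R}}Y\subseteq\mathbb{B}(\mathcal{L}^X\otimes\mathcal{L}^Y)$ is the C*-algebra generated by the elements $j_1(x)j_2(y)$, $x\in X$, $y\in Y$, where $j_1(x)=x\otimes 1$ and $j_2(y)=c^{-1}(y\otimes 1)c$; it carries the $\mathbb{Z}_N$-action for which $j_1,j_2$ are equivariant. The algebra $\mathrm{C}(\mathbb{Z}_N)$, with the action $(\rho_tf)(s)=f(s+t)$, is represented on $\ell^2(\mathbb{Z}_N)$ by multiplication, and $\mathrm{C}(\mathrm{S}_N^+(\mathrm{R}))$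 on any Hilbert space $\mathcal{L}$ that carries a faithful covariant representation. **The bosonization.** There is a unique unital $*$-homomorphism $\Delta:\mathrm{C}(\mathrm{S}_N^+(\mathrm{R}))\to\mathrm{C}(\mathrm{S}_N^+(\mathrm{R}))\boxtimes_{\mathrm{R}}\mathrm{C}(\mathrm{S}_N^+(\mathrm{R}))$ with $\Delta(q_{ij})=\sum_k j_1(q_{ik})j_2(q_{kj})$. For $X=Y=\mathrm{C}(\mathrm{S}_N^+(\mathrm{R}))$ let $$\psi:\mathrm{C}(\mathbb{Z}_N)\boxtimes_{\mathrm{R}}X\boxtimes_{\mathrm{R}}Y\to(\mathrm{C}(\mathbb{Z}_N)\boxtimes_{\mathrm{R}}X)\otimes(\mathrm{C}(\mathbb{Z}_N)\boxtimes_{\mathrm{R}}Y)$$ (minimal tensor product on the right) be the unital $*$-homomorphism determined by $\psi(j_1(f))=(j_1\otimes j_1)(\Delta_{\mathbb{Z}_N}(f))$ with $\Delta_{\mathbb{Z}_N}(f)(s,t)=f(s+t)$, $\psi(j_2(a))=(j_2\otimes j_1)(\rho(a))=\sum_t j_2(\rho_t(a))\otimes j_1(\delta_t)$, and $\psi(j_3(b))=1\otimes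 j_2(b)$. The bosonization $\mathrm{S}_N^+(\mathrm{R})\rtimes\mathbb{Z}_N$ is the C*-algebra $\mathrm{C}(\mathrm{S}_N^+(\mathrm{R})\rtimes\mathbb{Z}_N)=\mathrm{C}(\mathbb{Z}_N)\boxtimes_{\mathrm{R}}\mathrm{C}(\mathrm{S}_N^+(\mathrm{R}))$ with the comultiplication $\Delta_{\rtimes}=\psi\circ(\mathrm{id}\boxtimes_{\mathrm{R}}\Delta)$, where $(\mathrm{id}\boxtimes_{\mathrm{R}}\Delta)(j_1(f)j_2(a))=j_1(f)j_2(\Delta(a))$; this comultiplication exists and is uniquely determined. **Theorem.** Write $z$ for $j_1(z)$ and $q_{ij}$ for $j_2(q_{ij})$. Then $\mathrm{C}(\mathrm{S}_N^+(\mathrm{R})\rtimes\mathbb{Z}_N)$ is the universal unital C*-algebra generated by $z$ and $q_{ij}$, $i,j\in\mathbb{Z}_N$, subject to (1) $zz^*=z^*z=1=z^N$; (2) $zq_{ij}=\omega^{j-i}q_{ij}z$ for all $i,j$; (3) the relations (a)-(d). That is, it is the crossed product of $\mathrm{C}(\mathrm{S}_N^+(\mathrm{R}))$ by the action $\rho$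 of $\mathbb{Z}_N$, where $z$ is the unitary that implements $\rho_1$. Furthermore, for all $i,j\in\mathbb{Z}_N$, $$\Delta_{\rtimes}(z)=z\otimes z,\qquad \Delta_{\rtimes}(q_{ij})=\sum_{k\in\mathbb{Z}_N}q_{ik}\otimes z^{k-i}q_{kj}.$$ -/

import Mathlib

open scoped TensorProduct ComplexOrder
open UniformSpace

universe u v w

set_option linter.unusedSectionVars false

namespace Anyonic

noncomputable section


/-! ## The free unital `*`-algebra -/

/-- The free unital complex `*`-algebra on a set `X`: the free algebra on letters `x` and `x^*`
(`Sum.inl x` and `Sum.inr x`), with the conjugate-linear antimultiplicative involution that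
exchanges `x` and `x^*`. -/
def FreeStar (X : Type u) : Type u := FreeAlgebra ℂ (X ⊕ X)

namespace FreeStar

variable {X : Type u}

instance : Ring (FreeStar X) := inferInstanceAs (Ring (FreeAlgebra ℂ (X ⊕ X)))
instance : Algebra ℂ (FreeStar X) := inferInstanceAs (Algebra ℂ (FreeAlgebra ℂ (X ⊕ X)))

/-- The opposite of the free algebra, with the conjugate scalar multiplication. -/
def ConjOp (X : Type u) : Type u := (FreeStar X)ᵐᵒᵖ

instance : Ring (ConjOp X) := inferInstanceAs (Ring (FreeStar X)ᵐᵒᵖ)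

instance : Algebra ℂ (ConjOp X) :=
  RingHom.toAlgebra' ((algebraMap ℂ (FreeStar X)ᵐᵒᵖ).comp (starRingEnd ℂ))
    (fun c x => Algebra.commutes (A := (FreeStar X)ᵐᵒᵖ) (starRingEnd ℂ c) x)

/-- The involution, as a homomorphism to the conjugate opposite algebra. -/
def starAux (X : Type u) : FreeAlgebra ℂ (X ⊕ X) →ₐ[ℂ] ConjOp X :=
  FreeAlgebra.lift ℂ (fun s => (MulOpposite.op (FreeAlgebra.ι ℂ s.swap : FreeStar X) : ConjOp X))

/-- The involution as a map. -/
def starFun (x : FreeStar X) : FreeStar X :=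
  MulOpposite.unop (starAux X x : (FreeStar X)ᵐᵒᵖ)

/-- The letter `x` or its adjoint, as an element of the free `*`-algebra. -/
def letter (s : X ⊕ X) : FreeStar X := FreeAlgebra.ι ℂ s

/-- The generator `x`. -/
def gen (x : X) : FreeStar X := letter (Sum.inl x)

theorem starFun_letter (s : X ⊕ X) : starFun (letter s) = letter s.swap :=
  congrArg MulOpposite.unop (FreeAlgebra.lift_ι_apply (A := ConjOp X) _ s)

theorem starFun_add (a b : FreeStar X) : starFun (a + b) = starFun a + starFun b :=
  congrArg MulOpposite.unop (map_add (starAux X) a b)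

theorem starFun_mul (a b : FreeStar X) : starFun (a * b) = starFun b * starFun a :=
  congrArg MulOpposite.unop (map_mul (starAux X) a b)

theorem starFun_algebraMap (c : ℂ) :
    starFun (algebraMap ℂ (FreeStar X) c) = algebraMap ℂ (FreeStar X) (starRingEnd ℂ c) :=
  congrArg MulOpposite.unop ((starAux X).commutes c)

theorem induction {P : FreeStar X → Prop} (h0 : ∀ c : ℂ, P (algebraMap ℂ (FreeStar X) c))
    (h1 : ∀ s, P (letter s)) (hm : ∀ a b, P a → P b → P (a * b))
    (ha : ∀ a b, P a → P b → P (a + b)) (x : FreeStar X) : P x :=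
  FreeAlgebra.induction ℂ (X ⊕ X) (motive := P) h0 h1 hm ha x

instance : StarRing (FreeStar X) where
  star := starFun
  star_involutive x := by
    induction x using FreeStar.induction with
    | h0 c => rw [starFun_algebraMap, starFun_algebraMap, Complex.conj_conj]
    | h1 s => rw [starFun_letter, starFun_letter, Sum.swap_swap]
    | hm a b ha hb => rw [starFun_mul, starFun_mul, ha, hb]
    | ha a b ha hb => rw [starFun_add, starFun_add, ha, hb]
  star_mul := starFun_mul
  star_add := starFun_add

theorem star_letter (s : X ⊕ X) : star (letter s) = letter s.swap := starFun_letter s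

theorem star_algebraMap' (c : ℂ) :
    star (algebraMap ℂ (FreeStar X) c) = algebraMap ℂ (FreeStar X) (starRingEnd ℂ c) :=
  starFun_algebraMap c

instance : StarModule ℂ (FreeStar X) where
  star_smul c x := by
    rw [Algebra.smul_def, star_mul, star_algebraMap', Algebra.smul_def]
    exact (Algebra.commutes _ _).symm

section lift

variable {B : Type v} [Ring B] [StarRing B] [Algebra ℂ B] [StarModule ℂ B]

/-- Evaluation of `*`-polynomials at a family of elements of a `*`-algebra. -/
def lift (f : X → B) : FreeStar X →⋆ₐ[ℂ] B :=
  { (FreeAlgebra.lift ℂ (Sum.elim f (fun x => star (f x))) : FreeAlgebra ℂ (X ⊕ X) →ₐ[ℂ] B) with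
    map_star' := by
      intro x
      set g : FreeStar X →ₐ[ℂ] B :=
        (FreeAlgebra.lift ℂ (Sum.elim f (fun x => star (f x))) : FreeAlgebra ℂ (X ⊕ X) →ₐ[ℂ] B)
      have hg : ∀ s, g (letter s) = Sum.elim f (fun x => star (f x)) s := fun s =>
        FreeAlgebra.lift_ι_apply _ s
      change g (star x) = star (g x)
      induction x using FreeStar.induction with
      | h0 c =>
        rw [star_algebraMap', AlgHom.commutes, AlgHom.commutes]
        exact algebraMap_star_comm c
      | h1 s => rw [star_letter, hg, hg]; cases s <;> simp
      | hm a b ha hb => simp [ha, hb]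
      | ha a b ha hb => simp [ha, hb] }

theorem lift_gen (f : X → B) (x : X) : lift f (gen x) = f x :=
  FreeAlgebra.lift_ι_apply _ (Sum.inl x)

end lift

end FreeStar

/-! ## C*-seminorms and their completions -/

/-- A C*-seminorm on a complex `*`-algebra. -/
structure CStarSeminorm (F : Type u) [Ring F] [StarRing F] [Algebra ℂ F] extends
    Seminorm ℂ F where
  mul_le' : ∀ x y, toFun (x * y) ≤ toFun x * toFun y
  star_mul_self' : ∀ x, toFun (star x * x) = toFun x * toFun x

namespace CStarSeminorm

variable {F : Type u} [Ring F] [StarRing F] [Algebra ℂ F] [StarModule ℂ F]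

instance : CoeFun (CStarSeminorm F) (fun _ => F → ℝ) := ⟨fun p => p.toFun⟩

variable (p : CStarSeminorm F)

theorem nonneg (x : F) : 0 ≤ p x := apply_nonneg p.toSeminorm x

theorem le_star (x : F) : p x ≤ p (star x) := by
  rcases (p.nonneg x).eq_or_lt with h | h
  · rw [← h]; exact p.nonneg _
  · have := p.mul_le' (star x) x
    rw [p.star_mul_self'] at this
    exact le_of_mul_le_mul_right this h

theorem map_star (x : F) : p (star x) = p x :=
  le_antisymm (by simpa using p.le_star (star x)) (p.le_star x)

/-- The algebra `F`, to be equipped with the C*-seminorm `p`. -/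
@[nolint unusedArguments]
def Carrier (_ : CStarSeminorm F) : Type u := F

instance : Ring p.Carrier := inferInstanceAs (Ring F)
instance : StarRing p.Carrier := inferInstanceAs (StarRing F)
instance : Algebra ℂ p.Carrier := inferInstanceAs (Algebra ℂ F)
instance : StarModule ℂ p.Carrier := inferInstanceAs (StarModule ℂ F)

instance : Norm p.Carrier := ⟨fun x => p x⟩

instance : SeminormedAddCommGroup p.Carrier :=
  SeminormedAddCommGroup.ofCore (𝕜 := ℂ)
    { norm_nonneg := p.nonneg
      norm_smul := p.toSeminorm.smul'
      norm_triangle := p.toSeminorm.add_le' }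

instance : SeminormedRing p.Carrier :=
  { (inferInstance : SeminormedAddCommGroup p.Carrier), (inferInstance : Ring p.Carrier) with
    norm_mul_le := p.mul_le' }

instance : NormedAlgebra ℂ p.Carrier where
  __ := (inferInstance : Algebra ℂ p.Carrier)
  norm_smul_le c x := (p.toSeminorm.smul' c x).le

instance : NormedStarGroup p.Carrier where
  norm_star_le x := (p.map_star x).le

/-- The Hausdorff completion of `F` with respect to the C*-seminorm `p`. -/
def Compl : Type u := Completion p.Carrier

instance : NormedRing p.Compl := inferInstanceAs (NormedRing (Completion p.Carrier))
instance : CompleteSpace p.Compl := inferInstanceAs (CompleteSpace (Completion p.Carrier))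
instance : NormedAlgebra ℂ p.Compl where
  __ := (inferInstance : Algebra ℂ (Completion p.Carrier))
  norm_smul_le c x := norm_smul_le (β := Completion p.Carrier) c x

/-- The canonical map to the completion. -/
def coe (x : F) : p.Compl := Completion.coe' (α := p.Carrier) x

theorem norm_coe (x : F) : ‖p.coe x‖ = p x := Completion.norm_coe (E := p.Carrier) x

theorem coe_add (x y : F) : p.coe (x + y) = p.coe x + p.coe y :=
  Completion.coe_add (α := p.Carrier) x y

theorem coe_mul (x y : F) : p.coe (x * y) = p.coe x * p.coe y :=
  Completion.coe_mul (α := p.Carrier) x y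

theorem coe_algebraMap (c : ℂ) : p.coe (algebraMap ℂ F c) = algebraMap ℂ p.Compl c := rfl

theorem isometry_coe : Isometry (fun x : p.Carrier => p.coe x) := Completion.coe_isometry

theorem denseRange_coe : DenseRange (fun x : p.Carrier => p.coe x) := Completion.denseRange_coe

theorem induction {P : p.Compl → Prop} (x : p.Compl) (hc : IsClosed {x | P x})
    (h : ∀ a : F, P (p.coe a)) : P x :=
  Completion.induction_on (α := p.Carrier) x hc h

instance : Star p.Compl := ⟨Completion.map (fun x : p.Carrier => star x)⟩

theorem coe_star (x : F) : p.coe (star x) = star (p.coe x) :=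
  (Completion.map_coe (α := p.Carrier) (β := p.Carrier)
    (starₗᵢ ℂ : p.Carrier ≃ₗᵢ⋆[ℂ] p.Carrier).isometry.uniformContinuous x).symm

instance : ContinuousStar p.Compl := ⟨Completion.continuous_map⟩

instance : StarRing p.Compl where
  star_involutive x := by
    induction x using p.induction with
    | hc => exact isClosed_eq (by fun_prop) (by fun_prop)
    | h a => rw [← coe_star, ← coe_star, star_star]
  star_mul x y := by
    induction x using p.induction with
    | hc => exact isClosed_eq (by fun_prop) (by fun_prop)
    | h a =>
      induction y using p.induction with
      | hc => exact isClosed_eq (by fun_prop) (by fun_prop)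
      | h b => rw [← coe_mul, ← coe_star, ← coe_star, ← coe_star, star_mul, coe_mul]
  star_add x y := by
    induction x using p.induction with
    | hc => exact isClosed_eq (by fun_prop) (by fun_prop)
    | h a =>
      induction y using p.induction with
      | hc => exact isClosed_eq (by fun_prop) (by fun_prop)
      | h b => rw [← coe_add, ← coe_star, ← coe_star, ← coe_star, star_add, coe_add]

theorem coe_smul (c : ℂ) (x : F) : p.coe (c • x) = c • p.coe x := by
  rw [Algebra.smul_def, coe_mul, coe_algebraMap, Algebra.smul_def]

instance : CStarRing p.Compl where
  norm_mul_self_le x := by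
    induction x using p.induction with
    | hc =>
      exact isClosed_le (continuous_norm.mul continuous_norm)
        (continuous_norm.comp (continuous_star.mul continuous_id))
    | h a => rw [← coe_star, ← coe_mul, norm_coe, norm_coe, p.star_mul_self']

instance : StarModule ℂ p.Compl where
  star_smul c x := by
    induction x using p.induction with
    | hc =>
      exact isClosed_eq (continuous_star.comp (continuous_const_smul c))
        ((continuous_const_smul _).comp continuous_star)
    | h a => rw [← coe_smul, ← coe_star, ← coe_star, ← coe_smul, star_smul]

instance : CStarAlgebra p.Compl where

/-- The canonical `*`-homomorphism to the completion. -/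
def toCompl : F →⋆ₐ[ℂ] p.Compl where
  toFun := p.coe
  map_one' := rfl
  map_mul' := p.coe_mul
  map_zero' := rfl
  map_add' := p.coe_add
  commutes' := p.coe_algebraMap
  map_star' := p.coe_star

theorem norm_toCompl (x : F) : ‖p.toCompl x‖ = p x := p.norm_coe x

theorem denseRange_toCompl : DenseRange p.toCompl := p.denseRange_coe

section lift

variable {p} {B : Type v} [CStarAlgebra B] (φ : F →⋆ₐ[ℂ] B) (h : ∀ x, ‖φ x‖ ≤ p x)

theorem lipschitz_aux (h : ∀ x, ‖φ x‖ ≤ p x) : LipschitzWith 1 (fun x : p.Carrier => φ x) :=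
  LipschitzWith.of_dist_le_mul fun x y => by
    rw [NNReal.coe_one, one_mul, dist_eq_norm, dist_eq_norm]
    exact (map_sub φ (x : F) y) ▸ h (x - y : F)

/-- The extension of a `*`-homomorphism dominated by `p` to the completion, as a map. -/
def liftFun : p.Compl → B := Completion.extension (fun x : p.Carrier => φ x)

theorem continuous_liftFun : Continuous (liftFun (p := p) φ) := Completion.continuous_extension

theorem liftFun_coe (h : ∀ x, ‖φ x‖ ≤ p x) (x : F) : liftFun φ (p.coe x) = φ x :=
  Completion.extension_coe (lipschitz_aux φ h).uniformContinuous x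

/-- The extension of a `*`-homomorphism dominated by `p` to the completion. -/
def lift : p.Compl →⋆ₐ[ℂ] B where
  toFun := liftFun φ
  map_one' := (liftFun_coe φ h 1).trans (map_one φ)
  map_zero' := (liftFun_coe φ h 0).trans (map_zero φ)
  commutes' c := (liftFun_coe φ h (algebraMap ℂ F c)).trans (AlgHomClass.commutes φ c)
  map_mul' x y := by
    have := continuous_liftFun (p := p) φ
    induction x using p.induction with
    | hc => exact isClosed_eq (by fun_prop) (by fun_prop)
    | h a =>
      induction y using p.induction with
      | hc => exact isClosed_eq (by fun_prop) (by fun_prop)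
      | h b => rw [← coe_mul, liftFun_coe φ h, liftFun_coe φ h, liftFun_coe φ h, map_mul]
  map_add' x y := by
    have := continuous_liftFun (p := p) φ
    induction x using p.induction with
    | hc => exact isClosed_eq (by fun_prop) (by fun_prop)
    | h a =>
      induction y using p.induction with
      | hc => exact isClosed_eq (by fun_prop) (by fun_prop)
      | h b => rw [← coe_add, liftFun_coe φ h, liftFun_coe φ h, liftFun_coe φ h, map_add]
  map_star' x := by
    have := continuous_liftFun (p := p) φ
    induction x using p.induction with
    | hc => exact isClosed_eq (by fun_prop) (by fun_prop)
    | h a => rw [← coe_star, liftFun_coe φ h, liftFun_coe φ h, StarHomClass.map_star φ]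

theorem lift_toCompl (x : F) : lift φ h (p.toCompl x) = φ x := liftFun_coe φ h x

end lift

/-- The C*-seminorm obtained from a `*`-homomorphism to a C*-algebra. -/
def ofHom {B : Type v} [CStarAlgebra B] (φ : F →⋆ₐ[ℂ] B) : CStarSeminorm F where
  toFun x := ‖φ x‖
  map_zero' := by simp
  add_le' x y := by rw [map_add]; exact norm_add_le _ _
  neg' x := by simp
  smul' c x := by rw [map_smul, norm_smul]
  mul_le' x y := by rw [map_mul]; exact norm_mul_le _ _
  star_mul_self' x := by rw [map_mul, StarHomClass.map_star, CStarRing.norm_star_mul_self]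

/-- The C*-seminorms that vanish on a set of relators. -/
def Kills (S : Set F) (p : CStarSeminorm F) : Prop := ∀ r ∈ S, p r = 0

/-- The largest C*-seminorm that vanishes on a set of relators, when it is finite. -/
def largest (S : Set F)
    (hS : ∀ x, BddAbove (Set.range fun p : {p : CStarSeminorm F // p.Kills S} => p.1 x)) :
    CStarSeminorm F :=
  haveI : Nonempty {p : CStarSeminorm F // p.Kills S} :=
    ⟨⟨⟨0, fun _ _ => (zero_mul (0 : ℝ)).ge, fun _ => (zero_mul (0 : ℝ)).symm⟩, fun _ _ => rfl⟩⟩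
  { toFun x := ⨆ p : {p : CStarSeminorm F // p.Kills S}, p.1 x
    map_zero' := (iSup_congr fun p => p.1.map_zero').trans ciSup_const
    add_le' x y := ciSup_le fun p => (p.1.add_le' x y).trans
      (add_le_add (le_ciSup (hS x) p) (le_ciSup (hS y) p))
    neg' x := iSup_congr fun p => p.1.neg' x
    smul' c x := by
      rw [Real.mul_iSup_of_nonneg (norm_nonneg c)]
      exact iSup_congr fun p => p.1.smul' c x
    mul_le' x y := ciSup_le fun p => (p.1.mul_le' x y).trans
      (mul_le_mul (le_ciSup (hS x) p) (le_ciSup (hS y) p) (p.1.nonneg y)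
        (Real.iSup_nonneg fun p => p.1.nonneg x))
    star_mul_self' x := by
      apply le_antisymm
      · refine ciSup_le fun p => ?_
        rw [p.1.star_mul_self']
        exact mul_le_mul (le_ciSup (hS x) p) (le_ciSup (hS x) p) (p.1.nonneg x)
          (Real.iSup_nonneg fun p => p.1.nonneg x)
      · have h0 : 0 ≤ ⨆ p : {p : CStarSeminorm F // p.Kills S}, p.1 (star x * x) :=
          Real.iSup_nonneg fun p => p.1.nonneg _
        have h1 : (⨆ p : {p : CStarSeminorm F // p.Kills S}, p.1 x) ≤
            √(⨆ p : {p : CStarSeminorm F // p.Kills S}, p.1 (star x * x)) :=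
          ciSup_le fun p => Real.le_sqrt_of_sq_le <| by
            rw [sq, ← p.1.star_mul_self']
            exact le_ciSup (hS (star x * x)) p
        rw [← Real.mul_self_sqrt h0]
        exact mul_self_le_mul_self (Real.iSup_nonneg fun p => p.1.nonneg x) h1 }

theorem le_largest (S : Set F)
    (hS : ∀ x, BddAbove (Set.range fun p : {p : CStarSeminorm F // p.Kills S} => p.1 x))
    (p : CStarSeminorm F) (hp : p.Kills S) (x : F) : p x ≤ largest S hS x :=
  le_ciSup (hS x) ⟨p, hp⟩

theorem largest_kills (S : Set F)
    (hS : ∀ x, BddAbove (Set.range fun p : {p : CStarSeminorm F // p.Kills S} => p.1 x)) :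
    (largest S hS).Kills S := fun r hr =>
  haveI : Nonempty {p : CStarSeminorm F // p.Kills S} :=
    ⟨⟨⟨0, fun _ _ => (zero_mul (0 : ℝ)).ge, fun _ => (zero_mul (0 : ℝ)).symm⟩, fun _ _ => rfl⟩⟩
  (iSup_congr fun p => p.2 r hr).trans ciSup_const

end CStarSeminorm

/-! ## The algebra of functions on the anyonic quantum permutation group -/

section Perm

variable {N : ℕ} [NeZero N]

/-- The power `ω ^ k` of an `N`-th root of unity `ω`, for an exponent `k ∈ ℤ/Nℤ`. -/
def rpow (ω : ℂ) (k : ZMod N) : ℂ := ω ^ k.val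

/-- The defining relations of `C(S_N^+(R))`, for elements `q i j` of a unital `*`-algebra. -/
structure PermRel (ω : ℂ) {B : Type v} [Ring B] [StarRing B] [Algebra ℂ B]
    (q : ZMod N → ZMod N → B) : Prop where
  row_zero : ∀ i, q 0 i = if i = 0 then 1 else 0
  col_zero : ∀ i, q i 0 = if i = 0 then 1 else 0
  star_eq : ∀ i j, star (q i j) = rpow ω (-(i * (i - j))) • q (-i) (-j)
  mul_col : ∀ i j k,
    q k (i + j) = ∑ l, rpow ω (-(l * (i - k + l))) • (q (k - l) i * q l j)
  mul_row : ∀ i j k,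
    q (i + j) k = ∑ l, rpow ω (-(i * (l - j))) • (q j l * q i (k - l))

/-- The free unital `*`-algebra on letters `q i j` for `i, j ∈ ℤ/Nℤ`. -/
abbrev PermFree (N : ℕ) : Type := FreeStar (ZMod N × ZMod N)

/-- The letter `q i j`. -/
abbrev letterQ (i j : ZMod N) : PermFree N := FreeStar.gen (i, j)

/-- The defining relations of `C(S_N^+(R))`, as elements of the free `*`-algebra. -/
inductive PermRelator (ω : ℂ) : PermFree N → Prop
  | row_zero (i : ZMod N) : PermRelator ω (letterQ 0 i - if i = 0 then 1 else 0)
  | col_zero (i : ZMod N) : PermRelator ω (letterQ i 0 - if i = 0 then 1 else 0)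
  | star_eq (i j : ZMod N) :
      PermRelator ω (star (letterQ i j) - rpow ω (-(i * (i - j))) • letterQ (-i) (-j))
  | mul_col (i j k : ZMod N) :
      PermRelator ω (letterQ k (i + j) -
        ∑ l, rpow ω (-(l * (i - k + l))) • (letterQ (k - l) i * letterQ l j))
  | mul_row (i j k : ZMod N) :
      PermRelator ω (letterQ (i + j) k -
        ∑ l, rpow ω (-(i * (l - j))) • (letterQ j l * letterQ i (k - l)))

theorem permRel_of_kills (ω : ℂ) {B : Type v} [Ring B] [StarRing B] [Algebra ℂ B]
    (φ : PermFree N →⋆ₐ[ℂ] B) (h : ∀ r, PermRelator ω r → φ r = 0) :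
    PermRel ω (fun i j => φ (letterQ i j)) where
  row_zero i := by
    have := h _ (.row_zero i)
    rw [map_sub, sub_eq_zero] at this
    rw [this]; split_ifs <;> simp
  col_zero i := by
    have := h _ (.col_zero i)
    rw [map_sub, sub_eq_zero] at this
    rw [this]; split_ifs <;> simp
  star_eq i j := by
    have := h _ (.star_eq i j)
    rw [map_sub, sub_eq_zero, map_star, map_smul] at this
    exact this
  mul_col i j k := by
    have := h _ (.mul_col i j k)
    rw [map_sub, sub_eq_zero] at this
    simpa using this
  mul_row i j k := by
    have := h _ (.mul_row i j k)
    rw [map_sub, sub_eq_zero] at this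
    simpa using this

theorem kills_of_permRel (ω : ℂ) {B : Type v} [Ring B] [StarRing B] [Algebra ℂ B]
    (φ : PermFree N →⋆ₐ[ℂ] B) (h : PermRel ω (fun i j => φ (letterQ i j))) (r : PermFree N)
    (hr : PermRelator ω r) : φ r = 0 := by
  cases hr with
  | row_zero i =>
    rw [map_sub, sub_eq_zero, h.row_zero i]; split_ifs <;> simp
  | col_zero i =>
    rw [map_sub, sub_eq_zero, h.col_zero i]; split_ifs <;> simp
  | star_eq i j =>
    rw [map_sub, sub_eq_zero, map_star, map_smul]; exact h.star_eq i j
  | mul_col i j k =>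
    rw [map_sub, sub_eq_zero]; simpa using h.mul_col i j k
  | mul_row i j k =>
    rw [map_sub, sub_eq_zero]; simpa using h.mul_row i j k

theorem continuous_hom {A : Type u} {B : Type v} [CStarAlgebra A] [CStarAlgebra B]
    (φ : A →⋆ₐ[ℂ] B) : Continuous φ :=
  AddMonoidHomClass.continuous_of_bound φ 1 fun x => by
    simpa using NonUnitalStarAlgHom.norm_apply_le φ x

theorem norm_le_one_of_sum {B : Type v} [CStarAlgebra B] {ι : Type*} [Fintype ι] (a : ι → B)
    (h : ∑ l, star (a l) * a l = 1) (l : ι) : ‖a l‖ ≤ 1 := by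
  let _ := CStarAlgebra.spectralOrder B
  have _ := CStarAlgebra.spectralOrderedRing B
  have h1 : star (a l) * a l ≤ 1 := by
    rw [← h]
    exact Finset.single_le_sum (f := fun l => star (a l) * a l)
      (fun i _ => star_mul_self_nonneg (a i)) (Finset.mem_univ l)
  have h2 := (CStarAlgebra.norm_le_one_iff_of_nonneg _ (star_mul_self_nonneg (a l))).2 h1
  rw [CStarRing.norm_star_mul_self] at h2
  nlinarith [norm_nonneg (a l)]

theorem PermRel.norm_le_one {ω : ℂ} {B : Type v} [CStarAlgebra B]
    {q : ZMod N → ZMod N → B} (h : PermRel ω q) (i j : ZMod N) : ‖q i j‖ ≤ 1 := by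
  refine norm_le_one_of_sum (fun l => q l j) ?_ i
  have h1 := h.mul_col (-j) j 0
  rw [neg_add_cancel, h.row_zero 0, if_pos rfl] at h1
  rw [h1]
  refine Finset.sum_congr rfl fun l _ => ?_
  rw [h.star_eq, smul_mul_assoc, zero_sub]
  congr 2; ring

theorem perm_bddAbove (ω : ℂ) (x : PermFree N) :
    BddAbove (Set.range fun p : {p : CStarSeminorm (PermFree N) //
      p.Kills {r | PermRelator ω r}} => p.1 x) := by
  suffices H : ∃ M, ∀ p : CStarSeminorm (PermFree N), p.Kills {r | PermRelator ω r} → p x ≤ M by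
    obtain ⟨M, hM⟩ := H
    exact ⟨M, by rintro _ ⟨p, rfl⟩; exact hM p.1 p.2⟩
  induction x using FreeStar.induction with
  | h0 c =>
    refine ⟨‖c‖, fun p _ => ?_⟩
    have h1 : p (1 : PermFree N) ≤ 1 := by
      have := p.star_mul_self' 1
      rw [star_one, mul_one] at this
      nlinarith [p.nonneg 1]
    rw [Algebra.algebraMap_eq_smul_one]
    exact (p.smul' c 1).trans_le (mul_le_of_le_one_right (norm_nonneg c) h1)
  | h1 s =>
    refine ⟨1, fun p hp => ?_⟩
    have h : ∀ i j, p (letterQ i j) ≤ 1 := fun i j => by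
      rw [← p.norm_toCompl]
      refine (permRel_of_kills ω p.toCompl fun r hr => ?_).norm_le_one i j
      rw [← norm_eq_zero, p.norm_toCompl]
      exact hp r hr
    rcases s with ⟨i, j⟩ | ⟨i, j⟩
    · exact h i j
    · have : (FreeStar.letter (Sum.inr (i, j)) : PermFree N) = star (letterQ i j) :=
        (FreeStar.star_letter (Sum.inl (i, j))).symm
      rw [this, p.map_star]
      exact h i j
  | hm a b ha hb =>
    obtain ⟨M, hM⟩ := ha
    obtain ⟨M', hM'⟩ := hb
    exact ⟨M * M', fun p hp => (p.mul_le' a b).trans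
      (mul_le_mul (hM p hp) (hM' p hp) (p.nonneg b) ((p.nonneg a).trans (hM p hp)))⟩
  | ha a b ha hb =>
    obtain ⟨M, hM⟩ := ha
    obtain ⟨M', hM'⟩ := hb
    exact ⟨M + M', fun p hp => (p.add_le' a b).trans (add_le_add (hM p hp) (hM' p hp))⟩

/-- The largest C*-seminorm on the universal unital `*`-algebra with generators `q i j` and the
relations `PermRel`, that is, the largest C*-seminorm on the free `*`-algebra that vanishes on the
relations. -/
def permSeminorm (ω : ℂ) : CStarSeminorm (PermFree N) :=
  CStarSeminorm.largest {r | PermRelator ω r} (perm_bddAbove ω)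

variable (N) in
/-- The universal unital C*-algebra `C(S_N^+(R))` with generators `q i j` for `i, j ∈ ℤ/Nℤ` and the
relations `PermRel`. -/
abbrev CPerm (ω : ℂ) : Type := (permSeminorm (N := N) ω).Compl

namespace CPerm

variable {ω : ℂ}

/-- The generators of `C(S_N^+(R))`. -/
def q (ω : ℂ) (i j : ZMod N) : CPerm N ω := (permSeminorm ω).toCompl (letterQ i j)

theorem rel (ω : ℂ) : PermRel (N := N) ω (q ω) :=
  permRel_of_kills ω (permSeminorm ω).toCompl fun r hr => by
    rw [← norm_eq_zero, CStarSeminorm.norm_toCompl]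
    exact CStarSeminorm.largest_kills _ (perm_bddAbove ω) r hr

section lift

variable {B : Type v} [CStarAlgebra B] {b : ZMod N → ZMod N → B}

/-- The universal property of `C(S_N^+(R))`. -/
def lift (h : PermRel ω b) : CPerm N ω →⋆ₐ[ℂ] B :=
  CStarSeminorm.lift (p := permSeminorm ω)
    (FreeStar.lift (fun x : ZMod N × ZMod N => b x.1 x.2))
    (fun x => CStarSeminorm.le_largest _ (perm_bddAbove ω)
      (CStarSeminorm.ofHom (FreeStar.lift (fun x : ZMod N × ZMod N => b x.1 x.2)))
      (fun r hr => norm_eq_zero.2 <| kills_of_permRel ω _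
        (by simpa only [letterQ, FreeStar.lift_gen] using h) r hr) x)

theorem lift_q (h : PermRel ω b) (i j : ZMod N) : lift h (q ω i j) = b i j :=
  (CStarSeminorm.lift_toCompl _ _ _).trans (FreeStar.lift_gen _ _)

theorem hom_ext {φ ψ : CPerm N ω →⋆ₐ[ℂ] B} (h : ∀ i j, φ (q ω i j) = ψ (q ω i j)) : φ = ψ := by
  have hφ : Continuous φ := continuous_hom φ
  have hψ : Continuous ψ := continuous_hom ψ
  refine StarAlgHom.ext fun x => congrFun ((permSeminorm ω).denseRange_toCompl.equalizer hφ hψ ?_) x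
  funext x
  change φ ((permSeminorm ω).toCompl x) = ψ ((permSeminorm ω).toCompl x)
  induction x using FreeStar.induction with
  | h0 c => simp only [AlgHomClass.commutes]
  | h1 s =>
    rcases s with ⟨i, j⟩ | ⟨i, j⟩
    · exact h i j
    · have : (FreeStar.letter (Sum.inr (i, j)) : PermFree N) = star (letterQ i j) :=
        (FreeStar.star_letter (Sum.inl (i, j))).symm
      rw [this, map_star, map_star, map_star]
      exact congrArg star (h i j)
  | hm a b ha hb => simp only [map_mul, ha, hb]
  | ha a b ha hb => simp only [map_add, ha, hb]

end lift

end CPerm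

end Perm

/-! ## `ℤ/Nℤ`-C*-algebras and their covariant representations -/

/-- The structure of a `ℤ/Nℤ`-C*-algebra on a unital C*-algebra `A`. Under
`A ⊗ C(ℤ/Nℤ) = C(ℤ/Nℤ, A)` the coaction is `a ↦ (t ↦ ρ t a)`; its coassociativity is `ρ_add`, and,
given this, the density of `ρ(A)(1 ⊗ C(ℤ/Nℤ))` is `ρ_zero`. -/
structure ZNAction (N : ℕ) (A : Type u) [CStarAlgebra A] where
  ρ : ZMod N → (A →⋆ₐ[ℂ] A)
  ρ_zero : ∀ a, ρ 0 a = a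
  ρ_add : ∀ s t a, ρ (s + t) a = ρ s (ρ t a)

/-- A faithful `ℤ/Nℤ`-equivariant representation of a `ℤ/Nℤ`-C*-algebra on a Hilbert space with a
unitary representation of `ℤ/Nℤ`. -/
structure CovRep {N : ℕ} {A : Type u} [CStarAlgebra A] (α : ZNAction N A)
    (H : Type v) [NormedAddCommGroup H] [InnerProductSpace ℂ H] [CompleteSpace H] where
  U : Multiplicative (ZMod N) →* unitary (H →L[ℂ] H)
  π : A →⋆ₐ[ℂ] (H →L[ℂ] H)
  faithful : Function.Injective π
  covariant : ∀ (t : ZMod N) (a : A),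
    π (α.ρ t a) = U (.ofAdd t) * π a * star (U (.ofAdd t) : H →L[ℂ] H)

section Roots

variable {N : ℕ} [NeZero N] {ω : ℂ}

theorem rpow_natCast (hω : IsPrimitiveRoot ω N) (n : ℕ) : rpow ω (n : ZMod N) = ω ^ n := by
  rw [rpow, ZMod.val_natCast]
  exact (pow_eq_pow_mod n hω.pow_eq_one).symm

theorem rpow_zero : rpow ω (0 : ZMod N) = 1 := by simp [rpow]

theorem rpow_add (hω : IsPrimitiveRoot ω N) (a b : ZMod N) :
    rpow ω (a + b) = rpow ω a * rpow ω b := by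
  rw [← ZMod.natCast_zmod_val a, ← ZMod.natCast_zmod_val b, ← Nat.cast_add, rpow_natCast hω,
    rpow_natCast hω, rpow_natCast hω, pow_add]

theorem rpow_mul_neg (hω : IsPrimitiveRoot ω N) (a : ZMod N) : rpow ω a * rpow ω (-a) = 1 := by
  rw [← rpow_add hω, add_neg_cancel, rpow_zero]

theorem rpow_neg_mul (hω : IsPrimitiveRoot ω N) (a : ZMod N) : rpow ω (-a) * rpow ω a = 1 := by
  rw [mul_comm, rpow_mul_neg hω]

theorem star_rpow (hω : IsPrimitiveRoot ω N) (a : ZMod N) : star (rpow ω a) = rpow ω (-a) := by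
  have h : ‖rpow ω a‖ = 1 := by
    rw [rpow, norm_pow, hω.norm'_eq_one (NeZero.ne N), one_pow]
  have h1 : rpow ω a * star (rpow ω a) = 1 := by
    rw [Complex.star_def, Complex.mul_conj, Complex.normSq_eq_norm_sq, h]; simp
  have h0 : rpow ω a ≠ 0 := fun h' => by simp [h'] at h1
  exact mul_left_cancel₀ h0 (h1.trans (rpow_mul_neg hω a).symm)

theorem sum_rpow (hω : IsPrimitiveRoot ω N) (m : ZMod N) :
    ∑ t : ZMod N, rpow ω (t * m) = if m = 0 then (N : ℂ) else 0 := by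
  split_ifs with hm
  · simp [hm, rpow_zero]
  · have h1 : rpow ω m ≠ 1 := fun h => hm <| by
      have := (hω.pow_eq_one_iff_dvd m.val).1 h
      rw [← ZMod.natCast_zmod_val m]
      exact (ZMod.natCast_eq_zero_iff _ _).2 this
    have h2 : rpow ω m * ∑ t : ZMod N, rpow ω (t * m) = ∑ t : ZMod N, rpow ω (t * m) := by
      rw [Finset.mul_sum]
      refine Fintype.sum_equiv (Equiv.addRight (1 : ZMod N)) _ _ fun t => ?_
      rw [← rpow_add hω]; congr 1
      simp only [Equiv.coe_addRight]; ring
    have h3 : (rpow ω m - 1) * ∑ t : ZMod N, rpow ω (t * m) = 0 := by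
      rw [sub_mul, h2, one_mul, sub_self]
    exact (mul_eq_zero.1 h3).resolve_left (sub_ne_zero.2 h1)

end Roots

/-! ## Hilbert space tensor products -/

section Hilbert

variable {H : Type u} [NormedAddCommGroup H] [InnerProductSpace ℂ H]
variable {K : Type v} [NormedAddCommGroup K] [InnerProductSpace ℂ K]
variable {H' : Type*} [NormedAddCommGroup H'] [InnerProductSpace ℂ H']
variable {K' : Type*} [NormedAddCommGroup K'] [InnerProductSpace ℂ K']

variable (H K) in
/-- The tensor product of Hilbert spaces. -/
def HTensor : Type (max u v) := Completion (H ⊗[ℂ] K)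

instance : NormedAddCommGroup (HTensor H K) :=
  inferInstanceAs (NormedAddCommGroup (Completion (H ⊗[ℂ] K)))

instance : InnerProductSpace ℂ (HTensor H K) :=
  inferInstanceAs (InnerProductSpace ℂ (Completion (H ⊗[ℂ] K)))

instance : CompleteSpace (HTensor H K) :=
  inferInstanceAs (CompleteSpace (Completion (H ⊗[ℂ] K)))

/-- The embedding of the algebraic tensor product. -/
def coeT : H ⊗[ℂ] K →L[ℂ] HTensor H K :=
  (Completion.toComplL : H ⊗[ℂ] K →L[ℂ] Completion (H ⊗[ℂ] K))

/-- An elementary tensor. -/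
def elem (h : H) (k : K) : HTensor H K := coeT (h ⊗ₜ[ℂ] k)

/-- The extension of a bounded operator to the completed tensor products. -/
def extT (T : H ⊗[ℂ] K →L[ℂ] H' ⊗[ℂ] K') : HTensor H K →L[ℂ] HTensor H' K' :=
  (T.completion : Completion (H ⊗[ℂ] K) →L[ℂ] Completion (H' ⊗[ℂ] K'))

/-- The tensor product of bounded operators. -/
def opT (S : H →L[ℂ] H') (T : K →L[ℂ] K') : HTensor H K →L[ℂ] HTensor H' K' :=
  extT (TensorProduct.mapL S T)

variable (H K) in
/-- The flip `h ⊗ k ↦ k ⊗ h`. -/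
def flipT : HTensor H K →L[ℂ] HTensor K H :=
  extT ((TensorProduct.commIsometry ℂ H K).toContinuousLinearEquiv : H ⊗[ℂ] K →L[ℂ] K ⊗[ℂ] H)

theorem extT_coeT (T : H ⊗[ℂ] K →L[ℂ] H' ⊗[ℂ] K') (x : H ⊗[ℂ] K) :
    extT T (coeT x) = coeT (T x) :=
  ContinuousLinearMap.completion_apply_coe T x

theorem inner_coeT (x y : H ⊗[ℂ] K) : inner ℂ (coeT x) (coeT y) = inner ℂ x y :=
  Completion.inner_coe x y

theorem induction_coeT {P : HTensor H K → Prop} (x : HTensor H K) (hP : IsClosed {x | P x})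
    (h : ∀ x : H ⊗[ℂ] K, P (coeT x)) : P x :=
  Completion.induction_on (α := H ⊗[ℂ] K) x hP h

theorem opT_elem (S : H →L[ℂ] H') (T : K →L[ℂ] K') (h : H) (k : K) :
    opT S T (elem h k) = elem (S h) (T k) := by
  rw [opT, elem, extT_coeT, elem]; simp

theorem flipT_elem (h : H) (k : K) : flipT H K (elem h k) = elem k h := by
  rw [flipT, elem, extT_coeT, elem]; simp

theorem inner_elem (h h' : H) (k k' : K) :
    inner ℂ (elem h k) (elem h' k') = inner ℂ h h' * inner ℂ k k' := by
  rw [elem, elem, inner_coeT]; simp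

theorem ext_elem {E : Type w} [NormedAddCommGroup E] [NormedSpace ℂ E]
    {S T : HTensor H K →L[ℂ] E} (h : ∀ a b, S (elem a b) = T (elem a b)) : S = T := by
  refine ContinuousLinearMap.ext fun x => ?_
  induction x using induction_coeT with
  | hP => exact isClosed_eq S.continuous T.continuous
  | h x =>
    induction x using TensorProduct.induction_on with
    | zero => rw [map_zero, map_zero, map_zero]
    | tmul a b => exact h a b
    | add x y hx hy => rw [map_add, map_add, map_add, hx, hy]

theorem opT_mul (S S' : H →L[ℂ] H) (T T' : K →L[ℂ] K) :
    opT S T * opT S' T' = opT (S * S') (T * T') :=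
  ext_elem fun a b => by simp [opT_elem]

theorem opT_one : opT (1 : H →L[ℂ] H) (1 : K →L[ℂ] K) = 1 :=
  ext_elem fun a b => by simp [opT_elem]

theorem elem_add_left (a a' : H) (b : K) : elem (a + a') b = elem a b + elem a' b := by
  rw [elem, TensorProduct.add_tmul, map_add]; rfl

theorem elem_add_right (a : H) (b b' : K) : elem a (b + b') = elem a b + elem a b' := by
  rw [elem, TensorProduct.tmul_add, map_add]; rfl

theorem elem_smul_left (c : ℂ) (a : H) (b : K) : elem (c • a) b = c • elem a b := by
  rw [elem, ← TensorProduct.smul_tmul', map_smul]; rfl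

theorem elem_smul_right (c : ℂ) (a : H) (b : K) : elem a (c • b) = c • elem a b := by
  rw [elem, TensorProduct.tmul_smul, map_smul]; rfl

theorem elem_zero_left (b : K) : elem (0 : H) b = 0 := by
  rw [elem, TensorProduct.zero_tmul, map_zero]

theorem elem_zero_right (a : H) : elem a (0 : K) = 0 := by
  rw [elem, TensorProduct.tmul_zero, map_zero]

theorem elem_sum_left {ι : Type*} (s : Finset ι) (f : ι → H) (b : K) :
    elem (∑ i ∈ s, f i) b = ∑ i ∈ s, elem (f i) b :=
  map_sum (⟨⟨fun a => elem a b, elem_zero_left b⟩, fun a a' => elem_add_left a a' b⟩ :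
    H →+ HTensor H K) f s

theorem elem_sum_right {ι : Type*} (s : Finset ι) (a : H) (f : ι → K) :
    elem a (∑ i ∈ s, f i) = ∑ i ∈ s, elem a (f i) :=
  map_sum (⟨⟨fun b => elem a b, elem_zero_right a⟩, fun b b' => elem_add_right a b b'⟩ :
    K →+ HTensor H K) f s

variable [CompleteSpace H] [CompleteSpace K] [CompleteSpace H'] [CompleteSpace K']

theorem eq_adjoint_of_elem {S : HTensor H K →L[ℂ] HTensor H' K'}
    {T : HTensor H' K' →L[ℂ] HTensor H K}
    (h : ∀ a b c d, inner ℂ (S (elem a b)) (elem c d) = inner ℂ (elem a b) (T (elem c d))) :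
    S = ContinuousLinearMap.adjoint T := by
  rw [ContinuousLinearMap.eq_adjoint_iff]
  intro x y
  induction x using induction_coeT with
  | hP =>
    exact isClosed_eq (Continuous.inner (𝕜 := ℂ) S.continuous continuous_const)
      (Continuous.inner (𝕜 := ℂ) continuous_id continuous_const)
  | h x =>
    induction y using induction_coeT with
    | hP =>
      exact isClosed_eq (Continuous.inner (𝕜 := ℂ) continuous_const continuous_id)
        (Continuous.inner (𝕜 := ℂ) continuous_const T.continuous)
    | h y =>
      induction x using TensorProduct.induction_on with
      | zero => rw [map_zero, map_zero, inner_zero_left, inner_zero_left]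
      | add x x' hx hx' => rw [map_add, map_add, inner_add_left, inner_add_left, hx, hx']
      | tmul a b =>
        induction y using TensorProduct.induction_on with
        | zero => rw [map_zero, map_zero, inner_zero_right, inner_zero_right]
        | add y y' hy hy' => rw [map_add, map_add, inner_add_right, inner_add_right, hy, hy']
        | tmul c d => exact h a b c d

theorem star_opT (S : H →L[ℂ] H) (T : K →L[ℂ] K) : star (opT S T) = opT (star S) (star T) := by
  refine (eq_adjoint_of_elem fun a b c d => ?_).symm
  rw [opT_elem, opT_elem, inner_elem, inner_elem, ContinuousLinearMap.star_eq_adjoint,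
    ContinuousLinearMap.star_eq_adjoint, ContinuousLinearMap.adjoint_inner_left,
    ContinuousLinearMap.adjoint_inner_left]

end Hilbert

/-! ## The braiding -/

section Braiding

variable {N : ℕ} [NeZero N] {ω : ℂ}
variable {H : Type u} [NormedAddCommGroup H] [InnerProductSpace ℂ H] [CompleteSpace H]
variable {K : Type v} [NormedAddCommGroup K] [InnerProductSpace ℂ K] [CompleteSpace K]

/-- The orthogonal projection onto the vectors `ξ` of degree `m`, that is, with
`U t ξ = ω ^ (t * m) • ξ` for all `t`. -/
def degProj (ω : ℂ) (U : Multiplicative (ZMod N) →* unitary (H →L[ℂ] H)) (m : ZMod N) :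
    H →L[ℂ] H :=
  (N : ℂ)⁻¹ • ∑ t : ZMod N, rpow ω (-(t * m)) • (U (.ofAdd t) : H →L[ℂ] H)

/-- The braiding unitary, `ξ ⊗ η ↦ ω ^ (m * n) • η ⊗ ξ` for `ξ` of degree `m` and `η` of
degree `n`. -/
def braiding (ω : ℂ) (U : Multiplicative (ZMod N) →* unitary (H →L[ℂ] H))
    (V : Multiplicative (ZMod N) →* unitary (K →L[ℂ] K)) : HTensor H K →L[ℂ] HTensor K H :=
  ∑ m : ZMod N, ∑ n : ZMod N,
    rpow ω (m * n) • (flipT H K ∘L opT (degProj ω U m) (degProj ω V n))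

/-- The dual braiding unitary, `η ⊗ ξ ↦ ω ^ (-(m * n)) • ξ ⊗ η` for `ξ` of degree `m` and `η` of
degree `n`. -/
def braidingDual (ω : ℂ) (U : Multiplicative (ZMod N) →* unitary (H →L[ℂ] H))
    (V : Multiplicative (ZMod N) →* unitary (K →L[ℂ] K)) : HTensor K H →L[ℂ] HTensor H K :=
  ∑ m : ZMod N, ∑ n : ZMod N,
    rpow ω (-(m * n)) • (flipT K H ∘L opT (degProj ω V n) (degProj ω U m))

theorem U_add_apply (U : Multiplicative (ZMod N) →* unitary (H →L[ℂ] H)) (s t : ZMod N) :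
    (U (.ofAdd s) : H →L[ℂ] H) * (U (.ofAdd t) : H →L[ℂ] H) = U (.ofAdd (s + t)) := by
  rw [ofAdd_add, map_mul]; rfl

theorem U_zero (U : Multiplicative (ZMod N) →* unitary (H →L[ℂ] H)) :
    (U (.ofAdd 0) : H →L[ℂ] H) = 1 := by
  rw [ofAdd_zero, map_one]; rfl

theorem star_U (U : Multiplicative (ZMod N) →* unitary (H →L[ℂ] H)) (t : ZMod N) :
    star (U (.ofAdd t) : H →L[ℂ] H) = U (.ofAdd (-t)) := by
  rw [ofAdd_neg, map_inv]; rfl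

theorem U_mul_degProj (hω : IsPrimitiveRoot ω N)
    (U : Multiplicative (ZMod N) →* unitary (H →L[ℂ] H)) (t m : ZMod N) :
    (U (.ofAdd t) : H →L[ℂ] H) * degProj ω U m = rpow ω (t * m) • degProj ω U m := by
  rw [degProj, mul_smul_comm, smul_comm (rpow ω (t * m))]
  refine congrArg (fun x : H →L[ℂ] H => (N : ℂ)⁻¹ • x) ?_
  rw [Finset.mul_sum, Finset.smul_sum]
  refine Fintype.sum_equiv (Equiv.addLeft t) _ _ fun s => ?_
  rw [Equiv.coe_addLeft, mul_smul_comm, U_add_apply, smul_smul, ← rpow_add hω]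
  congr 2; ring

theorem degProj_mul_degProj (hω : IsPrimitiveRoot ω N)
    (U : Multiplicative (ZMod N) →* unitary (H →L[ℂ] H)) (m n : ZMod N) :
    degProj ω U m * degProj ω U n = if m = n then degProj ω U n else 0 := by
  have h : degProj ω U m * degProj ω U n =
      ((N : ℂ)⁻¹ * ∑ t : ZMod N, rpow ω (t * (n - m))) • degProj ω U n := by
    conv_lhs => rw [degProj]
    rw [smul_mul_assoc, Finset.sum_mul, mul_smul, Finset.sum_smul]
    congr 1
    refine Finset.sum_congr rfl fun t _ => ?_
    rw [smul_mul_assoc, U_mul_degProj hω, smul_smul, ← rpow_add hω]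
    congr 2; ring
  rw [h, sum_rpow hω]
  have hN : (N : ℂ) ≠ 0 := Nat.cast_ne_zero.2 (NeZero.ne N)
  by_cases hmn : m = n
  · simp [hmn, hN]
  · rw [if_neg (sub_ne_zero.2 (Ne.symm hmn)), if_neg hmn, mul_zero, zero_smul]

theorem sum_degProj (hω : IsPrimitiveRoot ω N)
    (U : Multiplicative (ZMod N) →* unitary (H →L[ℂ] H)) : ∑ m, degProj ω U m = 1 := by
  have hN : (N : ℂ) ≠ 0 := Nat.cast_ne_zero.2 (NeZero.ne N)
  simp only [degProj]
  have this : ∀ t : ZMod N, ∑ m : ZMod N, rpow ω (-(t * m)) • (U (.ofAdd t) : H →L[ℂ] H) =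
      if t = 0 then (N : ℂ) • 1 else 0 := fun t => by
    rw [← Finset.sum_smul]
    have h := sum_rpow hω (-t)
    simp only [mul_neg, mul_comm _ t] at h
    rw [h]
    simp only [neg_eq_zero, ite_smul, zero_smul]
    split_ifs with ht
    · rw [ht, U_zero]
    · rfl
  rw [← Finset.smul_sum, Finset.sum_comm, Finset.sum_congr rfl fun t _ => this t,
    Finset.sum_ite_eq', if_pos (Finset.mem_univ _),
    smul_smul, inv_mul_cancel₀ hN, one_smul]

theorem star_degProj (hω : IsPrimitiveRoot ω N)
    (U : Multiplicative (ZMod N) →* unitary (H →L[ℂ] H)) (m : ZMod N) :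
    star (degProj ω U m) = degProj ω U m := by
  rw [degProj, star_smul, star_sum, ← Equiv.sum_comp (Equiv.neg (ZMod N))]
  congr 1
  · simp
  · refine Finset.sum_congr rfl fun t _ => ?_
    rw [star_smul, star_rpow hω, star_U]
    simp

theorem braiding_elem (U : Multiplicative (ZMod N) →* unitary (H →L[ℂ] H))
    (V : Multiplicative (ZMod N) →* unitary (K →L[ℂ] K)) (a : H) (b : K) :
    braiding ω U V (elem a b) =
      ∑ m, ∑ n, rpow ω (m * n) • elem (degProj ω V n b) (degProj ω U m a) := by
  simp [braiding, opT_elem, flipT_elem]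

theorem braidingDual_elem (U : Multiplicative (ZMod N) →* unitary (H →L[ℂ] H))
    (V : Multiplicative (ZMod N) →* unitary (K →L[ℂ] K)) (b : K) (a : H) :
    braidingDual ω U V (elem b a) =
      ∑ m, ∑ n, rpow ω (-(m * n)) • elem (degProj ω U m a) (degProj ω V n b) := by
  simp [braidingDual, opT_elem, flipT_elem]

theorem degProj_apply_degProj (hω : IsPrimitiveRoot ω N)
    (U : Multiplicative (ZMod N) →* unitary (H →L[ℂ] H)) (m n : ZMod N) (a : H) :
    degProj ω U m (degProj ω U n a) = if m = n then degProj ω U n a else 0 := by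
  have := congrArg (fun T : H →L[ℂ] H => T a) (degProj_mul_degProj hω U m n)
  refine (this : degProj ω U m (degProj ω U n a) = _).trans ?_
  split_ifs <;> rfl

theorem sum_degProj_apply (hω : IsPrimitiveRoot ω N)
    (U : Multiplicative (ZMod N) →* unitary (H →L[ℂ] H)) (a : H) :
    ∑ m, degProj ω U m a = a := by
  have := congrArg (fun T : H →L[ℂ] H => T a) (sum_degProj hω U)
  simpa [sum_apply] using this

theorem ite_elem (p : Prop) [Decidable p] (a : H) (b : K) :
    elem (if p then a else 0) b = if p then elem a b else 0 := by
  split_ifs <;> simp [elem_zero_left]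

theorem elem_ite (p : Prop) [Decidable p] (a : H) (b : K) :
    elem a (if p then b else 0) = if p then elem a b else 0 := by
  split_ifs <;> simp [elem_zero_right]

theorem braidingDual_comp_braiding (hω : IsPrimitiveRoot ω N)
    (U : Multiplicative (ZMod N) →* unitary (H →L[ℂ] H))
    (V : Multiplicative (ZMod N) →* unitary (K →L[ℂ] K)) :
    braidingDual ω U V ∘L braiding ω U V = 1 := by
  refine ext_elem fun a b => ?_
  simp only [ContinuousLinearMap.comp_apply, braiding_elem, map_sum, map_smul, braidingDual_elem,
    degProj_apply_degProj hω, ite_elem, elem_ite, smul_ite, smul_zero, Finset.sum_ite_eq',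
    Finset.mem_univ, if_true, smul_smul, rpow_mul_neg hω, one_smul]
  simp only [← elem_sum_right, ← elem_sum_left, sum_degProj_apply hω]
  rfl

theorem braiding_comp_braidingDual (hω : IsPrimitiveRoot ω N)
    (U : Multiplicative (ZMod N) →* unitary (H →L[ℂ] H))
    (V : Multiplicative (ZMod N) →* unitary (K →L[ℂ] K)) :
    braiding ω U V ∘L braidingDual ω U V = 1 := by
  refine ext_elem fun b a => ?_
  simp only [ContinuousLinearMap.comp_apply, braiding_elem, map_sum, map_smul, braidingDual_elem,
    degProj_apply_degProj hω, ite_elem, elem_ite, smul_ite, smul_zero, Finset.sum_ite_eq',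
    Finset.sum_ite_irrel, Finset.sum_const_zero,
    Finset.mem_univ, if_true, smul_smul, rpow_neg_mul hω, one_smul]
  rw [Finset.sum_comm]
  simp only [← elem_sum_right, ← elem_sum_left, sum_degProj_apply hω]
  rfl

theorem inner_degProj (hω : IsPrimitiveRoot ω N)
    (U : Multiplicative (ZMod N) →* unitary (H →L[ℂ] H)) (m : ZMod N) (a b : H) :
    inner ℂ (degProj ω U m a) b = inner ℂ a (degProj ω U m b) := by
  conv_lhs => rw [← star_degProj hω, ContinuousLinearMap.star_eq_adjoint,
    ContinuousLinearMap.adjoint_inner_left]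

theorem adjoint_braiding (hω : IsPrimitiveRoot ω N)
    (U : Multiplicative (ZMod N) →* unitary (H →L[ℂ] H))
    (V : Multiplicative (ZMod N) →* unitary (K →L[ℂ] K)) :
    ContinuousLinearMap.adjoint (braiding ω U V) = braidingDual ω U V := by
  refine (eq_adjoint_of_elem fun b a c d => ?_).symm
  rw [braidingDual_elem, braiding_elem, sum_inner, inner_sum]
  refine Finset.sum_congr rfl fun m _ => ?_
  rw [sum_inner, inner_sum]
  refine Finset.sum_congr rfl fun n _ => ?_
  rw [inner_smul_left, inner_smul_right, inner_elem, inner_elem, inner_degProj hω,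
    inner_degProj hω]
  have : (starRingEnd ℂ) (rpow ω (-(m * n))) = rpow ω (m * n) := by
    have := star_rpow hω (-(m * n))
    rwa [neg_neg] at this
  rw [this]
  ring

end Braiding

/-! ## The braided tensor product -/

section Braided

variable {N : ℕ} [NeZero N] {ω : ℂ} (hω : IsPrimitiveRoot ω N)
variable {H : Type u} [NormedAddCommGroup H] [InnerProductSpace ℂ H] [CompleteSpace H]
variable {K : Type v} [NormedAddCommGroup K] [InnerProductSpace ℂ K] [CompleteSpace K]
variable {A : Type*} [CStarAlgebra A] {α : ZNAction N A}
variable {B : Type*} [CStarAlgebra B] {β : ZNAction N B}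
variable (R : CovRep α H) (S : CovRep β K)

/-- The tensor product of two unitary representations of `ℤ/Nℤ`. -/
def tensorU (U : Multiplicative (ZMod N) →* unitary (H →L[ℂ] H))
    (V : Multiplicative (ZMod N) →* unitary (K →L[ℂ] K)) :
    Multiplicative (ZMod N) →* unitary (HTensor H K →L[ℂ] HTensor H K) where
  toFun t := ⟨opT (U t : H →L[ℂ] H) (V t : K →L[ℂ] K), by
    rw [Unitary.mem_iff, star_opT, opT_mul, opT_mul]
    simp [opT_one]⟩
  map_one' := Subtype.ext <| by simp [opT_one]
  map_mul' s t := Subtype.ext <| by simp [opT_mul]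

/-- The unital C*-subalgebra generated by a subset of a C*-algebra. -/
def generated {E : Type w} [CStarAlgebra E] (s : Set E) : StarSubalgebra ℂ E :=
  (StarAlgebra.adjoin ℂ s).topologicalClosure

theorem subset_generated {E : Type w} [CStarAlgebra E] {s : Set E} {x : E} (h : x ∈ s) :
    x ∈ generated s :=
  StarSubalgebra.le_topologicalClosure _ (StarAlgebra.subset_adjoin ℂ s h)

instance isClosed_generated {E : Type w} [CStarAlgebra E] (s : Set E) :
    IsClosed (generated s : Set E) :=
  StarSubalgebra.isClosed_topologicalClosure _

theorem generated_le_comap {E : Type w} [CStarAlgebra E] {s : Set E} (φ : E →⋆ₐ[ℂ] E)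
    (h : ∀ x ∈ s, φ x ∈ generated s) {x : E} (hx : x ∈ generated s) : φ x ∈ generated s := by
  have hle : generated s ≤ (generated s).comap φ :=
    StarSubalgebra.topologicalClosure_minimal (StarAlgebra.adjoin_le h)
      (IsClosed.preimage (continuous_hom φ) (isClosed_generated s))
  exact hle hx

/-- The operator `j₁(a) = a ⊗ id`. -/
def leg1 : A →⋆ₐ[ℂ] (HTensor H K →L[ℂ] HTensor H K) where
  toFun a := opT (R.π a) 1
  map_one' := by rw [map_one, opT_one]
  map_mul' a b := by rw [map_mul, opT_mul, one_mul]
  map_zero' := ext_elem fun a b => by simp [opT_elem, elem_zero_left]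
  map_add' x y := ext_elem fun a b => by simp [opT_elem, elem_add_left]
  commutes' c := ext_elem fun a b => by
    simp [opT_elem, elem_smul_left, Algebra.algebraMap_eq_smul_one]
  map_star' x := by rw [map_star, star_opT, star_one]

/-- The operator `j₂(b) = c ∘ (b ⊗ id) ∘ c'`, where `c'` is the braiding unitary and `c` is the
dual braiding unitary. -/
def leg2 : B →⋆ₐ[ℂ] (HTensor H K →L[ℂ] HTensor H K) where
  toFun b := braidingDual ω R.U S.U ∘L opT (S.π b) 1 ∘L braiding ω R.U S.U
  map_one' := by
    rw [map_one, opT_one]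
    exact braidingDual_comp_braiding hω R.U S.U
  map_mul' a b := by
    have h := braiding_comp_braidingDual hω R.U S.U
    rw [map_mul, ← one_mul (1 : H →L[ℂ] H), ← opT_mul]
    ext x
    have hx := fun y => congrArg (fun T : HTensor K H →L[ℂ] HTensor K H => T y) h
    simp only [ContinuousLinearMap.comp_apply] at hx
    change _ = braidingDual ω R.U S.U (opT (S.π a) 1 (braiding ω R.U S.U
      (braidingDual ω R.U S.U (opT (S.π b) 1 (braiding ω R.U S.U x)))))
    rw [hx]
    rfl
  map_zero' := by
    have : opT (S.π 0) (1 : H →L[ℂ] H) = 0 :=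
      ext_elem fun a b => by simp [opT_elem, elem_zero_left]
    rw [this]; simp
  map_add' x y := by
    have : opT (S.π (x + y)) (1 : H →L[ℂ] H) = opT (S.π x) 1 + opT (S.π y) 1 :=
      ext_elem fun a b => by simp [opT_elem, elem_add_left]
    rw [this]; simp
  commutes' c := by
    have : opT (S.π (algebraMap ℂ B c)) (1 : H →L[ℂ] H) = c • 1 :=
      ext_elem fun a b => by
        simp [opT_elem, elem_smul_left, Algebra.algebraMap_eq_smul_one]
    rw [this, Algebra.algebraMap_eq_smul_one, ← braidingDual_comp_braiding hω R.U S.U]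
    ext x
    simp
  map_star' x := by
    rw [map_star, ContinuousLinearMap.star_eq_adjoint (_ ∘L _), ContinuousLinearMap.adjoint_comp,
      ContinuousLinearMap.adjoint_comp, adjoint_braiding hω, ← adjoint_braiding hω,
      ContinuousLinearMap.adjoint_adjoint, ← ContinuousLinearMap.star_eq_adjoint (opT _ _),
      star_opT, star_one]
    rfl

/-- The braided tensor product of two `ℤ/Nℤ`-C*-algebras: the C*-algebra of operators on `H ⊗ K`
generated by the products `j₁(a) j₂(b)`. -/
def braided : StarSubalgebra ℂ (HTensor H K →L[ℂ] HTensor H K) :=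
  generated {T | ∃ (a : A) (b : B), T = leg1 (K := K) R a * leg2 hω R S b}

instance : IsClosed (braided hω R S : Set (HTensor H K →L[ℂ] HTensor H K)) :=
  isClosed_generated _

/-- The braided tensor product, as a C*-algebra. -/
def BraidedTensor : Type (max u v) := ↥(braided hω R S)

instance : CStarAlgebra (BraidedTensor hω R S) :=
  inferInstanceAs (CStarAlgebra ↥(braided hω R S))

theorem leg_mul_leg_mem (a : A) (b : B) :
    leg1 (K := K) R a * leg2 hω R S b ∈ braided hω R S :=
  subset_generated ⟨a, b, rfl⟩

/-- The embedding `j₁` of the first factor. -/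
def j₁ : A →⋆ₐ[ℂ] BraidedTensor hω R S :=
  (leg1 (K := K) R).codRestrict (braided hω R S) fun a => by
    simpa using leg_mul_leg_mem hω R S a 1

/-- The embedding `j₂` of the second factor. -/
def j₂ : B →⋆ₐ[ℂ] BraidedTensor hω R S :=
  (leg2 hω R S).codRestrict (braided hω R S) fun b => by
    simpa using leg_mul_leg_mem hω R S 1 b

theorem degProj_U (U : Multiplicative (ZMod N) →* unitary (H →L[ℂ] H)) (m t : ZMod N) (a : H) :
    degProj ω U m ((U (.ofAdd t) : H →L[ℂ] H) a) = (U (.ofAdd t) : H →L[ℂ] H) (degProj ω U m a) := by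
  have h : degProj ω U m * (U (.ofAdd t) : H →L[ℂ] H) =
      (U (.ofAdd t) : H →L[ℂ] H) * degProj ω U m := by
    rw [degProj, smul_mul_assoc, mul_smul_comm, Finset.sum_mul, Finset.mul_sum]
    refine congrArg _ (Finset.sum_congr rfl fun s _ => ?_)
    rw [smul_mul_assoc, mul_smul_comm, U_add_apply, U_add_apply, add_comm]
  exact congrArg (fun T : H →L[ℂ] H => T a) h

theorem braiding_comp_tensorU (U : Multiplicative (ZMod N) →* unitary (H →L[ℂ] H))
    (V : Multiplicative (ZMod N) →* unitary (K →L[ℂ] K)) (t : ZMod N) :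
    braiding ω U V ∘L (tensorU U V (.ofAdd t) : HTensor H K →L[ℂ] HTensor H K) =
      (tensorU V U (.ofAdd t) : HTensor K H →L[ℂ] HTensor K H) ∘L braiding ω U V :=
  ext_elem fun a b => by
    simp only [ContinuousLinearMap.comp_apply, tensorU, MonoidHom.coe_mk, OneHom.coe_mk, opT_elem,
      braiding_elem, degProj_U, map_sum, map_smul]

theorem tensorU_comp_braidingDual (U : Multiplicative (ZMod N) →* unitary (H →L[ℂ] H))
    (V : Multiplicative (ZMod N) →* unitary (K →L[ℂ] K)) (t : ZMod N) :
    (tensorU U V (.ofAdd t) : HTensor H K →L[ℂ] HTensor H K) ∘L braidingDual ω U V =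
      braidingDual ω U V ∘L (tensorU V U (.ofAdd t) : HTensor K H →L[ℂ] HTensor K H) :=
  ext_elem fun a b => by
    simp only [ContinuousLinearMap.comp_apply, tensorU, MonoidHom.coe_mk, OneHom.coe_mk, opT_elem,
      braidingDual_elem, degProj_U, map_sum, map_smul]

theorem conj_leg1 (t : ZMod N) (a : A) :
    (tensorU R.U S.U (.ofAdd t) : HTensor H K →L[ℂ] HTensor H K) * leg1 R a *
      star (tensorU R.U S.U (.ofAdd t) : HTensor H K →L[ℂ] HTensor H K) = leg1 R (α.ρ t a) := by
  change opT _ _ * opT _ _ * star (opT _ _) = opT _ _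
  rw [star_opT, opT_mul, opT_mul, R.covariant]
  simp

theorem conj_leg2 (t : ZMod N) (b : B) :
    (tensorU R.U S.U (.ofAdd t) : HTensor H K →L[ℂ] HTensor H K) * leg2 hω R S b *
      star (tensorU R.U S.U (.ofAdd t) : HTensor H K →L[ℂ] HTensor H K) =
      leg2 hω R S (β.ρ t b) := by
  have h1 := tensorU_comp_braidingDual (ω := ω) R.U S.U t
  have h2 := braiding_comp_tensorU (ω := ω) R.U S.U (-t)
  have h3 : (tensorU S.U R.U (.ofAdd t) : HTensor K H →L[ℂ] HTensor K H) * opT (S.π b) 1 *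
      (tensorU S.U R.U (.ofAdd (-t)) : HTensor K H →L[ℂ] HTensor K H) =
      opT (S.π (β.ρ t b)) 1 := by
    rw [← star_U]
    exact conj_leg1 S R t b
  rw [star_U]
  change (_ ∘L (_ ∘L _ ∘L _)) ∘L _ = _ ∘L _ ∘L _
  rw [← h3]
  ext x
  have h1' := fun y => congrArg (fun T : HTensor K H →L[ℂ] HTensor H K => T y) h1
  have h2' := fun y => congrArg (fun T : HTensor H K →L[ℂ] HTensor K H => T y) h2
  simp only [ContinuousLinearMap.comp_apply] at h1' h2' ⊢
  rw [h1', h2']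
  rfl

/-- Conjugation by a unitary. -/
def conj (u : unitary (H →L[ℂ] H)) : (H →L[ℂ] H) →⋆ₐ[ℂ] (H →L[ℂ] H) where
  toFun x := (u : H →L[ℂ] H) * x * star (u : H →L[ℂ] H)
  map_one' := by simp
  map_mul' x y := by
    have : star (u : H →L[ℂ] H) * u = 1 := Unitary.star_mul_self_of_mem u.2
    calc (u : H →L[ℂ] H) * (x * y) * star (u : H →L[ℂ] H)
        = u * x * 1 * y * star (u : H →L[ℂ] H) := by simp only [mul_assoc, one_mul]
      _ = u * x * star (u : H →L[ℂ] H) * (u * y * star (u : H →L[ℂ] H)) := by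
        rw [← this]; simp only [mul_assoc]
  map_zero' := by simp
  map_add' x y := by rw [mul_add, add_mul]
  commutes' c := by
    rw [← Algebra.commutes, mul_assoc, Unitary.mul_star_self_of_mem u.2, mul_one]
  map_star' x := by simp [mul_assoc]

theorem conj_apply (u : unitary (H →L[ℂ] H)) (x : H →L[ℂ] H) :
    conj u x = (u : H →L[ℂ] H) * x * star (u : H →L[ℂ] H) := rfl

theorem conj_zero (U : Multiplicative (ZMod N) →* unitary (H →L[ℂ] H)) (x : H →L[ℂ] H) :
    conj (U (.ofAdd 0)) x = x := by
  rw [conj_apply, U_zero]; simp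

theorem conj_add (U : Multiplicative (ZMod N) →* unitary (H →L[ℂ] H)) (s t : ZMod N)
    (x : H →L[ℂ] H) : conj (U (.ofAdd (s + t))) x = conj (U (.ofAdd s)) (conj (U (.ofAdd t)) x) := by
  rw [conj_apply, conj_apply, conj_apply, ← U_add_apply, star_mul]
  simp only [mul_assoc]

theorem conj_mem (t : ZMod N) (T : HTensor H K →L[ℂ] HTensor H K) (hT : T ∈ braided hω R S) :
    conj (tensorU R.U S.U (.ofAdd t)) T ∈ braided hω R S := by
  refine generated_le_comap _ ?_ hT
  rintro _ ⟨a, b, rfl⟩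
  have e1 : conj (tensorU R.U S.U (.ofAdd t)) (leg1 R a) = leg1 R (α.ρ t a) :=
    (conj_apply _ _).trans (conj_leg1 R S t a)
  have e2 : conj (tensorU R.U S.U (.ofAdd t)) (leg2 hω R S b) = leg2 hω R S (β.ρ t b) :=
    (conj_apply _ _).trans (conj_leg2 hω R S t b)
  rw [map_mul, e1, e2]
  exact leg_mul_leg_mem hω R S _ _

/-- The action of `ℤ/Nℤ` on the braided tensor product, for which `j₁` and `j₂` are equivariant. -/
def braidedAction : ZNAction N (BraidedTensor hω R S) where
  ρ t :=
    { toFun := fun T => ⟨conj (tensorU R.U S.U (.ofAdd t)) T.1, conj_mem hω R S t T.1 T.2⟩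
      map_one' := Subtype.ext (map_one (conj _))
      map_mul' := fun _ _ => Subtype.ext (map_mul (conj _) _ _)
      map_zero' := Subtype.ext (map_zero (conj _))
      map_add' := fun _ _ => Subtype.ext (map_add (conj _) _ _)
      commutes' := fun c => Subtype.ext (AlgHomClass.commutes (conj _) c)
      map_star' := fun _ => Subtype.ext (map_star (conj _) _) }
  ρ_zero T := Subtype.ext (conj_zero (tensorU R.U S.U) T.1)
  ρ_add s t T := Subtype.ext (conj_add (tensorU R.U S.U) s t T.1)

/-- The defining representation of the braided tensor product on `H ⊗ K`. -/
def braidedRep : CovRep (braidedAction hω R S) (HTensor H K) where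
  U := tensorU R.U S.U
  π := ((braided hω R S).subtype : ↥(braided hω R S) →⋆ₐ[ℂ] _)
  faithful := Subtype.val_injective
  covariant _ _ := rfl

/-! ## The minimal tensor product -/

/-- The minimal tensor product of two C*-algebras, on the Hilbert space tensor product of the
spaces on which they are faithfully represented. -/
def minSubalgebra : StarSubalgebra ℂ (HTensor H K →L[ℂ] HTensor H K) :=
  generated {T | ∃ (a : A) (b : B), T = opT (R.π a) (S.π b)}

instance : IsClosed (minSubalgebra R S : Set (HTensor H K →L[ℂ] HTensor H K)) :=
  isClosed_generated _

/-- The minimal tensor product, as a C*-algebra. -/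
def MinTensor : Type (max u v) := ↥(minSubalgebra R S)

instance : CStarAlgebra (MinTensor R S) :=
  inferInstanceAs (CStarAlgebra ↥(minSubalgebra R S))

/-- The elementary tensor `a ⊗ b` in the minimal tensor product. -/
def minTmul (a : A) (b : B) : MinTensor R S :=
  ⟨opT (R.π a) (S.π b),
    subset_generated ⟨a, b, rfl⟩⟩

end Braided

/-! ## The function algebra of `ℤ/Nℤ` -/

section CZ

variable {N : ℕ} [NeZero N]

variable (N) in
/-- The C*-algebra `C(ℤ/Nℤ)`. -/
abbrev CZ : Type := ZMod N → ℂ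

variable (N) in
/-- The right translation action of `ℤ/Nℤ` on `C(ℤ/Nℤ)`, given by the comultiplication
`Δ(f)(s, t) = f(s + t)`. -/
def czAction : ZNAction N (CZ N) where
  ρ t :=
    { toFun := fun f s => f (s + t)
      map_one' := rfl
      map_mul' := fun _ _ => rfl
      map_zero' := rfl
      map_add' := fun _ _ => rfl
      commutes' := fun _ => rfl
      map_star' := fun _ => rfl }
  ρ_zero f := funext fun s => congrArg f (add_zero s)
  ρ_add s t f := funext fun r => congrArg f (by ring)

variable (N) in
/-- The translation representation of `ℤ/Nℤ` on `ℓ²(ℤ/Nℤ)`, `(U t ξ)(s) = ξ(s + t)`. -/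
def czU : Multiplicative (ZMod N) →*
    unitary (EuclideanSpace ℂ (ZMod N) →L[ℂ] EuclideanSpace ℂ (ZMod N)) where
  toFun t := Unitary.linearIsometryEquiv.symm
    (LinearIsometryEquiv.piLpCongrLeft 2 ℂ ℂ (Equiv.subRight t.toAdd))
  map_one' := by
    ext x s
    simp
  map_mul' s t := by
    ext x r
    simp [add_assoc]

theorem czU_apply (t s : ZMod N) (ξ : EuclideanSpace ℂ (ZMod N)) :
    (czU N (.ofAdd t) : EuclideanSpace ℂ (ZMod N) →L[ℂ] EuclideanSpace ℂ (ZMod N)) ξ s =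
      ξ (s + t) := rfl

variable (N) in
/-- The representation of `C(ℤ/Nℤ)` on `ℓ²(ℤ/Nℤ)` by pointwise multiplication. -/
def czRep : CovRep (czAction N) (EuclideanSpace ℂ (ZMod N)) where
  U := czU N
  π :=
    { toFun := fun f => Matrix.toEuclideanCLM (n := ZMod N) (𝕜 := ℂ) (Matrix.diagonal f)
      map_one' := by
        change Matrix.toEuclideanCLM (n := ZMod N) (𝕜 := ℂ) (Matrix.diagonal fun _ => 1) = 1
        rw [Matrix.diagonal_one, map_one]
      map_mul' := fun f g => by
        rw [← map_mul, Matrix.diagonal_mul_diagonal]; rfl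
      map_zero' := by
        change Matrix.toEuclideanCLM (n := ZMod N) (𝕜 := ℂ) (Matrix.diagonal fun _ => 0) = 0
        rw [Matrix.diagonal_zero, map_zero]
      map_add' := fun f g => by
        rw [← map_add, Matrix.diagonal_add]; rfl
      commutes' := fun c => by
        rw [← AlgHomClass.commutes (Matrix.toEuclideanCLM (n := ZMod N) (𝕜 := ℂ)) c,
          Matrix.algebraMap_eq_diagonal]
      map_star' := fun f => by
        rw [← map_star, Matrix.star_eq_conjTranspose, Matrix.diagonal_conjTranspose] }
  faithful f g h := Matrix.diagonal_injective (EquivLike.injective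
    (Matrix.toEuclideanCLM (n := ZMod N) (𝕜 := ℂ)) h)
  covariant t f := by
    rw [star_U]
    ext ξ s
    change _ = (czU N (.ofAdd t) : EuclideanSpace ℂ (ZMod N) →L[ℂ] EuclideanSpace ℂ (ZMod N)) _ s
    rw [czU_apply]
    change (Matrix.diagonal _).mulVec _ s = (Matrix.diagonal _).mulVec _ (s + t)
    rw [Matrix.mulVec_diagonal, Matrix.mulVec_diagonal]
    change f (s + t) * ξ s = f (s + t) * ξ (s + t + -t)
    rw [add_neg_cancel_right]

/-- The generator `z` of `C(ℤ/Nℤ)`, `z(t) = ω ^ t`. -/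
def czGen (ω : ℂ) : CZ N := fun t => rpow ω t

/-- The indicator function of `t`. -/
def czDelta (t : ZMod N) : CZ N := Pi.single t 1

end CZ

/-! ## The action on `C(S_N^+(R))` and the bosonization -/

section Boson

variable {N : ℕ} [NeZero N] {ω : ℂ} (hω : IsPrimitiveRoot ω N)

theorem permRel_scale (hω : IsPrimitiveRoot ω N) (t : ZMod N) :
    PermRel ω (fun i j : ZMod N => rpow ω (t * (j - i)) • CPerm.q ω i j) where
  row_zero i := by
    rw [(CPerm.rel ω).row_zero]
    split_ifs with h
    · simp [h, rpow_zero]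
    · simp
  col_zero i := by
    rw [(CPerm.rel ω).col_zero]
    split_ifs with h
    · simp [h, rpow_zero]
    · simp
  star_eq i j := by
    rw [star_smul, (CPerm.rel ω).star_eq, star_rpow hω, smul_smul, smul_smul, mul_comm]
    congr 3; ring
  mul_col i j k := by
    rw [(CPerm.rel ω).mul_col, Finset.smul_sum]
    refine Finset.sum_congr rfl fun l _ => ?_
    rw [smul_mul_smul_comm, smul_smul, smul_smul, mul_comm, ← rpow_add hω (t * _)]
    congr 3; ring
  mul_row i j k := by
    rw [(CPerm.rel ω).mul_row, Finset.smul_sum]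
    refine Finset.sum_congr rfl fun l _ => ?_
    rw [smul_mul_smul_comm, smul_smul, smul_smul, mul_comm, ← rpow_add hω (t * _)]
    congr 3; ring

/-- The action of `ℤ/Nℤ` on `C(S_N^+(R))`, with `ρ t (q i j) = ω ^ (t * (j - i)) • q i j`. -/
def permAction : ZNAction N (CPerm N ω) where
  ρ t := CPerm.lift (permRel_scale hω t)
  ρ_zero a := by
    refine DFunLike.congr_fun (g := StarAlgHom.id ℂ (CPerm N ω)) (CPerm.hom_ext fun i j => ?_) a
    rw [CPerm.lift_q]; simp [rpow_zero]
  ρ_add s t a := by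
    refine DFunLike.congr_fun (g := (CPerm.lift (permRel_scale hω s)).comp
      (CPerm.lift (permRel_scale hω t))) (CPerm.hom_ext fun i j => ?_) a
    rw [StarAlgHom.comp_apply, CPerm.lift_q, CPerm.lift_q, map_smul, CPerm.lift_q, smul_smul,
      ← rpow_add hω]
    congr 2; ring

theorem permAction_q (t i j : ZMod N) :
    (permAction hω).ρ t (CPerm.q ω i j) = rpow ω (t * (j - i)) • CPerm.q ω i j :=
  CPerm.lift_q (permRel_scale hω t) i j

section General

variable {H : Type u} [NormedAddCommGroup H] [InnerProductSpace ℂ H] [CompleteSpace H]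
variable {K : Type v} [NormedAddCommGroup K] [InnerProductSpace ℂ K] [CompleteSpace K]
variable {A : Type*} [CStarAlgebra A] {α : ZNAction N A}
variable {B : Type*} [CStarAlgebra B] {β : ZNAction N B}

/-- The canonical morphism
`ψ : C(ℤ/Nℤ) ⊠ X ⊠ Y → (C(ℤ/Nℤ) ⊠ X) ⊗ (C(ℤ/Nℤ) ⊠ Y)`, characterized by
`ψ(j₁(f)) = (j₁ ⊗ j₁)(Δ(f))`, `ψ(j₂(a)) = (j₂ ⊗ j₁)(ρ(a))` and `ψ(j₃(b)) = 1 ⊗ j₂(b)`, where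
`Δ(f) = ∑ f(s + t) δ_s ⊗ δ_t` and `ρ(a) = ∑ ρ_t(a) ⊗ δ_t`. -/
def IsPsi (R : CovRep α H) (S : CovRep β K)
    (ψ : BraidedTensor hω (czRep N) (braidedRep hω R S) →⋆ₐ[ℂ]
      MinTensor (braidedRep hω (czRep N) R) (braidedRep hω (czRep N) S)) : Prop :=
  (∀ f : CZ N, ψ (j₁ hω (czRep N) (braidedRep hω R S) f) =
    ∑ s : ZMod N, ∑ t : ZMod N,
      f (s + t) • minTmul (braidedRep hω (czRep N) R) (braidedRep hω (czRep N) S)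
        (j₁ hω (czRep N) R (czDelta s)) (j₁ hω (czRep N) S (czDelta t))) ∧
  (∀ a : A, ψ (j₂ hω (czRep N) (braidedRep hω R S) (j₁ hω R S a)) =
    ∑ t : ZMod N, minTmul (braidedRep hω (czRep N) R) (braidedRep hω (czRep N) S)
      (j₂ hω (czRep N) R (α.ρ t a)) (j₁ hω (czRep N) S (czDelta t))) ∧
  ∀ b : B, ψ (j₂ hω (czRep N) (braidedRep hω R S) (j₂ hω R S b)) =
    minTmul (braidedRep hω (czRep N) R) (braidedRep hω (czRep N) S)
      1 (j₂ hω (czRep N) S b)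

/-- The underlying C*-algebra `C(ℤ/Nℤ) ⊠ A` of the bosonization. -/
abbrev Boson (R : CovRep α H) : Type _ := BraidedTensor hω (czRep N) R

/-- The tensor square of the underlying C*-algebra of the bosonization. -/
abbrev BosonSq (R : CovRep α H) : Type _ :=
  MinTensor (braidedRep hω (czRep N) R) (braidedRep hω (czRep N) R)

/-- The elementary tensor `x ⊗ y` in the tensor square of the bosonization. -/
def bosonTmul (R : CovRep α H) (x y : Boson hω R) : BosonSq hω R :=
  minTmul (braidedRep hω (czRep N) R) (braidedRep hω (czRep N) R) x y

/-- `D` is the comultiplication `ψ ∘ (id ⊠ Δ)` of the bosonization of `(A, α, Δ)`. -/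
def IsBosonComult (R : CovRep α H) (Δ : A →⋆ₐ[ℂ] BraidedTensor hω R R)
    (D : Boson hω R →⋆ₐ[ℂ] BosonSq hω R) : Prop :=
  ∃ (idΔ : Boson hω R →⋆ₐ[ℂ] BraidedTensor hω (czRep N) (braidedRep hω R R))
    (ψ : BraidedTensor hω (czRep N) (braidedRep hω R R) →⋆ₐ[ℂ] BosonSq hω R),
    (∀ (f : CZ N) (a : A), idΔ (j₁ hω (czRep N) R f * j₂ hω (czRep N) R a) =
      j₁ hω (czRep N) (braidedRep hω R R) f * j₂ hω (czRep N) (braidedRep hω R R) (Δ a)) ∧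
    IsPsi hω R R ψ ∧ D = ψ.comp idΔ

end General

section PermBoson

variable {L : Type u} [NormedAddCommGroup L] [InnerProductSpace ℂ L] [CompleteSpace L]
variable (R : CovRep (permAction hω) L)

/-- The comultiplication of `S_N^+(R)`: `Δ(q i j) = ∑ k, j₁(q i k) j₂(q k j)`. -/
def IsPermComult (Δ : CPerm N ω →⋆ₐ[ℂ] BraidedTensor hω R R) : Prop :=
  ∀ i j, Δ (CPerm.q ω i j) = ∑ k, j₁ hω R R (CPerm.q ω i k) * j₂ hω R R (CPerm.q ω k j)

/-- The element `z` of the bosonization. -/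
def bosonZ : Boson hω R := j₁ hω (czRep N) R (czGen ω)

/-- The elements `q i j` of the bosonization. -/
def bosonQ (i j : ZMod N) : Boson hω R := j₂ hω (czRep N) R (CPerm.q ω i j)

end PermBoson

/-- The relations between `z` and the `q i j` in the bosonization of `S_N^+(R)`. -/
structure BosonRel (ω : ℂ) {B : Type v} [Ring B] [StarRing B] [Algebra ℂ B]
    (z : B) (q : ZMod N → ZMod N → B) : Prop where
  mul_star : z * star z = 1
  star_mul : star z * z = 1
  pow_eq_one : z ^ N = 1
  comm : ∀ i j, z * q i j = rpow ω (j - i) • (q i j * z)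
  perm : PermRel ω q

/-- `C` is the universal unital C*-algebra generated by `z` and the `q i j`, subject to the
relations `BosonRel`. -/
structure IsUniversalBoson (ω : ℂ) {C : Type v} [CStarAlgebra C]
    (z : C) (q : ZMod N → ZMod N → C) : Prop where
  rel : BosonRel ω z q
  generates : generated ({z} ∪ {x | ∃ i j, x = q i j}) = ⊤
  universal : ∀ (B : Type w) [CStarAlgebra B] (z' : B) (q' : ZMod N → ZMod N → B),
    BosonRel ω z' q' → ∃! φ : C →⋆ₐ[ℂ] B, φ z = z' ∧ ∀ i j, φ (q i j) = q' i j

/-- `C`, with the unital `*`-homomorphism `ι : A → C` and the unitary `z` of order dividing `N`, is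
the crossed product of `A` by the action `α` of `ℤ/Nℤ` (the unitary `z ^ t` implements `ρ t`). -/
structure IsCrossedProduct {A : Type u} [CStarAlgebra A] (α : ZNAction N A) {C : Type v}
    [CStarAlgebra C] (ι : A →⋆ₐ[ℂ] C) (z : C) : Prop where
  mem_unitary : z ∈ unitary C
  pow_eq_one : z ^ N = 1
  covariant : ∀ a, z * ι a * star z = ι (α.ρ 1 a)
  generates : generated ({z} ∪ Set.range ι) = ⊤
  universal : ∀ (B : Type w) [CStarAlgebra B] (φ : A →⋆ₐ[ℂ] B) (v : B), v ∈ unitary B →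
    v ^ N = 1 → (∀ a, v * φ a * star v = φ (α.ρ 1 a)) →
    ∃! Φ : C →⋆ₐ[ℂ] B, Φ z = v ∧ Φ.comp ι = φ

end Boson

end

end Anyonic

open Anyonic

/-! Everything rests on one formula for the second leg of a braided tensor product: j₂(b) = ∑ₘ Pₘ ⊗
ρ₋ₘ(b), where Pₘ is the projection onto degree m in the first Hilbert space (`leg2_apply`). A
unitary u of degree one in the first factor satisfies u Pₘ u* = Pₘ₊₁, so conjugation by j₁(u) acts
on j₂(b) as ρ₁ (`covPair_j₂`). For the first factor C(ℤ/Nℤ) and u = z this is the covariance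
relation of the crossed product.

Universality of this pair comes from a dual action. Conjugation by Uₜ ⊗ 1 multiplies z by ωᵗ and
fixes j₂(b), because Uₜ commutes with every Pₘ. Averaging x = ∑ₖ zᵏ j₂(aₖ) against characters
isolates each aₖ and gives ‖aₖ‖ ≤ ‖x‖. Hence the coefficients are unique and the sums form a closed
*-subalgebra, which is the whole algebra. The product and the adjoint of two such sums are computed
from covariance alone, so every covariant pair receives a homomorphism (`isCrossedProduct_of_dual`,
`boson_isCrossedProduct`). The presentation by z and the q i j follows, since relation (2) is
covariance tested on generators (`BosonRel.covPair`).

The braided comultiplication exists because the elements ∑ₖ j₁(q i k) j₂(q k j) satisfy (a)-(d);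
this is a computation with the commutation rule `j₂_mul_j₁`. Homomorphisms out of C(ℤ/Nℤ) ⊠ Y are
then covariant pairs. For id ⊠ Δ the equivariance of Δ suffices. For ψ one needs its restriction to
X ⊠ Y, and this is constructed spatially: N² isometries from H ⊗ K to (ℓ² ⊗ H) ⊗ (ℓ² ⊗ K), with
orthogonal ranges that span, intertwine both legs with their prescribed images (`psiIsom_leg1`,
`psiIsom_leg2`), and amplification along them is a *-homomorphism.

Finally ρₜ(q i k) = ω^(t(k-i)) q i k and ∑ₜ ω^(t(k-i)) δₜ = z^(k-i), which produces the formula for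
the comultiplication. It holds for every admissible choice of id ⊠ Δ and ψ, so it also gives
uniqueness. -/

namespace Anyonic

noncomputable section

/-! ### Covariant pairs and finite sums ∑ vᵏ φ(aₖ) -/

section CrossedProduct

variable {N : ℕ} [NeZero N] {ω : ℂ}

section Powers

variable {B : Type*} [Ring B] [StarRing B] {v : B}

/-- Since vᴺ = 1, the reduction modulo N hidden in `ZMod.val` is harmless, and exponents may be
taken in ℤ/Nℤ. -/
theorem pow_val_add (hN : v ^ N = 1) (k l : ZMod N) :
    v ^ (k + l).val = v ^ k.val * v ^ l.val := by
  rw [ZMod.val_add, ← pow_add]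
  exact (pow_eq_pow_mod _ hN).symm

theorem pow_val_one (hN : v ^ N = 1) : v ^ (1 : ZMod N).val = v := by
  rw [ZMod.val_one_eq_one_mod, ← pow_eq_pow_mod _ hN, pow_one]

theorem pow_val_zero : v ^ (0 : ZMod N).val = 1 := by
  rw [ZMod.val_zero, pow_zero]

theorem star_pow_val (hv : v ∈ unitary B) (hN : v ^ N = 1) (k : ZMod N) :
    star (v ^ k.val) = v ^ (-k).val := by
  have h1 : star (v ^ k.val) * v ^ k.val = 1 := Unitary.star_mul_self_of_mem (pow_mem hv _)
  have h2 : v ^ k.val * v ^ (-k).val = 1 := by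
    rw [← pow_val_add hN, add_neg_cancel, pow_val_zero]
  exact left_inv_eq_right_inv h1 h2

end Powers

variable {A : Type u} [CStarAlgebra A] {α : ZNAction N A}

/-- A covariant pair: a `*`-homomorphism and a unitary of order dividing `N` that implements the
generator of the action. -/
structure CovPair {B : Type*} [Ring B] [StarRing B] [Algebra ℂ B]
    (α : ZNAction N A) (φ : A →⋆ₐ[ℂ] B) (v : B) : Prop where
  mem_unitary : v ∈ unitary B
  pow_eq_one : v ^ N = 1
  covariant : ∀ a, v * φ a * star v = φ (α.ρ 1 a)

namespace CovPair

variable {B : Type*} [Ring B] [StarRing B] [Algebra ℂ B] {φ : A →⋆ₐ[ℂ] B} {v : B}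

theorem mul_eq (h : CovPair α φ v) (a : A) : v * φ a = φ (α.ρ 1 a) * v := by
  rw [← h.covariant, mul_assoc _ (star v), Unitary.star_mul_self_of_mem h.mem_unitary, mul_one]

theorem pow_mul_eq (h : CovPair α φ v) (k : ZMod N) (a : A) :
    v ^ k.val * φ a = φ (α.ρ k a) * v ^ k.val := by
  have key : ∀ n : ℕ, v ^ n * φ a = φ (α.ρ n a) * v ^ n := by
    intro n
    induction n with
    | zero => simp [α.ρ_zero]
    | succ n ih =>
      rw [pow_succ', mul_assoc, ih, ← mul_assoc, h.mul_eq, ← α.ρ_add, mul_assoc, Nat.cast_succ,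
        add_comm]
  simpa using key k.val

theorem mul_pow_eq (h : CovPair α φ v) (k : ZMod N) (a : A) :
    φ a * v ^ k.val = v ^ k.val * φ (α.ρ (-k) a) := by
  rw [h.pow_mul_eq, ← α.ρ_add, add_neg_cancel, α.ρ_zero]

end CovPair

/-- The element `∑ k, v ^ k * φ (f k)` attached to a covariant pair. -/
def covSum {B : Type*} [Ring B] [StarRing B] [Algebra ℂ B] (φ : A →⋆ₐ[ℂ] B) (v : B) :
    (ZMod N → A) →ₗ[ℂ] B where
  toFun f := ∑ k, v ^ k.val * φ (f k)
  map_add' f g := by simp [mul_add, Finset.sum_add_distrib]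
  map_smul' c f := by simp [Finset.smul_sum]

/-- The twisted convolution. -/
def covConv (α : ZNAction N A) (f g : ZMod N → A) (m : ZMod N) : A :=
  -- Read off from vᵏ φ(a) vˡ φ(b) = vᵏ⁺ˡ φ(ρ₋ₗ(a) b) with m = k + l.
  ∑ k, α.ρ (k - m) (f k) * g (m - k)

/-- The involution for the twisted convolution. -/
def covStar (α : ZNAction N A) (f : ZMod N → A) (m : ZMod N) : A :=
  -- Read off from (vᵏ φ(a))* = φ(a*) v⁻ᵏ = v⁻ᵏ φ(ρₖ(a*)) with m = -k.
  α.ρ (-m) (star (f (-m)))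

section covSum

variable {B : Type*} [Ring B] [StarRing B] [Algebra ℂ B] {φ : A →⋆ₐ[ℂ] B} {v : B}

theorem covSum_apply (f : ZMod N → A) : covSum φ v f = ∑ k, v ^ k.val * φ (f k) := rfl

theorem covSum_single (k : ZMod N) (a : A) : covSum φ v (Pi.single k a) = v ^ k.val * φ a := by
  rw [covSum_apply, Finset.sum_eq_single k]
  · simp
  · intro l _ hl
    simp [hl]
  · simp

/-- Covariance moves all powers of v to the left. The resulting coefficients depend on the action
only, not on the pair, and this is what lets `covLift` compare two pairs. -/
theorem covSum_mul (h : CovPair α φ v) (f g : ZMod N → A) :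
    covSum φ v f * covSum φ v g = covSum φ v (covConv α f g) := by
  simp only [covSum_apply, covConv, map_sum, Finset.sum_mul_sum, map_mul]
  simp only [Finset.mul_sum]
  conv_rhs => rw [Finset.sum_comm]
  refine Finset.sum_congr rfl fun k _ => ?_
  refine Fintype.sum_equiv (Equiv.addLeft k) _ _ fun l => ?_
  simp only [Equiv.coe_addLeft, add_sub_cancel_left]
  rw [pow_val_add h.pow_eq_one, mul_assoc, ← mul_assoc (φ (f k)), h.mul_pow_eq]
  have : k - (k + l) = -l := by ring
  simp only [this, mul_assoc]

theorem star_covSum (h : CovPair α φ v) (f : ZMod N → A) :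
    star (covSum φ v f) = covSum φ v (covStar α f) := by
  simp only [covSum_apply, covStar, star_sum, star_mul]
  refine Fintype.sum_equiv (Equiv.neg _) _ _ fun k => ?_
  rw [star_pow_val h.mem_unitary h.pow_eq_one, ← map_star, h.mul_pow_eq]
  simp

theorem covSum_algebraMap (c : ℂ) :
    covSum φ v (Pi.single (0 : ZMod N) (algebraMap ℂ A c)) = algebraMap ℂ B c := by
  rw [covSum_single, pow_val_zero, one_mul, AlgHomClass.commutes]

end covSum

theorem rpow_pow_val (hω : IsPrimitiveRoot ω N) (t k : ZMod N) :
    rpow ω t ^ k.val = rpow ω (t * k) := by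
  have := rpow_natCast hω (t.val * k.val)
  rw [Nat.cast_mul, ZMod.natCast_zmod_val, ZMod.natCast_zmod_val] at this
  rw [this, rpow, pow_mul]

theorem norm_rpow (hω : IsPrimitiveRoot ω N) (a : ZMod N) : ‖rpow ω a‖ = 1 := by
  rw [rpow, norm_pow, hω.norm'_eq_one (NeZero.ne N), one_pow]

/-- A *-homomorphism of C*-algebras is automatically continuous, so the equalizer is a closed
*-subalgebra. -/
theorem eq_of_generated_eq_top {C B : Type*} [CStarAlgebra C] [CStarAlgebra B] {s : Set C}
    (hs : generated s = ⊤) {Φ Ψ : C →⋆ₐ[ℂ] B} (h : ∀ x ∈ s, Φ x = Ψ x) : Φ = Ψ := by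
  have hcl : IsClosed (StarAlgHom.equalizer Φ Ψ : Set C) :=
    isClosed_eq (continuous_hom Φ) (continuous_hom Ψ)
  have hle : generated s ≤ StarAlgHom.equalizer Φ Ψ :=
    StarSubalgebra.topologicalClosure_minimal (StarAlgebra.adjoin_le h) hcl
  rw [hs] at hle
  exact StarAlgHom.ext fun x => hle (StarSubalgebra.mem_top (x := x))

/-! ### The dual action and the universal property of the crossed product -/

section Dual

variable {C : Type v} [CStarAlgebra C] {ι : A →⋆ₐ[ℂ] C} {z : C}

theorem dual_covSum (hω : IsPrimitiveRoot ω N) {θ : ZMod N → C →⋆ₐ[ℂ] C}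
    (hz : ∀ t, θ t z = rpow ω t • z) (hι : ∀ t a, θ t (ι a) = ι a) (t : ZMod N)
    (f : ZMod N → A) :
    θ t (covSum ι z f) = ∑ k, rpow ω (t * k) • (z ^ k.val * ι (f k)) := by
  rw [covSum_apply, map_sum]
  refine Finset.sum_congr rfl fun k _ => ?_
  rw [map_mul, map_pow, hz, hι, smul_pow, rpow_pow_val hω, smul_mul_assoc]

/-- Each coefficient is a Fourier coefficient for the dual action θ, hence an average of elements of
norm at most that of the sum; the injective ι is isometric. -/
theorem norm_le_norm_covSum (hω : IsPrimitiveRoot ω N) (h : CovPair α ι z)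
    (hinj : Function.Injective ι) {θ : ZMod N → C →⋆ₐ[ℂ] C}
    (hz : ∀ t, θ t z = rpow ω t • z) (hι : ∀ t a, θ t (ι a) = ι a) (f : ZMod N → A) :
    ‖f‖ ≤ ‖covSum ι z f‖ := by
  refine (pi_norm_le_iff_of_nonneg (norm_nonneg _)).2 fun k => ?_
  have hN : (0 : ℝ) < N := Nat.cast_pos.2 (NeZero.pos N)
  -- Orthogonality of characters leaves only the summand N zᵏ ι(f k); the factor z⁻ᵏ removes the
  -- power.
  have e : (N : ℂ) • ι (f k) =
      z ^ (-k).val * ∑ t, rpow ω (-(t * k)) • θ t (covSum ι z f) := by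
    simp only [dual_covSum hω hz hι, Finset.smul_sum, smul_smul, ← rpow_add hω]
    rw [Finset.sum_comm]
    have : ∀ j t : ZMod N, -(t * k) + t * j = t * (j - k) := fun j t => by ring
    simp only [this, ← Finset.sum_smul, sum_rpow hω, sub_eq_zero, ite_smul, zero_smul,
      Finset.sum_ite_eq', Finset.mem_univ, if_true]
    rw [mul_smul_comm, ← mul_assoc, ← pow_val_add h.pow_eq_one, neg_add_cancel, pow_val_zero,
      one_mul]
  have h1 : (N : ℝ) * ‖f k‖ ≤ N * ‖covSum ι z f‖ := by
    calc (N : ℝ) * ‖f k‖ = ‖(N : ℂ) • ι (f k)‖ := by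
          rw [norm_smul, Complex.norm_natCast]
          congr 1
          exact (NonUnitalStarAlgHom.norm_map ι hinj _).symm
      _ = ‖∑ t, rpow ω (-(t * k)) • θ t (covSum ι z f)‖ := by
          rw [e]
          exact CStarRing.norm_mem_unitary_mul _ (pow_mem h.mem_unitary _)
      _ ≤ ∑ t : ZMod N, ‖covSum ι z f‖ := by
          refine norm_sum_le_of_le _ fun t _ => ?_
          rw [norm_smul, norm_rpow hω, one_mul]
          exact NonUnitalStarAlgHom.norm_apply_le (θ t) _
      _ = N * ‖covSum ι z f‖ := by simp
  exact le_of_mul_le_mul_left h1 hN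

theorem continuous_covSum : Continuous (covSum (N := N) ι z) := by
  have := continuous_hom ι
  change Continuous fun f : ZMod N → A => ∑ k, z ^ k.val * ι (f k)
  fun_prop

/-- The lower bound of `norm_le_norm_covSum` gives injectivity and a closed range. The range is a
*-subalgebra containing z and the image of ι, so no further completion is needed. -/
theorem covSum_bijective (hω : IsPrimitiveRoot ω N) (h : CovPair α ι z)
    (hinj : Function.Injective ι) (hgen : generated ({z} ∪ Set.range ι) = ⊤)
    {θ : ZMod N → C →⋆ₐ[ℂ] C}
    (hz : ∀ t, θ t z = rpow ω t • z) (hι : ∀ t a, θ t (ι a) = ι a) :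
    Function.Bijective (covSum (N := N) ι z) := by
  have hanti : AntilipschitzWith 1 (covSum (N := N) ι z) :=
    AddMonoidHomClass.antilipschitz_of_bound _ fun f => by
      simpa using norm_le_norm_covSum hω h hinj hz hι f
  refine ⟨hanti.injective, ?_⟩
  have hcl : IsClosed (Set.range (covSum (N := N) ι z)) :=
    hanti.isClosed_range (uniformContinuous_addMonoidHom_of_continuous continuous_covSum)
  let S : StarSubalgebra ℂ C :=
    { carrier := Set.range (covSum (N := N) ι z)
      mul_mem' := by
        rintro _ _ ⟨f, rfl⟩ ⟨g, rfl⟩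
        exact ⟨_, (covSum_mul h f g).symm⟩
      add_mem' := by
        rintro _ _ ⟨f, rfl⟩ ⟨g, rfl⟩
        exact ⟨_, map_add _ f g⟩
      algebraMap_mem' := fun c => ⟨_, covSum_algebraMap c⟩
      star_mem' := by
        rintro _ ⟨f, rfl⟩
        exact ⟨_, (star_covSum h f).symm⟩ }
  have hle : generated ({z} ∪ Set.range ι) ≤ S := by
    refine StarSubalgebra.topologicalClosure_minimal (StarAlgebra.adjoin_le ?_) hcl
    rintro _ (rfl | ⟨a, rfl⟩)
    · exact ⟨Pi.single 1 1, by rw [covSum_single, map_one, mul_one, pow_val_one h.pow_eq_one]⟩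
    · exact ⟨Pi.single 0 a, by rw [covSum_single, pow_val_zero, one_mul]⟩
  rw [hgen] at hle
  exact fun x => hle (StarSubalgebra.mem_top (x := x))

/-- The homomorphism determined by a covariant pair, if the first one has a bijective `covSum`. -/
def covLift (h : CovPair α ι z) (hbij : Function.Bijective (covSum (N := N) ι z))
    {B : Type w} [CStarAlgebra B] {φ : A →⋆ₐ[ℂ] B} {v : B} (h' : CovPair α φ v) : C →⋆ₐ[ℂ] B :=
  -- The transport is purely algebraic: both pairs obey the same convolution and involution
  -- formulas, so no norm estimate enters.
  let e : (ZMod N → A) ≃ₗ[ℂ] C := LinearEquiv.ofBijective _ hbij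
  have key : ∀ f, covSum φ v (e.symm (covSum ι z f)) = covSum φ v f := fun f =>
    congrArg _ (e.symm_apply_apply f)
  { toFun := fun x => covSum φ v (e.symm x)
    map_one' := by
      have := covSum_algebraMap (N := N) (φ := ι) (v := z) 1
      rw [map_one, map_one] at this
      rw [← this, key]
      simpa using covSum_algebraMap (N := N) (φ := φ) (v := v) 1
    map_mul' := fun x y => by
      obtain ⟨f, rfl⟩ := hbij.2 x
      obtain ⟨g, rfl⟩ := hbij.2 y
      rw [covSum_mul h, key, key, key, covSum_mul h']
    map_zero' := by rw [map_zero, map_zero]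
    map_add' := fun x y => by rw [map_add, map_add]
    commutes' := fun c => by
      rw [← covSum_algebraMap (N := N) (φ := ι) (v := z) c, key, covSum_algebraMap]
    map_star' := fun x => by
      obtain ⟨f, rfl⟩ := hbij.2 x
      rw [star_covSum h, key, key, star_covSum h'] }

theorem covLift_covSum (h : CovPair α ι z) (hbij : Function.Bijective (covSum (N := N) ι z))
    {B : Type w} [CStarAlgebra B] {φ : A →⋆ₐ[ℂ] B} {v : B} (h' : CovPair α φ v)
    (f : ZMod N → A) : covLift h hbij h' (covSum ι z f) = covSum φ v f :=
  congrArg (covSum φ v) ((LinearEquiv.ofBijective _ hbij).symm_apply_apply f)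

/-- A covariant pair that generates, is faithful, and has a dual action gives a crossed product. -/
theorem isCrossedProduct_of_dual (hω : IsPrimitiveRoot ω N) (h : CovPair α ι z)
    (hinj : Function.Injective ι) (hgen : generated ({z} ∪ Set.range ι) = ⊤)
    {θ : ZMod N → C →⋆ₐ[ℂ] C}
    (hz : ∀ t, θ t z = rpow ω t • z) (hι : ∀ t a, θ t (ι a) = ι a) :
    IsCrossedProduct.{_, _, w} α ι z where
  mem_unitary := h.mem_unitary
  pow_eq_one := h.pow_eq_one
  covariant := h.covariant
  generates := hgen
  universal B _ φ v hv hvN hcov := by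
    have hbij := covSum_bijective hω h hinj hgen hz hι
    have h' : CovPair α φ v := ⟨hv, hvN, hcov⟩
    refine ⟨covLift h hbij h', ⟨?_, ?_⟩, ?_⟩
    · have := covLift_covSum h hbij h' (Pi.single 1 1)
      simpa only [covSum_single, map_one, mul_one, pow_val_one, h.pow_eq_one, hvN] using this
    · refine StarAlgHom.ext fun a => ?_
      have := covLift_covSum h hbij h' (Pi.single 0 a)
      simp only [covSum_single, pow_val_zero, one_mul] at this
      exact this
    · rintro Ψ ⟨hΨz, hΨι⟩
      refine eq_of_generated_eq_top hgen ?_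
      rintro _ (rfl | ⟨a, rfl⟩)
      · rw [hΨz]
        have := covLift_covSum h hbij h' (Pi.single 1 1)
        simp only [covSum_single, map_one, mul_one] at this
        rw [pow_val_one h.pow_eq_one, pow_val_one hvN] at this
        exact this.symm
      · have := covLift_covSum h hbij h' (Pi.single 0 a)
        simp only [covSum_single, pow_val_zero, one_mul] at this
        rw [this, ← hΨι]
        rfl

end Dual

end CrossedProduct

/-! ### The two legs of a braided tensor product -/

section Legs

variable {N : ℕ} [NeZero N] {ω : ℂ} (hω : IsPrimitiveRoot ω N)
variable {H : Type u} [NormedAddCommGroup H] [InnerProductSpace ℂ H] [CompleteSpace H]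
variable {K : Type v} [NormedAddCommGroup K] [InnerProductSpace ℂ K] [CompleteSpace K]
variable {A : Type*} [CStarAlgebra A] {α : ZNAction N A}
variable {B : Type*} [CStarAlgebra B] {β : ZNAction N B}
variable (R : CovRep α H) (S : CovRep β K)

theorem sum_rpow_smul_degProj (hω : IsPrimitiveRoot ω N) (U : Multiplicative (ZMod N) →* unitary (H →L[ℂ] H)) (t : ZMod N) :
    ∑ m, rpow ω (t * m) • degProj ω U m = (U (.ofAdd t) : H →L[ℂ] H) := by
  simp only [← U_mul_degProj hω, ← Finset.mul_sum, sum_degProj hω, mul_one]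

/-- The sum over the degree n of the second vector can be carried out, because ∑ₙ ω^(mn) Pₙ = Vₘ by
the spectral decomposition of V. Only the degree of the first vector remains. -/
theorem braiding_elem_eq_sum (hω : IsPrimitiveRoot ω N) (U : Multiplicative (ZMod N) →* unitary (H →L[ℂ] H))
    (V : Multiplicative (ZMod N) →* unitary (K →L[ℂ] K)) (a : H) (b : K) :
    braiding ω U V (elem a b) =
      ∑ m, elem ((V (.ofAdd m) : K →L[ℂ] K) b) (degProj ω U m a) := by
  rw [braiding_elem]
  refine Finset.sum_congr rfl fun m _ => ?_
  rw [← sum_rpow_smul_degProj hω, sum_apply, elem_sum_left]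
  refine Finset.sum_congr rfl fun n _ => ?_
  rw [smul_apply, elem_smul_left]

theorem braidingDual_elem_eq_sum (hω : IsPrimitiveRoot ω N) (U : Multiplicative (ZMod N) →* unitary (H →L[ℂ] H))
    (V : Multiplicative (ZMod N) →* unitary (K →L[ℂ] K)) (b : K) (a : H) :
    braidingDual ω U V (elem b a) =
      ∑ m, elem (degProj ω U m a) ((V (.ofAdd (-m)) : K →L[ℂ] K) b) := by
  rw [braidingDual_elem]
  refine Finset.sum_congr rfl fun m _ => ?_
  rw [← sum_rpow_smul_degProj hω, sum_apply, elem_sum_right]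
  refine Finset.sum_congr rfl fun n _ => ?_
  rw [smul_apply, elem_smul_right, neg_mul]

theorem leg1_apply (a : A) : leg1 (K := K) R a = opT (R.π a) 1 := rfl

/-- On a first vector of degree m the braiding applies Vₘ to the second vector and the dual braiding
applies V₋ₘ, so b is conjugated to V₋ₘ b Vₘ = ρ₋ₘ(b). -/
theorem leg2_apply (b : B) : leg2 hω R S b =
    ∑ m, opT (degProj ω R.U m) (S.π (β.ρ (-m) b)) := by
  refine ext_elem fun x y => ?_
  change braidingDual ω R.U S.U (opT (S.π b) 1 (braiding ω R.U S.U (elem x y))) = _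
  rw [braiding_elem_eq_sum hω, map_sum, map_sum, sum_apply]
  refine Finset.sum_congr rfl fun m _ => ?_
  rw [opT_elem, opT_elem, braidingDual_elem_eq_sum hω, Finset.sum_eq_single m]
  · rw [one_apply_eq_self, degProj_apply_degProj hω, if_pos rfl, S.covariant,
      star_U, neg_neg]
    rfl
  · intro n _ hn
    rw [one_apply_eq_self, degProj_apply_degProj hω, if_neg hn, elem_zero_left]
  · simp

theorem norm_elem (x : H) (y : K) : ‖elem x y‖ = ‖x‖ * ‖y‖ := by
  have h : (‖elem x y‖ : ℂ) ^ 2 = ((‖x‖ * ‖y‖ : ℝ) : ℂ) ^ 2 := by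
    have := inner_elem x x y y
    simp only [inner_self_eq_norm_sq_to_K] at this
    rw [Complex.ofReal_mul, mul_pow]
    exact this
  have h' : ‖elem x y‖ ^ 2 = (‖x‖ * ‖y‖) ^ 2 := by exact_mod_cast h
  exact (pow_left_inj₀ (norm_nonneg _) (by positivity) two_ne_zero).1 h'

/-- The braiding is invertible, so j₂(b) = 0 forces π(b) ⊗ 1 = 0. Evaluating on y ⊗ x with a fixed x
≠ 0 gives ‖π(b) y‖ ‖x‖ = 0. -/
theorem leg2_injective [Nontrivial H] : Function.Injective (leg2 hω R S) := by
  refine (injective_iff_map_eq_zero _).2 fun b hb => ?_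
  obtain ⟨x, hx⟩ := exists_ne (0 : H)
  refine S.faithful ?_
  rw [map_zero]
  refine ContinuousLinearMap.ext fun y => ?_
  have h1 : leg2 hω R S b (braidingDual ω R.U S.U (elem y x)) = 0 := by rw [hb]; rfl
  have h2 : braiding ω R.U S.U (leg2 hω R S b (braidingDual ω R.U S.U (elem y x))) =
      opT (S.π b) 1 (elem y x) := by
    have hc := fun w => congrArg (fun T : HTensor K H →L[ℂ] HTensor K H => T w)
      (braiding_comp_braidingDual hω R.U S.U)
    simp only [ContinuousLinearMap.comp_apply] at hc
    change braiding ω R.U S.U (braidingDual ω R.U S.U (opT (S.π b) 1 (braiding ω R.U S.U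
      (braidingDual ω R.U S.U (elem y x))))) = _
    rw [hc, hc]
    rfl
  rw [h1, map_zero, opT_elem] at h2
  have h3 := congrArg norm h2
  rw [norm_zero, norm_elem, eq_comm, mul_eq_zero] at h3
  simpa [hx] using h3

theorem j₂_injective [Nontrivial H] : Function.Injective (j₂ hω R S) := fun _ _ h =>
  leg2_injective hω R S (congrArg Subtype.val h)

/-- Elements of the braided tensor product are equal if the operators are. -/
theorem BraidedTensor.ext {x y : BraidedTensor hω R S} (h : x.1 = y.1) : x = y := Subtype.ext h

theorem conj_degProj (U : Multiplicative (ZMod N) →* unitary (H →L[ℂ] H)) (t m : ZMod N) :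
    (U (.ofAdd t) : H →L[ℂ] H) * degProj ω U m * star (U (.ofAdd t) : H →L[ℂ] H) =
      degProj ω U m := by
  have h : (U (.ofAdd t) : H →L[ℂ] H) * degProj ω U m =
      degProj ω U m * (U (.ofAdd t) : H →L[ℂ] H) :=
    ContinuousLinearMap.ext fun x => (degProj_U U m t x).symm
  rw [h, mul_assoc, star_U, U_add_apply, add_neg_cancel, U_zero, mul_one]

/-- Conjugation by the representation on the first tensor factor. -/
def conjLeft (t : ZMod N) : (HTensor H K →L[ℂ] HTensor H K) →⋆ₐ[ℂ] HTensor H K →L[ℂ] HTensor H K :=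
  conj (tensorU R.U (1 : Multiplicative (ZMod N) →* unitary (K →L[ℂ] K)) (.ofAdd t))

theorem conjLeft_opT (t : ZMod N) (X : H →L[ℂ] H) (Y : K →L[ℂ] K) :
    conjLeft R t (opT X Y) =
      opT ((R.U (.ofAdd t) : H →L[ℂ] H) * X * star (R.U (.ofAdd t) : H →L[ℂ] H)) Y := by
  change opT (R.U (.ofAdd t) : H →L[ℂ] H) 1 * opT X Y * star (opT (R.U (.ofAdd t) : H →L[ℂ] H) 1) = _
  rw [star_opT, opT_mul, opT_mul, star_one, one_mul, mul_one]

theorem conjLeft_leg1 (t : ZMod N) (a : A) :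
    conjLeft R t (leg1 (K := K) R a) = leg1 R (α.ρ t a) := by
  rw [leg1_apply, conjLeft_opT, ← R.covariant, leg1_apply]

/-- In `leg2_apply` the first tensor factors are spectral projections of U, which commute with U.
This invariance makes `leftAction` serve as the dual action. -/
theorem conjLeft_leg2 (t : ZMod N) (b : B) :
    conjLeft R t (leg2 hω R S b) = leg2 hω R S b := by
  rw [leg2_apply, map_sum]
  exact Finset.sum_congr rfl fun m _ => by rw [conjLeft_opT, conj_degProj]

theorem conjLeft_mem (t : ZMod N) (T : HTensor H K →L[ℂ] HTensor H K) (hT : T ∈ braided hω R S) :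
    conjLeft R t T ∈ braided hω R S := by
  refine generated_le_comap _ ?_ hT
  rintro _ ⟨a, b, rfl⟩
  rw [map_mul, conjLeft_leg1, conjLeft_leg2]
  exact leg_mul_leg_mem hω R S _ _

/-- The action on the braided tensor product that moves the first factor only. -/
def leftAction (t : ZMod N) : BraidedTensor hω R S →⋆ₐ[ℂ] BraidedTensor hω R S where
  toFun T := ⟨conjLeft R t T.1, conjLeft_mem hω R S t T.1 T.2⟩
  map_one' := Subtype.ext (map_one (conjLeft R t))
  map_mul' _ _ := Subtype.ext (map_mul (conjLeft R t) _ _)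
  map_zero' := Subtype.ext (map_zero (conjLeft R t))
  map_add' _ _ := Subtype.ext (map_add (conjLeft R t) _ _)
  commutes' c := Subtype.ext (AlgHomClass.commutes (conjLeft R t) c)
  map_star' _ := Subtype.ext (map_star (conjLeft R t) _)

theorem leftAction_j₁ (t : ZMod N) (a : A) :
    leftAction hω R S t (j₁ hω R S a) = j₁ hω R S (α.ρ t a) :=
  Subtype.ext (conjLeft_leg1 R t a)

theorem leftAction_j₂ (t : ZMod N) (b : B) :
    leftAction hω R S t (j₂ hω R S b) = j₂ hω R S b :=
  Subtype.ext (conjLeft_leg2 hω R S t b)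

theorem braidedAction_j₁ (t : ZMod N) (a : A) :
    (braidedAction hω R S).ρ t (j₁ hω R S a) = j₁ hω R S (α.ρ t a) :=
  Subtype.ext (conj_leg1 R S t a)

theorem braidedAction_j₂ (t : ZMod N) (b : B) :
    (braidedAction hω R S).ρ t (j₂ hω R S b) = j₂ hω R S (β.ρ t b) :=
  Subtype.ext (conj_leg2 hω R S t b)

/-- The generated algebra is closed in E, so a closed *-subalgebra of it is closed in E as well and
must contain everything that t generates. -/
theorem generated_coe_eq_top {E : Type*} [CStarAlgebra E] {t : Set E}
    (G : StarSubalgebra ℂ ↥(generated t)) (hG : IsClosed (G : Set ↥(generated t)))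
    (h : ∀ x ∈ t, ∃ y ∈ G, (y : E) = x) : G = ⊤ := by
  have hcl : IsClosed ((G.map (generated t).subtype : StarSubalgebra ℂ E) : Set E) :=
    (isClosed_generated t).isClosedEmbedding_subtypeVal.isClosedMap _ hG
  have hle : generated t ≤ G.map (generated t).subtype :=
    StarSubalgebra.topologicalClosure_minimal (StarAlgebra.adjoin_le h) hcl
  refine eq_top_iff.2 fun x _ => ?_
  obtain ⟨y, hy, hyx⟩ := hle x.2
  exact Subtype.ext hyx ▸ hy

theorem braidedTensor_eq_top (G : StarSubalgebra ℂ (BraidedTensor hω R S))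
    (hG : IsClosed (G : Set (BraidedTensor hω R S))) (h₁ : ∀ a, j₁ hω R S a ∈ G)
    (h₂ : ∀ b, j₂ hω R S b ∈ G) : G = ⊤ := by
  refine generated_coe_eq_top _ hG ?_
  rintro _ ⟨a, b, rfl⟩
  exact ⟨_, mul_mem (h₁ a) (h₂ b), rfl⟩

theorem braidedTensor_hom_ext {C : Type*} [CStarAlgebra C]
    {Φ Ψ : BraidedTensor hω R S →⋆ₐ[ℂ] C} (h₁ : ∀ a, Φ (j₁ hω R S a) = Ψ (j₁ hω R S a))
    (h₂ : ∀ b, Φ (j₂ hω R S b) = Ψ (j₂ hω R S b)) : Φ = Ψ := by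
  have h := braidedTensor_eq_top hω R S (StarAlgHom.equalizer Φ Ψ)
    (isClosed_eq (continuous_hom Φ) (continuous_hom Ψ)) h₁ h₂
  refine StarAlgHom.ext fun x => ?_
  have : x ∈ StarAlgHom.equalizer Φ Ψ := h ▸ StarSubalgebra.mem_top
  exact this

/-- The commutation relation between homogeneous elements of the two factors. -/
theorem j₂_mul_j₁ {a : A} {b : B} {d e : ZMod N} (ha : ∀ t, α.ρ t a = rpow ω (t * d) • a)
    (hb : ∀ t, β.ρ t b = rpow ω (t * e) • b) :
    j₂ hω R S b * j₁ hω R S a = rpow ω (-(e * d)) • (j₁ hω R S a * j₂ hω R S b) := by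
  -- For homogeneous b the sum in `leg2_apply` becomes ∑ₘ ω^(-me) Pₘ ⊗ b, and the first factor is
  -- the spectral decomposition of U₋ₑ.
  have hleg : leg2 hω R S b = opT (R.U (.ofAdd (-e)) : H →L[ℂ] H) (S.π b) := by
    rw [leg2_apply, ← sum_rpow_smul_degProj hω]
    refine ext_elem fun x y => ?_
    simp only [sum_apply, opT_elem, elem_sum_left]
    refine Finset.sum_congr rfl fun m _ => ?_
    rw [hb, map_smul, smul_apply, smul_apply,
      elem_smul_left, elem_smul_right]
    congr 2; ring
  have hU : (R.U (.ofAdd (-e)) : H →L[ℂ] H) * R.π a =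
      rpow ω (-(e * d)) • (R.π a * (R.U (.ofAdd (-e)) : H →L[ℂ] H)) := by
    have h := R.covariant (-e) a
    rw [ha, map_smul, star_U, neg_neg] at h
    rw [← smul_mul_assoc, ← neg_mul, h, mul_assoc, U_add_apply, add_neg_cancel, U_zero, mul_one]
  refine BraidedTensor.ext hω R S ?_
  change leg2 hω R S b * leg1 R a = rpow ω (-(e * d)) • (leg1 R a * leg2 hω R S b)
  rw [hleg, leg1_apply, opT_mul, opT_mul, hU, one_mul, mul_one]
  refine ext_elem fun x y => ?_
  simp only [smul_apply, opT_elem, elem_smul_left]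

/-- A unitary of degree one in the first factor implements the action on the second factor. -/
theorem covPair_j₂ {u : A} (hu : u ∈ unitary A) (huN : u ^ N = 1)
    (hdeg : ∀ t, α.ρ t u = rpow ω t • u) : CovPair β (j₂ hω R S) (j₁ hω R S u) where
  mem_unitary := Unitary.map_mem _ hu
  pow_eq_one := by rw [← map_pow, huN, map_one]
  covariant b := by
    have hπ : R.π u * star (R.π u) = 1 := by
      rw [← map_star, ← map_mul, Unitary.mul_star_self_of_mem hu, map_one]
    -- Since u has degree one, conjugation by it multiplies Uₜ by ω^(-t); inserted in the Fourier
    -- sum for Pₘ, this shifts m to m + 1.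
    have hU : ∀ t, R.π u * (R.U (.ofAdd t) : H →L[ℂ] H) * star (R.π u) =
        rpow ω (-t) • (R.U (.ofAdd t) : H →L[ℂ] H) := fun t => by
      have h := R.covariant t u
      rw [hdeg, map_smul] at h
      have h' : (R.U (.ofAdd t) : H →L[ℂ] H) * R.π u =
          rpow ω t • (R.π u * (R.U (.ofAdd t) : H →L[ℂ] H)) := by
        rw [← smul_mul_assoc, h, mul_assoc, star_U, U_add_apply, neg_add_cancel, U_zero, mul_one]
      have h'' : R.π u * (R.U (.ofAdd t) : H →L[ℂ] H) =
          rpow ω (-t) • ((R.U (.ofAdd t) : H →L[ℂ] H) * R.π u) := by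
        rw [h', smul_smul, rpow_neg_mul hω, one_smul]
      rw [h'', smul_mul_assoc, mul_assoc, hπ, mul_one]
    have hP : ∀ m, R.π u * degProj ω R.U m * star (R.π u) = degProj ω R.U (m + 1) := fun m => by
      simp only [degProj, mul_smul_comm, smul_mul_assoc, Finset.mul_sum, Finset.sum_mul, hU,
        smul_smul, ← rpow_add hω]
      congr 1
      refine Finset.sum_congr rfl fun t _ => ?_
      congr 2; ring
    refine BraidedTensor.ext hω R S ?_
    change leg1 R u * leg2 hω R S b * star (leg1 (K := K) R u) = leg2 hω R S (β.ρ 1 b)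
    rw [leg2_apply, leg2_apply, leg1_apply, star_opT, star_one, Finset.mul_sum, Finset.sum_mul]
    -- The shifted projection Pₘ₊₁ is paired with ρ₋ₘ(b) = ρ₋₍ₘ₊₁₎(ρ₁(b)), the summand of j₂(ρ₁(b))
    -- at m + 1.
    refine Fintype.sum_equiv (Equiv.addRight 1) _ _ fun m => ?_
    rw [opT_mul, opT_mul, hP, one_mul, mul_one, Equiv.coe_addRight, ← β.ρ_add]
    congr 3; ring_nf

end Legs

/-! ### C(ℤ/Nℤ) ⊠ A as a crossed product -/

section Boson

variable {N : ℕ} [NeZero N] {ω : ℂ} (hω : IsPrimitiveRoot ω N)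

theorem czGen_pow (hω : IsPrimitiveRoot ω N) (k s : ZMod N) : (czGen (N := N) ω ^ k.val) s = rpow ω (s * k) := by
  rw [Pi.pow_apply, czGen, rpow_pow_val hω]

theorem czGen_pow_eq_one (hω : IsPrimitiveRoot ω N) : czGen (N := N) ω ^ N = 1 := by
  funext s
  rw [Pi.pow_apply, czGen, rpow, ← pow_mul, mul_comm, pow_mul, hω.pow_eq_one, one_pow,
    Pi.one_apply]

theorem czGen_mem_unitary (hω : IsPrimitiveRoot ω N) : czGen (N := N) ω ∈ unitary (CZ N) := by
  have h : czGen (N := N) ω * star (czGen (N := N) ω) = 1 := by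
    funext s
    change rpow ω s * star (rpow ω s) = 1
    rw [star_rpow hω, rpow_mul_neg hω]
  exact Unitary.mem_iff.2 ⟨by rw [mul_comm, h], h⟩

theorem czAction_czGen (hω : IsPrimitiveRoot ω N) (t : ZMod N) : (czAction N).ρ t (czGen ω) = rpow ω t • czGen ω := by
  funext s
  change rpow ω (s + t) = rpow ω t * rpow ω s
  rw [add_comm, rpow_add hω]

/-- The powers of `z` span `C(ℤ/Nℤ)`. -/
theorem cz_eq_sum (hω : IsPrimitiveRoot ω N) (f : CZ N) : f = ∑ k : ZMod N,
    ((N : ℂ)⁻¹ * ∑ s, f s * rpow ω (-(s * k))) • czGen (N := N) ω ^ k.val := by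
  have hN : (N : ℂ) ≠ 0 := Nat.cast_ne_zero.2 (NeZero.ne N)
  funext t
  simp only [Finset.sum_apply, Pi.smul_apply, czGen_pow hω, smul_eq_mul, mul_assoc,
    Finset.sum_mul, ← rpow_add hω]
  rw [← Finset.mul_sum, Finset.sum_comm]
  have : ∀ s k : ZMod N, -(s * k) + t * k = k * (t - s) := fun s k => by ring
  simp only [this, ← Finset.mul_sum, sum_rpow hω, sub_eq_zero, mul_ite, mul_zero,
    Finset.sum_ite_eq, Finset.mem_univ, if_true]
  field_simp

/-- By Fourier inversion the powers of z span. The crossed product only controls the image of z, and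
this extends the control to every function f. -/
theorem cz_linearMap_ext (hω : IsPrimitiveRoot ω N) {E : Type*} [AddCommGroup E] [Module ℂ E] {φ ψ : CZ N →ₗ[ℂ] E}
    (h : ∀ k : ZMod N, φ (czGen ω ^ k.val) = ψ (czGen ω ^ k.val)) : φ = ψ := by
  refine LinearMap.ext fun f => ?_
  rw [cz_eq_sum hω f, map_sum, map_sum]
  exact Finset.sum_congr rfl fun k _ => by rw [map_smul, map_smul, h]

variable {H : Type u} [NormedAddCommGroup H] [InnerProductSpace ℂ H] [CompleteSpace H]
variable {A : Type v} [CStarAlgebra A] {α : ZNAction N A} (R : CovRep α H)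

theorem boson_generated : generated ({j₁ hω (czRep N) R (czGen ω)} ∪
    Set.range (j₂ hω (czRep N) R)) = ⊤ := by
  refine braidedTensor_eq_top hω _ _ _ (isClosed_generated _) (fun f => ?_) fun a =>
    subset_generated (Or.inr ⟨a, rfl⟩)
  have hz : j₁ hω (czRep N) R (czGen ω) ∈ generated ({j₁ hω (czRep N) R (czGen ω)} ∪
      Set.range (j₂ hω (czRep N) R)) := subset_generated (Or.inl rfl)
  rw [cz_eq_sum hω f, map_sum]
  refine sum_mem fun k _ => ?_
  rw [map_smul, map_pow]
  exact SMulMemClass.smul_mem _ (pow_mem hz _)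

theorem boson_covPair : CovPair α (j₂ hω (czRep N) R) (j₁ hω (czRep N) R (czGen ω)) :=
  covPair_j₂ hω _ _ (czGen_mem_unitary hω) (czGen_pow_eq_one hω) (czAction_czGen hω)

/-- The braided tensor product with `C(ℤ/Nℤ)` is the crossed product. -/
theorem boson_isCrossedProduct : IsCrossedProduct.{_, _, w} α (j₂ hω (czRep N) R)
    (j₁ hω (czRep N) R (czGen ω)) := by
  -- The dual action translates the factor C(ℤ/Nℤ) alone; it scales z by ωᵗ because z is a
  -- character.
  refine isCrossedProduct_of_dual hω (boson_covPair hω R) (j₂_injective hω _ _)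
    (boson_generated hω R) (θ := leftAction hω (czRep N) R) (fun t => ?_)
    fun t a => leftAction_j₂ hω _ _ t a
  rw [leftAction_j₁, czAction_czGen hω, map_smul]

end Boson

/-! ### Generators and relations for the bosonization -/

section PermBoson

variable {N : ℕ} [NeZero N] {ω : ℂ} (hω : IsPrimitiveRoot ω N)

theorem cPerm_generated : generated {x : CPerm N ω | ∃ i j, x = CPerm.q ω i j} = ⊤ := by
  set G : StarSubalgebra ℂ (CPerm N ω) := generated {x : CPerm N ω | ∃ i j, x = CPerm.q ω i j}
  have hG : IsClosed (G : Set (CPerm N ω)) := isClosed_generated _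
  refine eq_top_iff.2 fun x _ => ?_
  refine hG.closure_subset_iff.2 ?_ ((permSeminorm ω).denseRange_toCompl x)
  rintro _ ⟨y, rfl⟩
  change (permSeminorm ω).toCompl y ∈ G
  have hq : ∀ i j, (permSeminorm ω).toCompl (letterQ i j) ∈ G := fun i j =>
    subset_generated ⟨i, j, rfl⟩
  induction y using FreeStar.induction with
  | h0 c => rw [AlgHomClass.commutes]; exact algebraMap_mem G c
  | h1 s =>
    rcases s with ⟨i, j⟩ | ⟨i, j⟩
    · exact hq i j
    · have : (FreeStar.letter (Sum.inr (i, j)) : PermFree N) = star (letterQ i j) :=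
        (FreeStar.star_letter (Sum.inl (i, j))).symm
      rw [this, map_star]
      exact star_mem (hq i j)
  | hm a b ha hb => rw [map_mul]; exact mul_mem ha hb
  | ha a b ha hb => rw [map_add]; exact add_mem ha hb

/-- A unitary with the commutation relations implements the action on `C(S_N^+(R))`. -/
theorem BosonRel.covPair {B : Type w} [CStarAlgebra B] {v : B} {q : ZMod N → ZMod N → B}
    (h : BosonRel ω v q) : CovPair (permAction hω) (CPerm.lift h.perm) v where
  mem_unitary := Unitary.mem_iff.2 ⟨h.star_mul, h.mul_star⟩
  pow_eq_one := h.pow_eq_one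
  covariant a := by
    let u : unitary B := ⟨v, Unitary.mem_iff.2 ⟨h.star_mul, h.mul_star⟩⟩
    -- Conjugation by v after the lift and the lift after ρ₁ are both *-homomorphisms, so it
    -- suffices to compare them on q i j. There the commutation relation is covariance, since ρ₁
    -- scales q i j by ω^(j-i).
    refine DFunLike.congr_fun
      (f := ((Unitary.conjStarAlgAut ℂ B u : B ≃⋆ₐ[ℂ] B) : B →⋆ₐ[ℂ] B).comp (CPerm.lift h.perm))
      (g := (CPerm.lift h.perm).comp ((permAction hω).ρ 1)) (CPerm.hom_ext fun i j => ?_) a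
    change v * CPerm.lift h.perm (CPerm.q ω i j) * star v = _
    rw [StarAlgHom.comp_apply, permAction_q, one_mul, map_smul, CPerm.lift_q, h.comm,
      smul_mul_assoc, mul_assoc, h.mul_star, mul_one]

variable {L : Type u} [NormedAddCommGroup L] [InnerProductSpace ℂ L] [CompleteSpace L]
variable (R : CovRep (permAction hω) L)

theorem boson_rel : BosonRel ω (bosonZ hω R) (bosonQ hω R) := by
  have h := boson_covPair hω R
  refine ⟨Unitary.mul_star_self_of_mem h.mem_unitary, Unitary.star_mul_self_of_mem h.mem_unitary,
    h.pow_eq_one, fun i j => ?_, ?_⟩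
  · rw [bosonZ, bosonQ, h.mul_eq, permAction_q, one_mul, map_smul, smul_mul_assoc]
  · have hr := CPerm.rel (N := N) ω
    refine ⟨fun i => ?_, fun i => ?_, fun i j => ?_, fun i j k => ?_, fun i j k => ?_⟩
    · rw [bosonQ, hr.row_zero]; split_ifs <;> simp
    · rw [bosonQ, hr.col_zero]; split_ifs <;> simp
    · rw [bosonQ, ← map_star, hr.star_eq, map_smul, bosonQ]
    · rw [bosonQ, hr.mul_col, map_sum]; simp only [map_smul, map_mul, bosonQ]
    · rw [bosonQ, hr.mul_row, map_sum]; simp only [map_smul, map_mul, bosonQ]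

theorem boson_generated_q :
    generated ({bosonZ hω R} ∪ {x | ∃ i j, x = bosonQ hω R i j}) = ⊤ := by
  set G := generated ({bosonZ hω R} ∪ {x | ∃ i j, x = bosonQ hω R i j}) with hGdef
  have hG : IsClosed (G : Set (Boson hω R)) := isClosed_generated _
  have hle : generated {x : CPerm N ω | ∃ i j, x = CPerm.q ω i j} ≤
      G.comap (j₂ hω (czRep N) R) := by
    refine StarSubalgebra.topologicalClosure_minimal (StarAlgebra.adjoin_le ?_)
      (hG.preimage (continuous_hom (j₂ hω (czRep N) R)))
    rintro _ ⟨i, j, rfl⟩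
    exact subset_generated (Or.inr ⟨i, j, rfl⟩)
  rw [cPerm_generated] at hle
  rw [eq_top_iff, ← boson_generated hω R]
  refine StarSubalgebra.topologicalClosure_minimal (StarAlgebra.adjoin_le ?_) hG
  rintro _ (rfl | ⟨a, rfl⟩)
  · exact subset_generated (Or.inl rfl)
  · exact hle (StarSubalgebra.mem_top (x := a))

/-- Two universal properties are composed: relations (a)-(d) give a homomorphism on C(S_N^+(R)), and
relation (2) makes it covariant, so it extends to the crossed product. -/
theorem boson_isUniversal : IsUniversalBoson.{_, w} ω (bosonZ hω R) (bosonQ hω R) where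
  rel := boson_rel hω R
  generates := boson_generated_q hω R
  universal B _ v q h := by
    have hc := h.covPair hω
    obtain ⟨Φ, ⟨h1, h2⟩, -⟩ := (boson_isCrossedProduct.{_, _, w} hω R).universal B
      (CPerm.lift h.perm) v hc.mem_unitary hc.pow_eq_one hc.covariant
    have h3 : ∀ i j, Φ (bosonQ hω R i j) = q i j := fun i j =>
      (congrArg (fun F : CPerm N ω →⋆ₐ[ℂ] B => F (CPerm.q ω i j)) h2).trans (CPerm.lift_q _ _ _)
    refine ⟨Φ, ⟨h1, h3⟩, ?_⟩
    rintro Ψ ⟨hz, hq⟩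
    refine eq_of_generated_eq_top (boson_generated_q hω R) ?_
    rintro _ (rfl | ⟨i, j, rfl⟩)
    · exact hz.trans h1.symm
    · exact (hq i j).trans (h3 i j).symm

end PermBoson

/-! ### The braided comultiplication of C(S_N^+(R)) -/

section Comult

variable {N : ℕ} [NeZero N] {ω : ℂ} (hω : IsPrimitiveRoot ω N)
variable {L : Type u} [NormedAddCommGroup L] [InnerProductSpace ℂ L] [CompleteSpace L]
variable (R : CovRep (permAction hω) L)

/-- The generators are homogeneous: q i j has degree j - i. -/
theorem j₂_q_mul_j₁_q (i j k l : ZMod N) :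
    j₂ hω R R (CPerm.q ω k l) * j₁ hω R R (CPerm.q ω i j) =
      rpow ω (-((l - k) * (j - i))) •
        (j₁ hω R R (CPerm.q ω i j) * j₂ hω R R (CPerm.q ω k l)) :=
  j₂_mul_j₁ hω R R (fun t => permAction_q hω t i j) fun t => permAction_q hω t k l

/-- The elements `∑ k, j₁(q i k) j₂(q k j)` satisfy the relations of `C(S_N^+(R))`. -/
theorem permRel_comult : PermRel ω (fun i j : ZMod N =>
    ∑ k, j₁ hω R R (CPerm.q ω i k) * j₂ hω R R (CPerm.q ω k j)) where
  row_zero i := by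
    have hr := CPerm.rel (N := N) ω
    rw [Finset.sum_eq_single 0]
    · rw [hr.row_zero, hr.row_zero, if_pos rfl, map_one, one_mul]
      split_ifs <;> simp
    · intro k _ hk
      rw [hr.row_zero, if_neg hk, map_zero, zero_mul]
    · simp
  col_zero i := by
    have hr := CPerm.rel (N := N) ω
    rw [Finset.sum_eq_single 0]
    · rw [hr.col_zero, hr.col_zero, if_pos rfl, map_one, mul_one]
      split_ifs <;> simp
    · intro k _ hk
      rw [hr.col_zero k, if_neg hk, map_zero, mul_zero]
    · simp
  star_eq i j := by
    have hr := CPerm.rel (N := N) ω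
    rw [star_sum, Finset.smul_sum]
    -- Relation (b) negates the summation index. The adjoint also reverses the two legs, and the
    -- phase from commuting them back combines the two star phases into the required one.
    refine Fintype.sum_equiv (Equiv.neg _) _ _ fun k => ?_
    rw [star_mul, ← map_star, ← map_star, hr.star_eq, hr.star_eq, map_smul, map_smul,
      smul_mul_smul_comm, j₂_q_mul_j₁_q, smul_smul, ← rpow_add hω, ← rpow_add hω, Equiv.neg_apply]
    congr 2; ring
  mul_col i j k := by
    have hr := CPerm.rel (N := N) ω
    -- Relation (c) is used once in each leg: first to split the column i + j in the second leg,
    -- then, with m = r + s, to split the column r + s of the first leg.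
    have lhs : ∑ m, j₁ hω R R (CPerm.q ω k m) * j₂ hω R R (CPerm.q ω m (i + j)) =
        ∑ s, ∑ r, ∑ l, (rpow ω (-(s * (i - r))) * rpow ω (-(l * (r - k + l)))) •
          (j₁ hω R R (CPerm.q ω (k - l) r) * j₁ hω R R (CPerm.q ω l s) *
            (j₂ hω R R (CPerm.q ω r i) * j₂ hω R R (CPerm.q ω s j))) := by
      have h1 : ∀ m, j₁ hω R R (CPerm.q ω k m) * j₂ hω R R (CPerm.q ω m (i + j)) =
          ∑ s, rpow ω (-(s * (i - m + s))) • (j₁ hω R R (CPerm.q ω k m) *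
            (j₂ hω R R (CPerm.q ω (m - s) i) * j₂ hω R R (CPerm.q ω s j))) := fun m => by
        rw [hr.mul_col i j m, map_sum, Finset.mul_sum]
        exact Finset.sum_congr rfl fun s _ => by rw [map_smul, map_mul, mul_smul_comm]
      simp only [h1]
      rw [Finset.sum_comm]
      refine Finset.sum_congr rfl fun s _ => ?_
      refine Fintype.sum_equiv (Equiv.subRight s) _ _ fun m => ?_
      rw [Equiv.subRight_apply]
      conv_lhs => rw [← sub_add_cancel m s, hr.mul_col (m - s) s k]
      rw [map_sum, Finset.sum_mul, Finset.smul_sum]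
      refine Finset.sum_congr rfl fun l _ => ?_
      rw [map_smul, map_mul, smul_mul_assoc, smul_smul, sub_add_cancel]
      congr 3; ring_nf
    rw [lhs]
    simp only [Finset.sum_mul_sum, Finset.smul_sum]
    conv_rhs => rw [Finset.sum_comm]
    conv_rhs => enter [2, r]; rw [Finset.sum_comm]
    conv_rhs => rw [Finset.sum_comm]
    refine Finset.sum_congr rfl fun s _ => Finset.sum_congr rfl fun r _ =>
      Finset.sum_congr rfl fun l _ => ?_
    -- The product of two comultiplied generators has its middle factors in the order j₂ j₁.
    -- Exchanging them costs the braiding phase ω^(-(i-r)(s-l)), exactly the discrepancy between the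
    -- exponents on the two sides.
    have hc : ∀ x y : BraidedTensor hω R R,
        x * j₂ hω R R (CPerm.q ω r i) * (j₁ hω R R (CPerm.q ω l s) * y) =
        rpow ω (-((i - r) * (s - l))) •
          (x * j₁ hω R R (CPerm.q ω l s) * (j₂ hω R R (CPerm.q ω r i) * y)) := fun x y => by
      rw [mul_assoc, ← mul_assoc (j₂ hω R R _), j₂_q_mul_j₁_q, smul_mul_assoc, mul_smul_comm,
        mul_assoc, mul_assoc]
    rw [hc, smul_smul, ← rpow_add hω, ← rpow_add hω]
    congr 2; ring
  mul_row i j k := by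
    have hr := CPerm.rel (N := N) ω
    -- Here relation (d) splits the row i + j in the first leg; writing m = r + l then allows it to
    -- split the row of the second leg.
    have lhs : ∑ m, j₁ hω R R (CPerm.q ω (i + j) m) * j₂ hω R R (CPerm.q ω m k) =
        ∑ l, ∑ r, ∑ s, (rpow ω (-(i * (l - j))) * rpow ω (-(r * (s - l)))) •
          (j₁ hω R R (CPerm.q ω j l) * j₁ hω R R (CPerm.q ω i r) *
            (j₂ hω R R (CPerm.q ω l s) * j₂ hω R R (CPerm.q ω r (k - s)))) := by
      have h1 : ∀ m, j₁ hω R R (CPerm.q ω (i + j) m) * j₂ hω R R (CPerm.q ω m k) =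
          ∑ l, rpow ω (-(i * (l - j))) • (j₁ hω R R (CPerm.q ω j l) *
            j₁ hω R R (CPerm.q ω i (m - l)) * j₂ hω R R (CPerm.q ω m k)) := fun m => by
        rw [hr.mul_row i j m, map_sum, Finset.sum_mul]
        exact Finset.sum_congr rfl fun s _ => by rw [map_smul, map_mul, smul_mul_assoc]
      simp only [h1]
      rw [Finset.sum_comm]
      refine Finset.sum_congr rfl fun l _ => ?_
      refine Fintype.sum_equiv (Equiv.subRight l) _ _ fun m => ?_
      rw [Equiv.subRight_apply]
      have h2 := hr.mul_row (m - l) l k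
      rw [sub_add_cancel] at h2
      rw [h2, map_sum, Finset.mul_sum, Finset.smul_sum]
      exact Finset.sum_congr rfl fun s _ => by rw [map_smul, map_mul, mul_smul_comm, smul_smul]
    rw [lhs]
    simp only [Finset.sum_mul_sum, Finset.smul_sum]
    conv_rhs => rw [Finset.sum_comm]
    conv_rhs => enter [2, r]; rw [Finset.sum_comm]
    refine Finset.sum_congr rfl fun l _ => Finset.sum_congr rfl fun r _ =>
      Finset.sum_congr rfl fun s _ => ?_
    have hc : ∀ x y : BraidedTensor hω R R,
        x * j₂ hω R R (CPerm.q ω l s) * (j₁ hω R R (CPerm.q ω i r) * y) =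
        rpow ω (-((s - l) * (r - i))) •
          (x * j₁ hω R R (CPerm.q ω i r) * (j₂ hω R R (CPerm.q ω l s) * y)) := fun x y => by
      rw [mul_assoc, ← mul_assoc (j₂ hω R R _), j₂_q_mul_j₁_q, smul_mul_assoc, mul_smul_comm,
        mul_assoc, mul_assoc]
    rw [hc, smul_smul, ← rpow_add hω, ← rpow_add hω]
    congr 2; ring

/-- The comultiplication of `C(S_N^+(R))` exists and is unique. -/
theorem existsUnique_permComult :
    ∃! Δ : CPerm N ω →⋆ₐ[ℂ] BraidedTensor hω R R, IsPermComult hω R Δ :=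
  ⟨CPerm.lift (permRel_comult hω R), fun i j => CPerm.lift_q _ i j, fun _ h =>
    CPerm.hom_ext fun i j => (h i j).trans (CPerm.lift_q (permRel_comult hω R) i j).symm⟩

/-- The comultiplication is equivariant. -/
theorem IsPermComult.equivariant {Δ : CPerm N ω →⋆ₐ[ℂ] BraidedTensor hω R R}
    (h : IsPermComult hω R Δ) (t : ZMod N) (a : CPerm N ω) :
    Δ ((permAction hω).ρ t a) = (braidedAction hω R R).ρ t (Δ a) := by
  refine DFunLike.congr_fun (f := Δ.comp ((permAction hω).ρ t))
    (g := ((braidedAction hω R R).ρ t).comp Δ) (CPerm.hom_ext fun i j => ?_) a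
  rw [StarAlgHom.comp_apply, StarAlgHom.comp_apply, permAction_q, map_smul, h i j, map_sum,
    Finset.smul_sum]
  refine Finset.sum_congr rfl fun k _ => ?_
  rw [map_mul, braidedAction_j₁, braidedAction_j₂, permAction_q, permAction_q, map_smul,
    map_smul, smul_mul_smul_comm, ← rpow_add hω]
  congr 2; ring

end Comult

/-! ### Tensor products of operators and insertion of a vector -/

section Insertion

variable {N : ℕ} [NeZero N] {ω : ℂ}
variable {H : Type u} [NormedAddCommGroup H] [InnerProductSpace ℂ H] [CompleteSpace H]
variable {K : Type v} [NormedAddCommGroup K] [InnerProductSpace ℂ K] [CompleteSpace K]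
variable {H' : Type*} [NormedAddCommGroup H'] [InnerProductSpace ℂ H'] [CompleteSpace H']
variable {K' : Type*} [NormedAddCommGroup K'] [InnerProductSpace ℂ K'] [CompleteSpace K']
variable {H'' : Type*} [NormedAddCommGroup H''] [InnerProductSpace ℂ H''] [CompleteSpace H'']
variable {K'' : Type*} [NormedAddCommGroup K''] [InnerProductSpace ℂ K''] [CompleteSpace K'']

theorem opT_comp (X : H' →L[ℂ] H'') (Y : K' →L[ℂ] K'') (X' : H →L[ℂ] H') (Y' : K →L[ℂ] K') :
    opT X Y ∘L opT X' Y' = opT (X ∘L X') (Y ∘L Y') :=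
  ext_elem fun a b => by simp [opT_elem]

theorem adjoint_opT (X : H →L[ℂ] H') (Y : K →L[ℂ] K') :
    ContinuousLinearMap.adjoint (opT X Y) =
      opT (ContinuousLinearMap.adjoint X) (ContinuousLinearMap.adjoint Y) := by
  refine (eq_adjoint_of_elem fun a b c d => ?_).symm
  rw [opT_elem, opT_elem, inner_elem, inner_elem, ContinuousLinearMap.adjoint_inner_left,
    ContinuousLinearMap.adjoint_inner_left]

theorem opT_smul_left (c : ℂ) (X : H →L[ℂ] H') (Y : K →L[ℂ] K') :
    opT (c • X) Y = c • opT X Y :=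
  ext_elem fun a b => by simp [opT_elem, elem_smul_left]

theorem opT_smul_right (c : ℂ) (X : H →L[ℂ] H') (Y : K →L[ℂ] K') :
    opT X (c • Y) = c • opT X Y :=
  ext_elem fun a b => by simp [opT_elem, elem_smul_right]

theorem opT_sum_left {ι : Type*} (s : Finset ι) (X : ι → H →L[ℂ] H') (Y : K →L[ℂ] K') :
    opT (∑ i ∈ s, X i) Y = ∑ i ∈ s, opT (X i) Y :=
  ext_elem fun a b => by simp [opT_elem, elem_sum_left]

theorem opT_sum_right {ι : Type*} (s : Finset ι) (X : H →L[ℂ] H') (Y : ι → K →L[ℂ] K') :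
    opT X (∑ i ∈ s, Y i) = ∑ i ∈ s, opT X (Y i) :=
  ext_elem fun a b => by simp [opT_elem, elem_sum_right]

theorem opT_zero_left (Y : K →L[ℂ] K') : opT (0 : H →L[ℂ] H') Y = 0 :=
  ext_elem fun a b => by simp [opT_elem, elem_zero_left]

theorem opT_zero_right (X : H →L[ℂ] H') : opT X (0 : K →L[ℂ] K') = 0 :=
  ext_elem fun a b => by simp [opT_elem, elem_zero_right]

/-- The operator `η ↦ e ⊗ η`. -/
def ins (e : H) : K →L[ℂ] HTensor H K :=
  LinearMap.mkContinuous
    { toFun := fun η => elem e η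
      map_add' := elem_add_right e
      map_smul' := fun c η => elem_smul_right c e η } ‖e‖ fun η => (norm_elem e η).le

theorem ins_apply (e : H) (η : K) : ins e η = elem e η := rfl

theorem ins_smul (c : ℂ) (e : H) : (ins (c • e) : K →L[ℂ] HTensor H K) = c • ins e :=
  ContinuousLinearMap.ext fun η => elem_smul_left c e η

theorem ins_sum {ι : Type*} (s : Finset ι) (e : ι → H) :
    (ins (∑ i ∈ s, e i) : K →L[ℂ] HTensor H K) = ∑ i ∈ s, ins (e i) :=
  ContinuousLinearMap.ext fun η => by simp [ins_apply, elem_sum_left]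

theorem opT_comp_ins (X : H →L[ℂ] H') (Y : K →L[ℂ] K') (e : H) :
    opT X Y ∘L ins e = ins (X e) ∘L Y :=
  ContinuousLinearMap.ext fun η => by simp [ins_apply, opT_elem]

theorem adjoint_ins_elem (e x : H) (η : K) :
    ContinuousLinearMap.adjoint (ins e : K →L[ℂ] HTensor H K) (elem x η) =
      (inner ℂ e x : ℂ) • η := by
  refine ext_inner_left ℂ fun y => ?_
  rw [ContinuousLinearMap.adjoint_inner_right, ins_apply, inner_elem, inner_smul_right]

theorem adjoint_ins_comp_ins (e x : H) :
    ContinuousLinearMap.adjoint (ins e : K →L[ℂ] HTensor H K) ∘L ins x =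
      (inner ℂ e x : ℂ) • ContinuousLinearMap.id ℂ K :=
  ContinuousLinearMap.ext fun η => adjoint_ins_elem e x η

theorem sum_ins_comp_adjoint_ins {ι : Type*} [Fintype ι] (b : OrthonormalBasis ι ℂ H) :
    ∑ i, ins (b i) ∘L ContinuousLinearMap.adjoint (ins (b i) : K →L[ℂ] HTensor H K) =
      ContinuousLinearMap.id ℂ _ :=
  ext_elem fun x η => by
    rw [sum_apply]
    simp only [ContinuousLinearMap.comp_apply, adjoint_ins_elem, map_smul, ins_apply,
      ← elem_smul_left, ← elem_sum_left, b.sum_repr', ContinuousLinearMap.id_apply]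

end Insertion

/-! ### Amplification along orthogonal isometries -/

section Amplify

variable {X : Type u} [NormedAddCommGroup X] [InnerProductSpace ℂ X] [CompleteSpace X]
variable {Y : Type v} [NormedAddCommGroup Y] [InnerProductSpace ℂ Y] [CompleteSpace Y]
variable {ι : Type*} [Fintype ι] [DecidableEq ι] {W : ι → X →L[ℂ] Y}

/-- The amplification of operators along isometries with orthogonal ranges that span. -/
def amplify (h₁ : ∀ i j, ContinuousLinearMap.adjoint (W i) ∘L W j =
      if i = j then ContinuousLinearMap.id ℂ X else 0)
    (h₂ : ∑ i, W i ∘L ContinuousLinearMap.adjoint (W i) = ContinuousLinearMap.id ℂ Y) :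
    (X →L[ℂ] X) →⋆ₐ[ℂ] (Y →L[ℂ] Y) where
  toFun T := ∑ i, W i ∘L T ∘L ContinuousLinearMap.adjoint (W i)
  map_one' := h₂
  map_mul' S T := by
    rw [Finset.sum_mul_sum]
    refine Finset.sum_congr rfl fun i _ => ?_
    rw [Finset.sum_eq_single i]
    · have h := fun x => congrArg (fun F : X →L[ℂ] X => F x) (h₁ i i)
      simp only [if_true, ContinuousLinearMap.comp_apply, ContinuousLinearMap.id_apply] at h
      refine ContinuousLinearMap.ext fun y => ?_
      change _ = W i (S (ContinuousLinearMap.adjoint (W i) (W i (T _))))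
      rw [h]
      rfl
    · intro j _ hj
      have h := fun x => congrArg (fun F : X →L[ℂ] X => F x) (h₁ i j)
      simp only [if_neg hj.symm, ContinuousLinearMap.comp_apply] at h
      refine ContinuousLinearMap.ext fun y => ?_
      change W i (S (ContinuousLinearMap.adjoint (W i) (W j (T _)))) = _
      rw [h]
      simp
    · simp
  map_zero' := by simp
  map_add' S T := by simp [Finset.sum_add_distrib]
  commutes' c := by
    have : (algebraMap ℂ (Y →L[ℂ] Y)) c = c • ContinuousLinearMap.id ℂ Y :=
      Algebra.algebraMap_eq_smul_one c
    rw [this, ← h₂, Finset.smul_sum]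
    refine Finset.sum_congr rfl fun i _ => ContinuousLinearMap.ext fun y => ?_
    simp [Algebra.algebraMap_eq_smul_one]
  map_star' T := by
    rw [star_sum]
    refine Finset.sum_congr rfl fun i _ => ?_
    rw [ContinuousLinearMap.star_eq_adjoint, ContinuousLinearMap.star_eq_adjoint,
      ContinuousLinearMap.adjoint_comp, ContinuousLinearMap.adjoint_comp,
      ContinuousLinearMap.adjoint_adjoint]
    rfl

/-- The ranges of the W i span, so an operator is determined by its compositions with them.
Prescribed values of the amplification thus reduce to intertwining identities. -/
theorem amplify_eq (h₁ : ∀ i j, ContinuousLinearMap.adjoint (W i) ∘L W j =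
      if i = j then ContinuousLinearMap.id ℂ X else 0)
    (h₂ : ∑ i, W i ∘L ContinuousLinearMap.adjoint (W i) = ContinuousLinearMap.id ℂ Y)
    {T : X →L[ℂ] X} {S : Y →L[ℂ] Y} (h : ∀ i, S ∘L W i = W i ∘L T) :
    amplify h₁ h₂ T = S := by
  change ∑ i, W i ∘L T ∘L ContinuousLinearMap.adjoint (W i) = S
  rw [← ContinuousLinearMap.comp_id S, ← h₂, ContinuousLinearMap.comp_finsetSum]
  refine Finset.sum_congr rfl fun i _ => ?_
  rw [← ContinuousLinearMap.comp_assoc, ← ContinuousLinearMap.comp_assoc, h]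

end Amplify

/-! ### Point masses and characters in ℓ²(ℤ/Nℤ) -/

section Characters

variable {N : ℕ} [NeZero N] {ω : ℂ}
variable {K : Type v} [NormedAddCommGroup K] [InnerProductSpace ℂ K] [CompleteSpace K]

/-- The standard basis of `ℓ²(ℤ/Nℤ)`. -/
def stdVec (t : ZMod N) : EuclideanSpace ℂ (ZMod N) := EuclideanSpace.basisFun (ZMod N) ℂ t

theorem stdVec_apply (t s : ZMod N) : stdVec t s = if s = t then (1 : ℂ) else 0 := by
  simp [stdVec]

theorem inner_stdVec (s t : ZMod N) : inner ℂ (stdVec s) (stdVec t) = if s = t then (1 : ℂ) else 0 :=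
  (orthonormal_iff_ite.1 (EuclideanSpace.basisFun (ZMod N) ℂ).orthonormal) s t

theorem czU_stdVec (r t : ZMod N) :
    (czU N (.ofAdd r) : EuclideanSpace ℂ (ZMod N) →L[ℂ] EuclideanSpace ℂ (ZMod N)) (stdVec t) =
      stdVec (t - r) := by
  ext s
  rw [czU_apply, stdVec_apply, stdVec_apply]
  simp only [eq_sub_iff_add_eq]

theorem czRep_π_apply (f : CZ N) (x : EuclideanSpace ℂ (ZMod N)) (s : ZMod N) :
    (czRep N).π f x s = f s * x s :=
  Matrix.mulVec_diagonal f _ s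

theorem czDelta_stdVec (s t : ZMod N) :
    (czRep N).π (czDelta s) (stdVec t) = if s = t then stdVec t else 0 := by
  ext r
  rw [czRep_π_apply, stdVec_apply, czDelta, Pi.single_apply]
  split_ifs with h1 h2 h3 <;> simp_all [stdVec_apply]

/-- The characters of `ℤ/Nℤ`, as vectors of `ℓ²(ℤ/Nℤ)`. -/
def charVec (ω : ℂ) (m : ZMod N) : EuclideanSpace ℂ (ZMod N) := ∑ r, rpow ω (r * m) • stdVec r

theorem czU_charVec (hω : IsPrimitiveRoot ω N) (t m : ZMod N) :
    (czU N (.ofAdd t) : EuclideanSpace ℂ (ZMod N) →L[ℂ] EuclideanSpace ℂ (ZMod N)) (charVec ω m) =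
      rpow ω (t * m) • charVec ω m := by
  rw [charVec, map_sum, Finset.smul_sum]
  refine Fintype.sum_equiv (Equiv.subRight t) _ _ fun r => ?_
  rw [map_smul, czU_stdVec, smul_smul, ← rpow_add hω, Equiv.subRight_apply]
  congr 2; ring

theorem degProj_charVec (hω : IsPrimitiveRoot ω N) (n m : ZMod N) :
    degProj ω (czU N) n (charVec ω m) = if n = m then charVec ω m else 0 := by
  have hN : (N : ℂ) ≠ 0 := Nat.cast_ne_zero.2 (NeZero.ne N)
  rw [degProj, smul_apply, sum_apply]
  simp only [smul_apply, czU_charVec hω, smul_smul, ← rpow_add hω]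
  have : ∀ t : ZMod N, -(t * n) + t * m = t * (m - n) := fun t => by ring
  rw [Finset.sum_congr rfl fun t _ => by rw [this t], ← Finset.sum_smul, sum_rpow hω]
  by_cases h : n = m
  · simp [h, smul_smul, hN]
  · simp [h, sub_eq_zero, Ne.symm h]

theorem inner_charVec (hω : IsPrimitiveRoot ω N) (m n : ZMod N) :
    inner ℂ (charVec ω m) (charVec ω n) = if m = n then (N : ℂ) else 0 := by
  have h : ∀ r : ZMod N, (starRingEnd ℂ) (rpow ω (r * m)) = rpow ω (-(r * m)) := fun r =>
    star_rpow hω _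
  have h' : ∀ r : ZMod N, inner ℂ (stdVec r) (charVec ω n) = rpow ω (r * n) := fun r => by
    simp only [charVec, inner_sum, inner_smul_right, inner_stdVec, mul_ite, mul_one, mul_zero,
      Finset.sum_ite_eq, Finset.mem_univ, if_true]
  have h'' : ∀ r : ZMod N, -(r * m) + r * n = r * (n - m) := fun r => by ring
  change inner ℂ (∑ r, rpow ω (r * m) • stdVec r) (charVec ω n) = _
  simp only [sum_inner, inner_smul_left, h, h', ← rpow_add hω, h'', sum_rpow hω, sub_eq_zero,
    eq_comm]

/-- Parseval for the characters. They are not normalized: each has squared norm N, which explains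
the factor. -/
theorem sum_ins_charVec (hω : IsPrimitiveRoot ω N) :
    ∑ m : ZMod N, ins (charVec ω m) ∘L
      ContinuousLinearMap.adjoint (ins (charVec ω m) : K →L[ℂ] HTensor _ K) =
      (N : ℂ) • ContinuousLinearMap.id ℂ _ := by
  rw [← sum_ins_comp_adjoint_ins (EuclideanSpace.basisFun (ZMod N) ℂ)]
  have h : ∀ r m : ZMod N, (starRingEnd ℂ) (rpow ω (r * m)) = rpow ω (-(r * m)) := fun r m =>
    star_rpow hω _
  have h' : ∀ s r m : ZMod N, -(r * m) + s * m = m * (s - r) := fun s r m => by ring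
  simp only [charVec, ins_sum, ins_smul, map_sum, LinearIsometryEquiv.map_smulₛₗ, h,
    ContinuousLinearMap.comp_finsetSum, ContinuousLinearMap.finsetSum_comp,
    ContinuousLinearMap.comp_smul, ContinuousLinearMap.smul_comp]
  simp only [Finset.smul_sum, smul_smul, ← rpow_add hω, h']
  rw [Finset.sum_comm]
  refine Finset.sum_congr rfl fun r _ => ?_
  rw [Finset.sum_comm]
  simp only [← Finset.sum_smul, sum_rpow hω, sub_eq_zero, ite_smul, zero_smul,
    Finset.sum_ite_eq', Finset.mem_univ, if_true]
  rfl

end Characters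

/-! ### The isometries that implement ψ on the last two factors -/

section Psi

variable {N : ℕ} [NeZero N] {ω : ℂ} (hω : IsPrimitiveRoot ω N)
variable {H : Type u} [NormedAddCommGroup H] [InnerProductSpace ℂ H] [CompleteSpace H]
variable {K : Type v} [NormedAddCommGroup K] [InnerProductSpace ℂ K] [CompleteSpace K]
variable {A : Type*} [CStarAlgebra A] {α : ZNAction N A}
variable {B : Type*} [CStarAlgebra B] {β : ZNAction N B}

/-- The m-th character has degree m, so only the m-th summand of `leg2_apply` survives. -/
theorem leg2_comp_ins_charVec (R : CovRep α H) (a : A) (m : ZMod N) :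
    leg2 hω (czRep N) R a ∘L ins (charVec ω m) = ins (charVec ω m) ∘L R.π (α.ρ (-m) a) := by
  rw [leg2_apply, ContinuousLinearMap.finsetSum_comp, Finset.sum_eq_single m]
  · rw [opT_comp_ins]
    congr 2
    exact (degProj_charVec hω m m).trans (if_pos rfl)
  · intro n _ hn
    rw [opT_comp_ins]
    have : degProj ω (czRep N).U n (charVec ω m) = 0 :=
      (degProj_charVec hω n m).trans (if_neg hn)
    rw [this]
    exact ContinuousLinearMap.ext fun x => elem_zero_left _
  · simp

theorem leg1_czDelta_comp_ins (s t : ZMod N) :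
    leg1 (K := K) (czRep N) (czDelta s) ∘L ins (stdVec t) = if s = t then ins (stdVec t) else 0 := by
  rw [leg1_apply, opT_comp_ins, czDelta_stdVec]
  refine ContinuousLinearMap.ext fun x => ?_
  split_ifs
  · rfl
  · exact elem_zero_left _

/-- A point mass is not homogeneous; its component of degree n is N⁻¹ ∑ᵣ ω^(-rn) δₜ₋ᵣ, since
translation by r sends δₜ to δₜ₋ᵣ. -/
theorem leg2_comp_ins_stdVec (S : CovRep β K) (b : B) (t : ZMod N) :
    leg2 hω (czRep N) S b ∘L ins (stdVec t) = (N : ℂ)⁻¹ • ∑ n : ZMod N, ∑ r : ZMod N,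
      rpow ω (-(r * n)) • (ins (stdVec (t - r)) ∘L S.π (β.ρ (-n) b)) := by
  rw [leg2_apply, ContinuousLinearMap.finsetSum_comp, Finset.smul_sum]
  refine Finset.sum_congr rfl fun n _ => ?_
  have : degProj ω (czRep N).U n (stdVec t) =
      (N : ℂ)⁻¹ • ∑ r : ZMod N, rpow ω (-(r * n)) • stdVec (t - r) := by
    rw [degProj, smul_apply, sum_apply]
    simp only [smul_apply]
    congr 1
    exact Finset.sum_congr rfl fun r _ => congrArg _ (czU_stdVec r t)
  rw [opT_comp_ins, this, ins_smul, ins_sum, ContinuousLinearMap.smul_comp,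
    ContinuousLinearMap.finsetSum_comp]
  simp only [ins_smul, ContinuousLinearMap.smul_comp]

/-- The isometries `H ⊗ K → (ℓ² ⊗ H) ⊗ (ℓ² ⊗ K)` that intertwine the two sides of `ψ`. -/
def psiIsom (ω : ℂ) (U : Multiplicative (ZMod N) →* unitary (H →L[ℂ] H))
    (V : Multiplicative (ZMod N) →* unitary (K →L[ℂ] K)) (p : ZMod N × ZMod N) :
    HTensor H K →L[ℂ]
      HTensor (HTensor (EuclideanSpace ℂ (ZMod N)) H) (HTensor (EuclideanSpace ℂ (ZMod N)) K) :=
  -- With p = (m, l) and χₘ the m-th character, ∑ₜ j₂(ρₜ(a)) ⊗ j₁(δₜ) acts as ρₜ₋ₘ(a) behind χₘ and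
  -- δₜ; the unitary Uₜ₋ₘ turns this back into a. The phase ω^(tl) gives N orthogonal copies, and
  -- V₋ₗ undoes the twist by ρ₋ₗ that this phase causes in j₂(b). For the constant: N orthogonal
  -- values of t and ‖χₘ‖² = N.
  (N : ℂ)⁻¹ • ∑ t, rpow ω (t * p.2) •
    opT (ins (charVec ω p.1) ∘L (U (.ofAdd (t - p.1)) : H →L[ℂ] H))
      (ins (stdVec t) ∘L (V (.ofAdd (-p.2)) : K →L[ℂ] K))

theorem adjoint_U (U : Multiplicative (ZMod N) →* unitary (H →L[ℂ] H)) (t : ZMod N) :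
    ContinuousLinearMap.adjoint (U (.ofAdd t) : H →L[ℂ] H) = U (.ofAdd (-t)) := by
  rw [← ContinuousLinearMap.star_eq_adjoint, star_U]

theorem U_comp_U (U : Multiplicative (ZMod N) →* unitary (H →L[ℂ] H)) (s t : ZMod N) :
    (U (.ofAdd s) : H →L[ℂ] H) ∘L (U (.ofAdd t) : H →L[ℂ] H) = U (.ofAdd (s + t)) :=
  U_add_apply U s t

theorem adjoint_psiIsom (hω : IsPrimitiveRoot ω N)
    (U : Multiplicative (ZMod N) →* unitary (H →L[ℂ] H))
    (V : Multiplicative (ZMod N) →* unitary (K →L[ℂ] K)) (p : ZMod N × ZMod N) :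
    ContinuousLinearMap.adjoint (psiIsom ω U V p) = (N : ℂ)⁻¹ • ∑ t, rpow ω (-(t * p.2)) •
      opT ((U (.ofAdd (-(t - p.1))) : H →L[ℂ] H) ∘L
          ContinuousLinearMap.adjoint (ins (charVec ω p.1)))
        ((V (.ofAdd p.2) : K →L[ℂ] K) ∘L ContinuousLinearMap.adjoint (ins (stdVec t))) := by
  have h : ∀ x : ZMod N, (starRingEnd ℂ) (rpow ω x) = rpow ω (-x) := fun x => star_rpow hω _
  rw [psiIsom, LinearIsometryEquiv.map_smulₛₗ, map_sum, map_inv₀, Complex.conj_natCast]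
  congr 1
  refine Finset.sum_congr rfl fun t _ => ?_
  rw [LinearIsometryEquiv.map_smulₛₗ, h, adjoint_opT, ContinuousLinearMap.adjoint_comp,
    ContinuousLinearMap.adjoint_comp, adjoint_U, adjoint_U, neg_neg]

/-- Orthogonality of the point masses forces t = t', that of the characters forces m = m'. The
remaining sum ∑ₜ ω^(t(l'-l)) forces l = l', and the constants are N⁻² · N · N = 1. -/
theorem adjoint_psiIsom_comp (hω : IsPrimitiveRoot ω N)
    (U : Multiplicative (ZMod N) →* unitary (H →L[ℂ] H))
    (V : Multiplicative (ZMod N) →* unitary (K →L[ℂ] K)) (p p' : ZMod N × ZMod N) :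
    ContinuousLinearMap.adjoint (psiIsom ω U V p) ∘L psiIsom ω U V p' =
      if p = p' then ContinuousLinearMap.id ℂ _ else 0 := by
  have hN : (N : ℂ) ≠ 0 := Nat.cast_ne_zero.2 (NeZero.ne N)
  obtain ⟨m, l⟩ := p
  obtain ⟨m', l'⟩ := p'
  have hterm : ∀ t t' : ZMod N,
      opT ((U (.ofAdd (-(t - m))) : H →L[ℂ] H) ∘L ContinuousLinearMap.adjoint (ins (charVec ω m)))
          ((V (.ofAdd l) : K →L[ℂ] K) ∘L ContinuousLinearMap.adjoint (ins (stdVec t))) ∘L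
        opT (ins (charVec ω m') ∘L (U (.ofAdd (t' - m')) : H →L[ℂ] H))
          (ins (stdVec t') ∘L (V (.ofAdd (-l')) : K →L[ℂ] K)) =
      if t = t' then (if m = m' then (N : ℂ) • opT (1 : H →L[ℂ] H)
        (V (.ofAdd (l - l')) : K →L[ℂ] K) else 0) else 0 := fun t t' => by
    rw [opT_comp, ContinuousLinearMap.comp_assoc, ContinuousLinearMap.comp_assoc,
      ← ContinuousLinearMap.comp_assoc _ (ins (charVec ω m')),
      ← ContinuousLinearMap.comp_assoc _ (ins (stdVec t')), adjoint_ins_comp_ins,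
      adjoint_ins_comp_ins, inner_stdVec, inner_charVec hω]
    by_cases ht : t = t'
    · by_cases hm : m = m'
      · subst ht hm
        simp only [if_true, one_smul, ContinuousLinearMap.smul_comp, ContinuousLinearMap.comp_smul,
          ContinuousLinearMap.id_comp, U_comp_U, opT_smul_left]
        rw [neg_add_cancel, U_zero, sub_eq_add_neg]
      · simp [hm, opT_zero_left]
    · simp [ht, opT_zero_right]
  rw [adjoint_psiIsom hω, psiIsom]
  simp only [ContinuousLinearMap.smul_comp, ContinuousLinearMap.comp_smul,
    ContinuousLinearMap.finsetSum_comp, ContinuousLinearMap.comp_finsetSum, hterm]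
  simp only [Finset.smul_sum, smul_ite, smul_zero, Finset.sum_ite_eq',
    Finset.mem_univ, if_true]
  by_cases hm : m = m'
  · subst hm
    trans ∑ t : ZMod N, ((N : ℂ)⁻¹ * (N : ℂ)⁻¹ * N * rpow ω (t * (l' - l))) •
      opT (1 : H →L[ℂ] H) (V (.ofAdd (l - l')) : K →L[ℂ] K)
    · refine Finset.sum_congr rfl fun t _ => ?_
      rw [if_pos rfl, smul_smul, smul_smul, smul_smul, smul_smul,
        show t * (l' - l) = -(t * l) + t * l' by ring, rpow_add hω]
      congr 1; ring
    · rw [← Finset.sum_smul, ← Finset.mul_sum, sum_rpow hω]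
      by_cases hl : l = l'
      · subst hl
        rw [sub_self, if_pos rfl, if_pos rfl, U_zero, opT_one,
          show (N : ℂ)⁻¹ * (N : ℂ)⁻¹ * N * N = 1 by field_simp, one_smul]
        rfl
      · simp [hl, sub_eq_zero, Ne.symm hl]
  · simp [hm]

/-- The sum over l forces t = t', after which the unitaries U cancel. What remains is completeness
of the characters in the first slot and of the point masses in the second. -/
theorem sum_psiIsom_comp_adjoint (hω : IsPrimitiveRoot ω N)
    (U : Multiplicative (ZMod N) →* unitary (H →L[ℂ] H))
    (V : Multiplicative (ZMod N) →* unitary (K →L[ℂ] K)) :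
    ∑ p, psiIsom ω U V p ∘L ContinuousLinearMap.adjoint (psiIsom ω U V p) =
      ContinuousLinearMap.id ℂ _ := by
  have hN : (N : ℂ) ≠ 0 := Nat.cast_ne_zero.2 (NeZero.ne N)
  have hterm : ∀ m l t t' : ZMod N,
      opT (ins (charVec ω m) ∘L (U (.ofAdd (t - m)) : H →L[ℂ] H))
          (ins (stdVec t) ∘L (V (.ofAdd (-l)) : K →L[ℂ] K)) ∘L
        opT ((U (.ofAdd (-(t' - m))) : H →L[ℂ] H) ∘L
            ContinuousLinearMap.adjoint (ins (charVec ω m)))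
          ((V (.ofAdd l) : K →L[ℂ] K) ∘L ContinuousLinearMap.adjoint (ins (stdVec t'))) =
      opT (ins (charVec ω m) ∘L (U (.ofAdd (t - t')) : H →L[ℂ] H) ∘L
          ContinuousLinearMap.adjoint (ins (charVec ω m)))
        (ins (stdVec t) ∘L ContinuousLinearMap.adjoint (ins (stdVec t'))) := fun m l t t' => by
    rw [opT_comp, ContinuousLinearMap.comp_assoc (ins (charVec ω m)),
      ContinuousLinearMap.comp_assoc (ins (stdVec t)),
      ← ContinuousLinearMap.comp_assoc (U (.ofAdd (t - m)) : H →L[ℂ] H),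
      ← ContinuousLinearMap.comp_assoc (V (.ofAdd (-l)) : K →L[ℂ] K), U_comp_U, U_comp_U,
      neg_add_cancel, U_zero, show t - m + -(t' - m) = t - t' by ring]
    rfl
  have hp : ∀ m l : ZMod N, psiIsom ω U V (m, l) ∘L
      ContinuousLinearMap.adjoint (psiIsom ω U V (m, l)) = ((N : ℂ)⁻¹ * (N : ℂ)⁻¹) •
      ∑ t, ∑ t', rpow ω (l * (t - t')) •
        opT (ins (charVec ω m) ∘L (U (.ofAdd (t - t')) : H →L[ℂ] H) ∘L
          ContinuousLinearMap.adjoint (ins (charVec ω m)))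
        (ins (stdVec t) ∘L ContinuousLinearMap.adjoint (ins (stdVec t'))) := fun m l => by
    rw [adjoint_psiIsom hω, psiIsom]
    simp only [ContinuousLinearMap.smul_comp, ContinuousLinearMap.comp_smul, smul_smul,
      ContinuousLinearMap.finsetSum_comp, ContinuousLinearMap.comp_finsetSum, hterm,
      Finset.smul_sum]
    rw [Finset.sum_comm]
    refine Finset.sum_congr rfl fun t _ => Finset.sum_congr rfl fun t' _ => ?_
    rw [show l * (t - t') = -(t' * l) + t * l by ring, rpow_add hω]
    congr 1; ring
  rw [Fintype.sum_prod_type]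
  simp only [hp, ← Finset.smul_sum]
  have hsum : ∀ m : ZMod N, ∑ l : ZMod N, ∑ t : ZMod N, ∑ t' : ZMod N, rpow ω (l * (t - t')) •
        opT (ins (charVec ω m) ∘L (U (.ofAdd (t - t')) : H →L[ℂ] H) ∘L
          ContinuousLinearMap.adjoint (ins (charVec ω m)))
        (ins (stdVec t) ∘L ContinuousLinearMap.adjoint (ins (stdVec t'))) =
      (N : ℂ) • opT (ins (charVec ω m) ∘L ContinuousLinearMap.adjoint
        (ins (charVec ω m) : H →L[ℂ] HTensor _ H))
        (ContinuousLinearMap.id ℂ (HTensor (EuclideanSpace ℂ (ZMod N)) K)) := fun m => by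
    rw [← sum_ins_comp_adjoint_ins (EuclideanSpace.basisFun (ZMod N) ℂ), opT_sum_right,
      Finset.smul_sum, Finset.sum_comm]
    refine Finset.sum_congr rfl fun t _ => ?_
    rw [Finset.sum_comm]
    simp only [← Finset.sum_smul, sum_rpow hω, sub_eq_zero, ite_smul, zero_smul,
      Finset.sum_ite_eq, Finset.mem_univ, if_true, sub_self, U_zero]
    rfl
  simp only [hsum, ← Finset.smul_sum, ← opT_sum_left, sum_ins_charVec hω, opT_smul_left]
  rw [smul_smul, smul_smul, show (N : ℂ)⁻¹ * (N : ℂ)⁻¹ * N * N = 1 by field_simp, one_smul]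
  exact opT_one

variable (R : CovRep α H) (S : CovRep β K)

theorem π_comp_U (t : ZMod N) (a : A) : R.π (α.ρ t a) ∘L (R.U (.ofAdd t) : H →L[ℂ] H) =
    (R.U (.ofAdd t) : H →L[ℂ] H) ∘L R.π a := by
  rw [R.covariant, star_U]
  change (R.U (.ofAdd t) : H →L[ℂ] H) * R.π a * (R.U (.ofAdd (-t)) : H →L[ℂ] H) *
    (R.U (.ofAdd t) : H →L[ℂ] H) = (R.U (.ofAdd t) : H →L[ℂ] H) * R.π a
  rw [mul_assoc, U_add_apply, neg_add_cancel, U_zero, mul_one]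

/-- The point mass δₜ selects ρₜ(a), the character χₘ twists it to ρₜ₋ₘ(a), and this passes through
Uₜ₋ₘ as a itself. -/
theorem psiIsom_leg1 (a : A) (p : ZMod N × ZMod N) :
    (∑ t : ZMod N, opT (leg2 hω (czRep N) R (α.ρ t a)) (leg1 (K := K) (czRep N) (czDelta t))) ∘L
      psiIsom ω R.U S.U p = psiIsom ω R.U S.U p ∘L leg1 R a := by
  have hterm : ∀ s t : ZMod N,
      opT (leg2 hω (czRep N) R (α.ρ s a)) (leg1 (K := K) (czRep N) (czDelta s)) ∘L
        opT (ins (charVec ω p.1) ∘L (R.U (.ofAdd (t - p.1)) : H →L[ℂ] H))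
          (ins (stdVec t) ∘L (S.U (.ofAdd (-p.2)) : K →L[ℂ] K)) =
      if s = t then opT (ins (charVec ω p.1) ∘L (R.U (.ofAdd (t - p.1)) : H →L[ℂ] H))
          (ins (stdVec t) ∘L (S.U (.ofAdd (-p.2)) : K →L[ℂ] K)) ∘L leg1 R a else 0 :=
    fun s t => by
      rw [opT_comp, ← ContinuousLinearMap.comp_assoc, ← ContinuousLinearMap.comp_assoc,
        leg1_czDelta_comp_ins, leg2_comp_ins_charVec, ContinuousLinearMap.comp_assoc, ← α.ρ_add]
      split_ifs with h
      · subst h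
        rw [neg_add_eq_sub, π_comp_U, leg1_apply, opT_comp, ContinuousLinearMap.comp_assoc]
        rfl
      · rw [ContinuousLinearMap.zero_comp, opT_zero_right]
  rw [psiIsom]
  simp only [ContinuousLinearMap.smul_comp, ContinuousLinearMap.comp_smul,
    ContinuousLinearMap.finsetSum_comp, ContinuousLinearMap.comp_finsetSum, hterm,
    Finset.sum_ite_eq', Finset.mem_univ, if_true]

/-- The degree index is shifted by l so that ρ₋₍ₙ₊ₗ₎(b) can be moved past V₋ₗ and become ρ₋ₙ(b), as
in `comp_leg2`. -/
theorem opT_leg2_comp (b : B) (m l t : ZMod N) :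
    opT 1 (leg2 hω (czRep N) S b) ∘L
        opT (ins (charVec ω m) ∘L (R.U (.ofAdd (t - m)) : H →L[ℂ] H))
          (ins (stdVec t) ∘L (S.U (.ofAdd (-l)) : K →L[ℂ] K)) =
      (N : ℂ)⁻¹ • ∑ n : ZMod N, ∑ r : ZMod N, rpow ω (-(r * (n + l))) •
        opT (ins (charVec ω m) ∘L (R.U (.ofAdd (t - m)) : H →L[ℂ] H))
          (ins (stdVec (t - r)) ∘L (S.U (.ofAdd (-l)) : K →L[ℂ] K) ∘L
            S.π (β.ρ (-n) b)) := by
  rw [opT_comp, ← ContinuousLinearMap.comp_assoc (leg2 _ _ _ _), leg2_comp_ins_stdVec,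
    ContinuousLinearMap.smul_comp, opT_smul_right, ContinuousLinearMap.finsetSum_comp,
    opT_sum_right, ← Equiv.sum_comp (Equiv.addRight l)]
  refine congrArg _ (Finset.sum_congr rfl fun n _ => ?_)
  rw [ContinuousLinearMap.finsetSum_comp, opT_sum_right]
  refine Finset.sum_congr rfl fun r _ => ?_
  rw [ContinuousLinearMap.smul_comp, opT_smul_right, ContinuousLinearMap.comp_assoc,
    Equiv.coe_addRight, show -(n + l) = -l + -n by ring, β.ρ_add, π_comp_U]
  rfl

theorem comp_leg2 (b : B) (m l t : ZMod N) :
    opT (ins (charVec ω m) ∘L (R.U (.ofAdd (t - m)) : H →L[ℂ] H))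
          (ins (stdVec t) ∘L (S.U (.ofAdd (-l)) : K →L[ℂ] K)) ∘L leg2 hω R S b =
      (N : ℂ)⁻¹ • ∑ n : ZMod N, ∑ r : ZMod N, rpow ω (-(r * n)) •
        opT (ins (charVec ω m) ∘L (R.U (.ofAdd (t + r - m)) : H →L[ℂ] H))
          (ins (stdVec t) ∘L (S.U (.ofAdd (-l)) : K →L[ℂ] K) ∘L
            S.π (β.ρ (-n) b)) := by
  rw [leg2_apply, ContinuousLinearMap.comp_finsetSum, Finset.smul_sum]
  refine Finset.sum_congr rfl fun n _ => ?_
  rw [opT_comp, ContinuousLinearMap.comp_assoc, ContinuousLinearMap.comp_assoc, degProj,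
    ContinuousLinearMap.comp_smul, ContinuousLinearMap.comp_smul, opT_smul_left,
    ContinuousLinearMap.comp_finsetSum, ContinuousLinearMap.comp_finsetSum, opT_sum_left]
  refine congrArg _ (Finset.sum_congr rfl fun r _ => ?_)
  rw [ContinuousLinearMap.comp_smul, ContinuousLinearMap.comp_smul, opT_smul_left, U_comp_U,
    show t - m + r = t + r - m by ring]

/-- Substituting t + r for t on the left turns ω^(tl) ω^(-r(n+l)) into ω^(tl) ω^(-rn). On one side
of `psiIsom_leg2` the operator j₂(b) translates the point mass, on the other it translates the
argument of U; this substitution identifies the two. -/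
theorem sum_shift_eq (hω : IsPrimitiveRoot ω N) {E : Type*} [AddCommGroup E] [Module ℂ E]
    (c : ℂ) (l : ZMod N) (F : ZMod N → ZMod N → ZMod N → E) :
    ∑ t : ZMod N, rpow ω (t * l) • c • ∑ n : ZMod N, ∑ r : ZMod N,
        rpow ω (-(r * (n + l))) • F t (t - r) n =
      ∑ t : ZMod N, rpow ω (t * l) • c • ∑ n : ZMod N, ∑ r : ZMod N,
        rpow ω (-(r * n)) • F (t + r) t n := by
  simp only [smul_comm (rpow ω _) c, ← Finset.smul_sum]
  congr 1
  simp only [Finset.smul_sum, smul_smul, ← rpow_add hω]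
  rw [Finset.sum_comm]
  conv_rhs => rw [Finset.sum_comm]
  refine Finset.sum_congr rfl fun n _ => ?_
  rw [Finset.sum_comm]
  conv_rhs => rw [Finset.sum_comm]
  refine Finset.sum_congr rfl fun r _ => ?_
  refine Fintype.sum_equiv (Equiv.subRight r) _ _ fun t => ?_
  rw [Equiv.subRight_apply, sub_add_cancel]
  congr 2; ring

theorem psiIsom_leg2 (b : B) (p : ZMod N × ZMod N) :
    opT 1 (leg2 hω (czRep N) S b) ∘L psiIsom ω R.U S.U p =
      psiIsom ω R.U S.U p ∘L leg2 hω R S b := by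
  obtain ⟨m, l⟩ := p
  rw [psiIsom, ContinuousLinearMap.comp_smul, ContinuousLinearMap.smul_comp,
    ContinuousLinearMap.comp_finsetSum, ContinuousLinearMap.finsetSum_comp]
  refine congrArg _ ?_
  simp only [ContinuousLinearMap.smul_comp, ContinuousLinearMap.comp_smul, opT_leg2_comp,
    comp_leg2]
  exact sum_shift_eq hω _ l fun t s n =>
    opT (ins (charVec ω m) ∘L (R.U (.ofAdd (t - m)) : H →L[ℂ] H))
      (ins (stdVec s) ∘L (S.U (.ofAdd (-l)) : K →L[ℂ] K) ∘L S.π (β.ρ (-n) b))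

/-- The restriction of `ψ` to the last two factors, on operators. -/
def psiOp : (HTensor H K →L[ℂ] HTensor H K) →⋆ₐ[ℂ]
    (HTensor (HTensor (EuclideanSpace ℂ (ZMod N)) H) (HTensor (EuclideanSpace ℂ (ZMod N)) K) →L[ℂ]
      HTensor (HTensor (EuclideanSpace ℂ (ZMod N)) H) (HTensor (EuclideanSpace ℂ (ZMod N)) K)) :=
  amplify (adjoint_psiIsom_comp hω R.U S.U) (sum_psiIsom_comp_adjoint hω R.U S.U)

theorem psiOp_leg1 (a : A) : psiOp hω R S (leg1 R a) =
    ∑ t : ZMod N, opT (leg2 hω (czRep N) R (α.ρ t a)) (leg1 (K := K) (czRep N) (czDelta t)) :=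
  amplify_eq _ _ (psiIsom_leg1 hω R S a)

theorem psiOp_leg2 (b : B) : psiOp hω R S (leg2 hω R S b) =
    opT 1 (leg2 hω (czRep N) S b) :=
  amplify_eq _ _ (psiIsom_leg2 hω R S b)

end Psi

/-! ### Elementary tensors in the minimal tensor product -/

section MinTmul

variable {N : ℕ} [NeZero N]
variable {H : Type u} [NormedAddCommGroup H] [InnerProductSpace ℂ H] [CompleteSpace H]
variable {K : Type v} [NormedAddCommGroup K] [InnerProductSpace ℂ K] [CompleteSpace K]
variable {A : Type*} [CStarAlgebra A] {α : ZNAction N A}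
variable {B : Type*} [CStarAlgebra B] {β : ZNAction N B}
variable (R : CovRep α H) (S : CovRep β K)

theorem minTmul_mul (a a' : A) (b b' : B) :
    minTmul R S a b * minTmul R S a' b' = minTmul R S (a * a') (b * b') :=
  Subtype.ext <| by
    change opT (R.π a) (S.π b) * opT (R.π a') (S.π b') = opT (R.π (a * a')) (S.π (b * b'))
    rw [opT_mul, map_mul, map_mul]

theorem star_minTmul (a : A) (b : B) : star (minTmul R S a b) = minTmul R S (star a) (star b) :=
  Subtype.ext <| by
    change star (opT (R.π a) (S.π b)) = opT (R.π (star a)) (S.π (star b))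
    rw [star_opT, map_star, map_star]

theorem minTmul_one : minTmul R S 1 1 = 1 :=
  Subtype.ext <| by
    change opT (R.π 1) (S.π 1) = 1
    rw [map_one, map_one, opT_one]

theorem minTmul_smul_left (c : ℂ) (a : A) (b : B) :
    minTmul R S (c • a) b = c • minTmul R S a b :=
  Subtype.ext <| by
    change opT (R.π (c • a)) (S.π b) = c • opT (R.π a) (S.π b)
    rw [map_smul, opT_smul_left]

theorem minTmul_smul_right (c : ℂ) (a : A) (b : B) :
    minTmul R S a (c • b) = c • minTmul R S a b :=
  Subtype.ext <| by
    change opT (R.π a) (S.π (c • b)) = c • opT (R.π a) (S.π b)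
    rw [map_smul, opT_smul_right]

theorem coe_sum_minTensor {ι : Type*} (s : Finset ι) (x : ι → MinTensor R S) :
    (∑ i ∈ s, x i : MinTensor R S).1 = ∑ i ∈ s, (x i).1 :=
  map_sum ((minSubalgebra R S).subtype : ↥(minSubalgebra R S) →⋆ₐ[ℂ] _) x s

theorem minTmul_sum_left {ι : Type*} (s : Finset ι) (a : ι → A) (b : B) :
    minTmul R S (∑ i ∈ s, a i) b = ∑ i ∈ s, minTmul R S (a i) b :=
  Subtype.ext <| by
    rw [coe_sum_minTensor]
    change opT (R.π (∑ i ∈ s, a i)) (S.π b) = ∑ i ∈ s, opT (R.π (a i)) (S.π b)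
    rw [map_sum, opT_sum_left]

theorem minTmul_sum_right {ι : Type*} (s : Finset ι) (a : A) (b : ι → B) :
    minTmul R S a (∑ i ∈ s, b i) = ∑ i ∈ s, minTmul R S a (b i) :=
  Subtype.ext <| by
    rw [coe_sum_minTensor]
    change opT (R.π a) (S.π (∑ i ∈ s, b i)) = ∑ i ∈ s, opT (R.π a) (S.π (b i))
    rw [map_sum, opT_sum_right]

theorem minTmul_pow (a : A) (b : B) (n : ℕ) :
    minTmul R S a b ^ n = minTmul R S (a ^ n) (b ^ n) := by
  induction n with
  | zero => rw [pow_zero, pow_zero, pow_zero, minTmul_one]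
  | succ n ih => rw [pow_succ, ih, minTmul_mul, pow_succ, pow_succ]

end MinTmul

/-! ### Existence of ψ -/

section Psi

variable {N : ℕ} [NeZero N] {ω : ℂ} (hω : IsPrimitiveRoot ω N)
variable {H : Type u} [NormedAddCommGroup H] [InnerProductSpace ℂ H] [CompleteSpace H]
variable {K : Type v} [NormedAddCommGroup K] [InnerProductSpace ℂ K] [CompleteSpace K]
variable {A : Type*} [CStarAlgebra A] {α : ZNAction N A}
variable {B : Type*} [CStarAlgebra B] {β : ZNAction N B}
variable (R : CovRep α H) (S : CovRep β K)

theorem cz_eq_sum_czDelta (f : CZ N) : f = ∑ s, f s • czDelta s := by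
  funext t
  simp [czDelta, Pi.single_apply]

theorem psiOp_mem (T : HTensor H K →L[ℂ] HTensor H K) (hT : T ∈ braided hω R S) :
    psiOp hω R S T ∈ minSubalgebra (braidedRep hω (czRep N) R) (braidedRep hω (czRep N) S) := by
  set G := minSubalgebra (braidedRep hω (czRep N) R) (braidedRep hω (czRep N) S)
  have hG : IsClosed G.carrier := isClosed_generated _
  have hle : braided hω R S ≤ G.comap (psiOp hω R S) := by
    refine StarSubalgebra.topologicalClosure_minimal (StarAlgebra.adjoin_le ?_)
      (hG.preimage (continuous_hom (psiOp hω R S)))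
    rintro _ ⟨a, b, rfl⟩
    change psiOp hω R S (leg1 R a * leg2 hω R S b) ∈ G
    rw [map_mul, psiOp_leg1, psiOp_leg2]
    refine mul_mem (sum_mem fun t _ => ?_) ?_
    · exact (minTmul (braidedRep hω (czRep N) R) (braidedRep hω (czRep N) S)
        (j₂ hω (czRep N) R (α.ρ t a)) (j₁ hω (czRep N) S (czDelta t))).2
    · exact (minTmul (braidedRep hω (czRep N) R) (braidedRep hω (czRep N) S)
        1 (j₂ hω (czRep N) S b)).2
  exact hle hT

/-- The restriction of `ψ` to the last two factors. -/
def psiAux : BraidedTensor hω R S →⋆ₐ[ℂ]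
    MinTensor (braidedRep hω (czRep N) R) (braidedRep hω (czRep N) S) :=
  ((psiOp hω R S).comp (braidedRep hω R S).π).codRestrict
    (minSubalgebra (braidedRep hω (czRep N) R) (braidedRep hω (czRep N) S))
    fun T => psiOp_mem hω R S T.1 T.2

theorem psiAux_j₁ (a : A) : psiAux hω R S (j₁ hω R S a) =
    ∑ t : ZMod N, minTmul (braidedRep hω (czRep N) R) (braidedRep hω (czRep N) S)
      (j₂ hω (czRep N) R (α.ρ t a)) (j₁ hω (czRep N) S (czDelta t)) :=
  Subtype.ext <| by
    rw [coe_sum_minTensor]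
    exact psiOp_leg1 hω R S a

theorem psiAux_j₂ (b : B) : psiAux hω R S (j₂ hω R S b) =
    minTmul (braidedRep hω (czRep N) R) (braidedRep hω (czRep N) S) 1 (j₂ hω (czRep N) S b) :=
  Subtype.ext (psiOp_leg2 hω R S b)

theorem minTmul_czGen_mem_unitary :
    minTmul (braidedRep hω (czRep N) R) (braidedRep hω (czRep N) S)
      (j₁ hω (czRep N) R (czGen ω)) (j₁ hω (czRep N) S (czGen ω)) ∈ unitary _ := by
  have h1 := (boson_covPair hω R).mem_unitary
  have h2 := (boson_covPair hω S).mem_unitary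
  rw [Unitary.mem_iff, star_minTmul, minTmul_mul, minTmul_mul, Unitary.star_mul_self_of_mem h1,
    Unitary.star_mul_self_of_mem h2, Unitary.mul_star_self_of_mem h1,
    Unitary.mul_star_self_of_mem h2, minTmul_one]
  exact ⟨rfl, rfl⟩

/-- It suffices to test the two legs. In j₂(ρₜ(a)) ⊗ j₁(δₜ) the first z applies ρ₁, while the second
commutes with δₜ. In 1 ⊗ j₂(b) the first z cancels and the second applies ρ₁. -/
theorem psiAux_covPair : CovPair (braidedAction hω R S) (psiAux hω R S)
    (minTmul (braidedRep hω (czRep N) R) (braidedRep hω (czRep N) S)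
      (j₁ hω (czRep N) R (czGen ω)) (j₁ hω (czRep N) S (czGen ω))) where
  mem_unitary := minTmul_czGen_mem_unitary hω R S
  pow_eq_one := by
    rw [minTmul_pow, (boson_covPair hω R).pow_eq_one, (boson_covPair hω S).pow_eq_one, minTmul_one]
  covariant T := by
    set v := minTmul (braidedRep hω (czRep N) R) (braidedRep hω (czRep N) S)
      (j₁ hω (czRep N) R (czGen ω)) (j₁ hω (czRep N) S (czGen ω)) with hv
    let u : unitary (MinTensor (braidedRep hω (czRep N) R) (braidedRep hω (czRep N) S)) :=
      ⟨v, minTmul_czGen_mem_unitary hω R S⟩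
    have h1 := boson_covPair hω R
    have h2 := boson_covPair hω S
    have hδ : ∀ t : ZMod N, j₁ hω (czRep N) S (czGen ω) * j₁ hω (czRep N) S (czDelta t) *
        star (j₁ hω (czRep N) S (czGen ω)) = j₁ hω (czRep N) S (czDelta t) := fun t => by
      rw [← map_mul, mul_comm, map_mul, mul_assoc, Unitary.mul_star_self_of_mem h2.mem_unitary,
        mul_one]
    refine DFunLike.congr_fun
      (f := ((Unitary.conjStarAlgAut ℂ _ u : _ ≃⋆ₐ[ℂ] _) : _ →⋆ₐ[ℂ] _).comp (psiAux hω R S))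
      (g := (psiAux hω R S).comp ((braidedAction hω R S).ρ 1))
      (braidedTensor_hom_ext hω R S (fun a => ?_) fun b => ?_) T
    · change v * psiAux hω R S (j₁ hω R S a) * star v = _
      rw [StarAlgHom.comp_apply, braidedAction_j₁, psiAux_j₁, psiAux_j₁, Finset.mul_sum,
        Finset.sum_mul]
      refine Finset.sum_congr rfl fun t _ => ?_
      rw [hv, star_minTmul, minTmul_mul, minTmul_mul, h1.covariant, hδ, ← α.ρ_add, ← α.ρ_add,
        add_comm]
    · change v * psiAux hω R S (j₂ hω R S b) * star v = _
      rw [StarAlgHom.comp_apply, braidedAction_j₂, psiAux_j₂, psiAux_j₂, hv, star_minTmul,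
        minTmul_mul, minTmul_mul, h2.covariant, mul_one,
        Unitary.mul_star_self_of_mem h1.mem_unitary]

/-- The image of `f` under `(j₁ ⊗ j₁) ∘ Δ`, as a linear map. -/
def comultZ : CZ N →ₗ[ℂ] MinTensor (braidedRep hω (czRep N) R) (braidedRep hω (czRep N) S) where
  toFun f := ∑ s : ZMod N, ∑ t : ZMod N,
    f (s + t) • minTmul (braidedRep hω (czRep N) R) (braidedRep hω (czRep N) S)
      (j₁ hω (czRep N) R (czDelta s)) (j₁ hω (czRep N) S (czDelta t))
  map_add' f g := by simp [add_smul, Finset.sum_add_distrib]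
  map_smul' c f := by simp [Finset.smul_sum, mul_smul]

/-- The powers of z are characters: zᵏ(s + t) = zᵏ(s) zᵏ(t), so the double sum factors. -/
theorem comultZ_pow (k : ZMod N) : comultZ hω R S (czGen ω ^ k.val) =
    minTmul (braidedRep hω (czRep N) R) (braidedRep hω (czRep N) S)
      (j₁ hω (czRep N) R (czGen ω)) (j₁ hω (czRep N) S (czGen ω)) ^ k.val := by
  rw [minTmul_pow, ← map_pow, ← map_pow]
  conv_rhs => rw [cz_eq_sum_czDelta (czGen ω ^ k.val), map_sum, map_sum, minTmul_sum_left]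
  refine Finset.sum_congr rfl fun s _ => ?_
  rw [minTmul_sum_right]
  refine Finset.sum_congr rfl fun t _ => ?_
  rw [map_smul, map_smul, minTmul_smul_left, minTmul_smul_right, smul_smul, czGen_pow hω,
    czGen_pow hω, czGen_pow hω, ← rpow_add hω, add_mul]

/-- The triple product is the crossed product of X ⊠ Y, so the covariant pair formed by `psiAux` and
z ⊗ z extends to it. The condition on all f follows from the powers of z. -/
theorem exists_isPsi : ∃ ψ, IsPsi hω R S ψ := by
  have hc := psiAux_covPair hω R S
  obtain ⟨ψ, ⟨hz, hψ⟩, -⟩ := (boson_isCrossedProduct hω (braidedRep hω R S)).universal _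
    (psiAux hω R S) _ hc.mem_unitary hc.pow_eq_one hc.covariant
  have hψ' : ∀ x, ψ (j₂ hω (czRep N) (braidedRep hω R S) x) = psiAux hω R S x := fun x =>
    DFunLike.congr_fun hψ x
  refine ⟨ψ, fun f => ?_, fun a => ?_, fun b => ?_⟩
  · refine LinearMap.congr_fun (f := ψ.toAlgHom.toLinearMap ∘ₗ
      (j₁ hω (czRep N) (braidedRep hω R S)).toAlgHom.toLinearMap) (g := comultZ hω R S)
      (cz_linearMap_ext hω fun k => ?_) f
    rw [comultZ_pow, ← hz, ← map_pow, ← map_pow]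
    rfl
  · rw [hψ', psiAux_j₁]
  · rw [hψ', psiAux_j₂]

theorem IsPsi.czGen {R : CovRep α H} {S : CovRep β K}
    {ψ : BraidedTensor hω (czRep N) (braidedRep hω R S) →⋆ₐ[ℂ]
      MinTensor (braidedRep hω (czRep N) R) (braidedRep hω (czRep N) S)}
    (h : IsPsi hω R S ψ) : ψ (j₁ hω (czRep N) (braidedRep hω R S) (czGen ω)) =
      minTmul (braidedRep hω (czRep N) R) (braidedRep hω (czRep N) S)
        (j₁ hω (czRep N) R (czGen ω)) (j₁ hω (czRep N) S (czGen ω)) := by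
  have := comultZ_pow hω R S 1
  rw [pow_val_one (czGen_pow_eq_one hω), pow_val_one (psiAux_covPair hω R S).pow_eq_one] at this
  exact (h.1 _).trans this

end Psi

/-! ### The comultiplication of the bosonization -/

section Comult

variable {N : ℕ} [NeZero N] {ω : ℂ} (hω : IsPrimitiveRoot ω N)
variable {L : Type u} [NormedAddCommGroup L] [InnerProductSpace ℂ L] [CompleteSpace L]
variable (R : CovRep (permAction hω) L)

/-- The homomorphism `id ⊠ Δ`. -/
theorem exists_id_boxtimes {Δ : CPerm N ω →⋆ₐ[ℂ] BraidedTensor hω R R} (h : IsPermComult hω R Δ) :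
    ∃ idΔ : Boson hω R →⋆ₐ[ℂ] BraidedTensor hω (czRep N) (braidedRep hω R R),
      ∀ (f : CZ N) (a : CPerm N ω), idΔ (j₁ hω (czRep N) R f * j₂ hω (czRep N) R a) =
        j₁ hω (czRep N) (braidedRep hω R R) f * j₂ hω (czRep N) (braidedRep hω R R) (Δ a) := by
  have hc := boson_covPair hω (braidedRep hω R R)
  -- The pair of j₂ ∘ Δ and z is covariant because z implements the braided action and Δ is
  -- equivariant.
  obtain ⟨Φ, ⟨hz, hΦ⟩, -⟩ := (boson_isCrossedProduct hω R).universal _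
    ((j₂ hω (czRep N) (braidedRep hω R R)).comp Δ) _ hc.mem_unitary hc.pow_eq_one fun a => by
      rw [StarAlgHom.comp_apply, hc.covariant, StarAlgHom.comp_apply, h.equivariant]
  refine ⟨Φ, fun f a => ?_⟩
  rw [map_mul]
  congr 1
  · refine LinearMap.congr_fun (f := Φ.toAlgHom.toLinearMap ∘ₗ
      (j₁ hω (czRep N) R).toAlgHom.toLinearMap)
      (g := (j₁ hω (czRep N) (braidedRep hω R R)).toAlgHom.toLinearMap)
      (cz_linearMap_ext hω fun k => ?_) f
    change Φ (j₁ hω (czRep N) R (czGen ω ^ k.val)) =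
      j₁ hω (czRep N) (braidedRep hω R R) (czGen ω ^ k.val)
    rw [map_pow, map_pow, hz, map_pow]
  · exact DFunLike.congr_fun hΦ a

variable {R}

theorem IsBosonComult.bosonZ {Δ : CPerm N ω →⋆ₐ[ℂ] BraidedTensor hω R R}
    {D : Boson hω R →⋆ₐ[ℂ] BosonSq hω R} (hD : IsBosonComult hω R Δ D) :
    D (bosonZ hω R) = bosonTmul hω R (bosonZ hω R) (bosonZ hω R) := by
  obtain ⟨idΔ, ψ, hid, hψ, rfl⟩ := hD
  have h := hid (Anyonic.czGen ω) 1
  rw [map_one, map_one, map_one, mul_one, mul_one] at h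
  rw [StarAlgHom.comp_apply, Anyonic.bosonZ, h, hψ.czGen]
  rfl

/-- Applying ψ to the first leg gives ∑ₜ ω^(t(k-i)) q i k ⊗ δₜ. The scalars move to the second
factor, where they assemble into z^(k-i). -/
theorem IsBosonComult.bosonQ {Δ : CPerm N ω →⋆ₐ[ℂ] BraidedTensor hω R R}
    (hΔ : IsPermComult hω R Δ) {D : Boson hω R →⋆ₐ[ℂ] BosonSq hω R}
    (hD : IsBosonComult hω R Δ D) (i j : ZMod N) :
    D (bosonQ hω R i j) = ∑ k : ZMod N, bosonTmul hω R (bosonQ hω R i k)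
      (Anyonic.bosonZ hω R ^ (k - i).val * bosonQ hω R k j) := by
  obtain ⟨idΔ, ψ, hid, ⟨-, h1, h2⟩, rfl⟩ := hD
  have h := hid 1 (CPerm.q ω i j)
  rw [map_one, map_one, one_mul, one_mul] at h
  rw [StarAlgHom.comp_apply, Anyonic.bosonQ, h, hΔ i j, map_sum, map_sum]
  refine Finset.sum_congr rfl fun k _ => ?_
  rw [map_mul, map_mul, h1, h2, Anyonic.bosonZ, ← map_pow,
    cz_eq_sum_czDelta (czGen ω ^ (k - i).val), map_sum, Finset.sum_mul, Finset.sum_mul, bosonTmul,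
    minTmul_sum_right]
  refine Finset.sum_congr rfl fun t _ => ?_
  rw [minTmul_mul, mul_one, permAction_q, map_smul, minTmul_smul_left, map_smul, smul_mul_assoc,
    minTmul_smul_right, czGen_pow hω]
  rfl

theorem existsUnique_bosonComult {Δ : CPerm N ω →⋆ₐ[ℂ] BraidedTensor hω R R}
    (hΔ : IsPermComult hω R Δ) :
    ∃! D : Boson hω R →⋆ₐ[ℂ] BosonSq hω R, IsBosonComult hω R Δ D := by
  obtain ⟨idΔ, hid⟩ := exists_id_boxtimes hω R hΔ
  obtain ⟨ψ, hψ⟩ := exists_isPsi hω R R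
  have hD : IsBosonComult hω R Δ (ψ.comp idΔ) := ⟨idΔ, ψ, hid, hψ, rfl⟩
  -- The formulas on z and q i j hold for any admissible D, whatever id ⊠ Δ and ψ it comes from, so
  -- two such D agree on generators.
  refine ⟨_, hD, fun D' hD' => eq_of_generated_eq_top (boson_generated_q hω R) ?_⟩
  rintro _ (rfl | ⟨i, j, rfl⟩)
  · rw [hD'.bosonZ, hD.bosonZ]
  · rw [hD'.bosonQ hω hΔ, hD.bosonQ hω hΔ]

end Comult

end

end Anyonic

theorem theorem3 (N : ℕ) [NeZero N] (ω : ℂ) (hω : IsPrimitiveRoot ω N)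
    (L : Type u) [NormedAddCommGroup L] [InnerProductSpace ℂ L] [CompleteSpace L]
    (R : CovRep (permAction hω) L) :
    IsUniversalBoson.{_, w} ω (bosonZ hω R) (bosonQ hω R) ∧
    IsCrossedProduct.{_, _, w} (permAction hω) (j₂ hω (czRep N) R) (bosonZ hω R) ∧
    (∃! Δ : CPerm N ω →⋆ₐ[ℂ] BraidedTensor hω R R, IsPermComult hω R Δ) ∧
    (∀ Δ : CPerm N ω →⋆ₐ[ℂ] BraidedTensor hω R R, IsPermComult hω R Δ →
      (∃! D : Boson hω R →⋆ₐ[ℂ] BosonSq hω R, IsBosonComult hω R Δ D) ∧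
      ∀ D : Boson hω R →⋆ₐ[ℂ] BosonSq hω R, IsBosonComult hω R Δ D →
        D (bosonZ hω R) = bosonTmul hω R (bosonZ hω R) (bosonZ hω R) ∧
        ∀ i j : ZMod N, D (bosonQ hω R i j) =
          ∑ k : ZMod N, bosonTmul hω R (bosonQ hω R i k)
            (bosonZ hω R ^ (k - i).val * bosonQ hω R k j)) := by
  exact ⟨boson_isUniversal hω R, boson_isCrossedProduct hω R, existsUnique_permComult hω R,
    fun Δ hΔ => ⟨existsUnique_bosonComult hω hΔ, fun D hD =>
      ⟨hD.bosonZ, hD.bosonQ hω hΔ⟩⟩⟩
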